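/- For $0<\beta\le 1$ let $\mathbf C_\beta$ be the complex plane with the line element $|z|^{\beta-1}|dz|$, a flat cone of total angle $2\pi\beta$. Let $0<\beta,\gamma\le 1$ and let $(z,w)$ be the coordinates on the product cone $\mathbf C_\beta\times\mathbf C_\gamma$, with metric $g=|z|^{2\beta-2}|dz|^2+|w|^{2\gamma-2}|dw|^2$, apex $0$ and dilations $D_t(z,w)=(t^{1/\beta}z,t^{1/\gamma}w)$, $t>0$. A real function $u$ on it is called harmonic if $u\in W^{1,2}_{\mathrm{loc}}$ and $\int\langle\nabla u,\nabla\varphi\rangle_g\,d\mathrm{vol}_g=0$ for all test functions $\varphi$, and homogeneous of degree $d$ if $u\circ D_t=t^d u$ for all $t>0$ (functions being identified when they agree almost everywhere). Let $\mathcal H_{\le 2}$ be the space spanned by the homogeneous harmonic functions of degree $d\in[0,2]$, regarded as a subspace of $L^2(B_R,d\mathrm{vol}_g)$ for any ball $B_R$, $R>0$, about the apex. **Proposition.** The following functions are homogeneous harmonic of degree in $[0,2]$, and $\mathcal H_{\le 2}$ is spanned by them: - the constant $1$; - the real and imaginary parts of $z$ if $\beta\ge 1/2$, and those of $z^2$ if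 $\beta=1$; - the real and imaginary parts of $w$ if $\gamma\ge 1/2$, and those of $w^2$ if $\gamma=1$; - the real and imaginary parts of $zw$ and of $z\bar w$ if $\beta=\gamma=1$; - the quadratic harmonic function $\beta^{-2}|z|^{2\beta}-\gamma^{-2}|w|^{2\gamma}$. -/

import Mathlib

open MeasureTheory

noncomputable section

namespace ConeProduct

/-- The Riemannian volume of `ℂ_β × ℂ_γ` in the coordinates `(z, w)`, where `ℂ_β` is `ℂ` with the
line element `|z|^(β-1) |dz|` (a flat cone of total angle `2πβ`): it has density
`|z|^(2β-2) |w|^(2γ-2)` with respect to Lebesgue measure. -/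
def vol (β γ : ℝ) : Measure (ℂ × ℂ) :=
  volume.withDensity fun p =>
    ENNReal.ofReal (‖p.1‖ ^ (2 * β - 2) * ‖p.2‖ ^ (2 * γ - 2))

/-- The inner product of two real covectors at the point `p`, for the metric
`|z|^(2β-2) |dz|² + |w|^(2γ-2) |dw|²`. -/
def coInner (β γ : ℝ) (p : ℂ × ℂ) (a b : ℂ × ℂ →L[ℝ] ℝ) : ℝ :=
  ‖p.1‖ ^ (2 - 2 * β) * (a (1, 0) * b (1, 0) + a (Complex.I, 0) * b (Complex.I, 0)) +
    ‖p.2‖ ^ (2 - 2 * γ) * (a (0, 1) * b (0, 1) + a (0, Complex.I) * b (0, Complex.I))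

/-- Smooth test functions with compact support. -/
def IsTest (φ : ℂ × ℂ → ℝ) : Prop :=
  ContDiff ℝ (⊤ : ℕ∞) φ ∧ HasCompactSupport φ

/-- `G` is the weak (distributional) differential of `u`. -/
def IsWeakDifferential (u : ℂ × ℂ → ℝ) (G : ℂ × ℂ → (ℂ × ℂ →L[ℝ] ℝ)) : Prop :=
  LocallyIntegrable u ∧ LocallyIntegrable G ∧
    ∀ φ : ℂ × ℂ → ℝ, IsTest φ → ∀ e : ℂ × ℂ,
      ∫ p, u p * fderiv ℝ φ p e = -∫ p, G p e * φ p

/-- `u ∈ W^{1,2}_loc(ℂ_β × ℂ_γ)` with differential `G`: both `u²` and `|du|²` are locally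
integrable for the metric and the volume of the cone. -/
def IsLocSobolev (β γ : ℝ) (u : ℂ × ℂ → ℝ) (G : ℂ × ℂ → (ℂ × ℂ →L[ℝ] ℝ)) : Prop :=
  IsWeakDifferential u G ∧
    LocallyIntegrable (fun p => u p ^ 2) (vol β γ) ∧
    LocallyIntegrable (fun p => coInner β γ p (G p) (G p)) (vol β γ)

/-- `u` is a (weakly) harmonic function on `ℂ_β × ℂ_γ`: it lies in `W^{1,2}_loc` and
`∫ ⟨du, dφ⟩ = 0` for all test functions `φ`. -/
def IsHarmonic (β γ : ℝ) (u : ℂ × ℂ → ℝ) : Prop :=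
  ∃ G : ℂ × ℂ → (ℂ × ℂ →L[ℝ] ℝ), IsLocSobolev β γ u G ∧
    ∀ φ : ℂ × ℂ → ℝ, IsTest φ →
      ∫ p, coInner β γ p (G p) (fderiv ℝ φ p) ∂(vol β γ) = 0

/-- The dilation of the cone `ℂ_β × ℂ_γ` by the factor `t > 0`. -/
def dilation (β γ t : ℝ) (p : ℂ × ℂ) : ℂ × ℂ :=
  (((t ^ (1 / β) : ℝ) : ℂ) * p.1, ((t ^ (1 / γ) : ℝ) : ℂ) * p.2)

/-- `u` is homogeneous of degree `d` on the cone (functions are taken up to null sets). -/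
def IsHomogeneous (β γ d : ℝ) (u : ℂ × ℂ → ℝ) : Prop :=
  ∀ t : ℝ, 0 < t → ∀ᵐ p : ℂ × ℂ, u (dilation β γ t p) = t ^ d * u p

/-- Homogeneous harmonic functions of some degree `d ∈ [0, 2]`. -/
def IsSubquadraticHarmonic (β γ : ℝ) (u : ℂ × ℂ → ℝ) : Prop :=
  IsHarmonic β γ u ∧ ∃ d : ℝ, 0 ≤ d ∧ d ≤ 2 ∧ IsHomogeneous β γ d u

/-- The distance to the apex; the distance from `0` to `z` in `ℂ_β` is `|z|^β / β`. -/
def rho (β γ : ℝ) (p : ℂ × ℂ) : ℝ :=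
  Real.sqrt ((‖p.1‖ ^ β / β) ^ 2 + (‖p.2‖ ^ γ / γ) ^ 2)

/-- The volume of the cone restricted to the ball of radius `R` about the apex. -/
def ballVol (β γ R : ℝ) : Measure (ℂ × ℂ) :=
  (vol β γ).restrict {p | rho β γ p < R}

/-- The subspace of `L²(B_R)` spanned by (the classes of) a set of functions on the cone. -/
def spanL2 (β γ R : ℝ) (S : Set (ℂ × ℂ → ℝ)) : Submodule ℝ (Lp ℝ 2 (ballVol β γ R)) :=
  Submodule.span ℝ {f | ∃ u ∈ S, f =ᵐ[ballVol β γ R] u}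

/-- The space `H_{≤2}`, as a subspace of `L²(B_R)`. -/
def subquadraticHarmonics (β γ R : ℝ) : Submodule ℝ (Lp ℝ 2 (ballVol β γ R)) :=
  spanL2 β γ R {u | IsSubquadraticHarmonic β γ u}

/-- The real and imaginary parts of a complex function. -/
def reIm (h : ℂ × ℂ → ℂ) : Set (ℂ × ℂ → ℝ) :=
  {fun p => (h p).re, fun p => (h p).im}

/-- The explicit list of spanning functions. -/
def explicitList (β γ : ℝ) : Set (ℂ × ℂ → ℝ) :=
  {v | v = (fun _ => 1) ∨
    (1 / 2 ≤ β ∧ v ∈ reIm fun p => p.1) ∨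
    (β = 1 ∧ v ∈ reIm fun p => p.1 ^ 2) ∨
    (1 / 2 ≤ γ ∧ v ∈ reIm fun p => p.2) ∨
    (γ = 1 ∧ v ∈ reIm fun p => p.2 ^ 2) ∨
    (β = 1 ∧ γ = 1 ∧ v ∈ reIm fun p => p.1 * p.2) ∨
    (β = 1 ∧ γ = 1 ∧ v ∈ reIm fun p => p.1 * (starRingEnd ℂ) p.2) ∨
    v = fun p => ‖p.1‖ ^ (2 * β) / β ^ 2 - ‖p.2‖ ^ (2 * γ) / γ ^ 2}

end ConeProduct

end

/-!
Let `r²` be the squared distance to the apex and let `h` run over the functions `Re (c z^m w^n)`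
and `Re (c z^m \bar w^n)`. They are harmonic, so for `x = |z|^(2β) / β²` and `y = |w|^(2γ) / γ²` the
Laplacian of `h F(x, y)` is again of the form `h G(x, y)`, with `G` obtained from `F` by an explicit
operator. Testing a harmonic function `u` of degree `d` against regularisations of `h F(x, y)`, and
using that homogeneity turns radial derivatives into factors, gives recursions between the moments
`∫ u h x^k y^l Y(r²)`. Since `d ≤ 2`, these recursions force all moments to vanish as soon as
`u` is orthogonal to those `h` that have degree `d` and, if `d = 2`, to `x - y`. The resonant `h`
and `x - y` are exactly the explicit functions of degree `d`.

By Stone-Weierstrass a function without moments vanishes near the apex, hence everywhere by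
homogeneity. Applied to `u` minus its `L²`-projection onto the explicit functions of degree `d`,
this gives the theorem.
-/

noncomputable section

open Filter Topology Set
open scoped InnerProductSpace Laplacian

namespace ConeProduct

/-! ### The density of the cone -/

/-- The density `|z|^(2α-2)` of the area of the cone `ℂ_α` with respect to Lebesgue measure. -/
def wt (α : ℝ) (z : ℂ) : ℝ := ‖z‖ ^ (2 * α - 2)

lemma wt_nonneg (α : ℝ) (z : ℂ) : 0 ≤ wt α z := Real.rpow_nonneg (norm_nonneg _) _

lemma wt_pos (α : ℝ) {z : ℂ} (hz : z ≠ 0) : 0 < wt α z :=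
  Real.rpow_pos_of_pos (norm_pos_iff.2 hz) _

@[fun_prop]
lemma measurable_wt (α : ℝ) : Measurable (wt α) := by unfold wt; fun_prop

lemma locallyIntegrable_norm_rpow {r : ℝ} (hr : -2 < r) :
    LocallyIntegrable (fun z : ℂ => ‖z‖ ^ r) := by
  rw [locallyIntegrable_iff]
  intro K hK
  obtain ⟨R, hR⟩ := hK.isBounded.subset_ball (0 : ℂ)
  refine IntegrableOn.mono_set ?_ hR
  rw [integrableOn_fun_norm_addHaar (volume : Measure ℂ) (f := fun x : ℝ => x ^ r) (r := R),
    Complex.finrank_real_complex]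
  rcases le_or_gt R 0 with hR0 | hR0
  · rw [Set.Ioo_eq_empty (by simpa using hR0)]
    exact integrableOn_empty
  · have hpow : IntegrableOn (fun y : ℝ => y ^ (r + 1)) (Ioo 0 R) := by
      rw [← integrableOn_Ioc_iff_integrableOn_Ioo,
        ← intervalIntegrable_iff_integrableOn_Ioc_of_le hR0.le]
      exact intervalIntegral.intervalIntegrable_rpow' (by linarith)
    refine hpow.congr_fun (fun y hy => ?_) measurableSet_Ioo
    simp only [Nat.add_one_sub_one, pow_one, smul_eq_mul]
    rw [Real.rpow_add hy.1, Real.rpow_one, mul_comm]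

lemma locallyIntegrable_mul_prod {f g : ℂ → ℝ} (hf : LocallyIntegrable f)
    (hg : LocallyIntegrable g) : LocallyIntegrable (fun p : ℂ × ℂ => f p.1 * g p.2) := by
  rw [locallyIntegrable_iff]
  intro K hK
  have hfg := Integrable.mul_prod (hf.integrableOn_isCompact (hK.image continuous_fst))
    (hg.integrableOn_isCompact (hK.image continuous_snd))
  rw [Measure.prod_restrict] at hfg
  exact IntegrableOn.mono_set hfg fun p hp => ⟨⟨p, hp, rfl⟩, ⟨p, hp, rfl⟩⟩

lemma locallyIntegrable_norm_rpow_mul {r s : ℝ} (hr : -2 < r) (hs : -2 < s) :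
    LocallyIntegrable (fun p : ℂ × ℂ => ‖p.1‖ ^ r * ‖p.2‖ ^ s) :=
  locallyIntegrable_mul_prod (locallyIntegrable_norm_rpow hr) (locallyIntegrable_norm_rpow hs)

lemma ae_fst_ne_zero : ∀ᵐ p : ℂ × ℂ, p.1 ≠ 0 :=
  Measure.quasiMeasurePreserving_fst.ae (p := fun z : ℂ => z ≠ 0) (μb := volume)
    (by rw [ae_iff]; simp)

lemma ae_snd_ne_zero : ∀ᵐ p : ℂ × ℂ, p.2 ≠ 0 :=
  Measure.quasiMeasurePreserving_snd.ae (p := fun z : ℂ => z ≠ 0) (μb := volume)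
    (by rw [ae_iff]; simp)

/-- The density `|z|^(2β-2) |w|^(2γ-2)` of `vol β γ` with respect to Lebesgue measure. -/
def density (β γ : ℝ) (p : ℂ × ℂ) : ℝ := wt β p.1 * wt γ p.2

lemma density_nonneg (β γ : ℝ) (p : ℂ × ℂ) : 0 ≤ density β γ p :=
  mul_nonneg (wt_nonneg _ _) (wt_nonneg _ _)

@[fun_prop]
lemma measurable_density (β γ : ℝ) : Measurable (density β γ) := by unfold density; fun_prop

lemma ae_density_pos (β γ : ℝ) : ∀ᵐ p : ℂ × ℂ, 0 < density β γ p := by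
  filter_upwards [ae_fst_ne_zero, ae_snd_ne_zero] with p hz hw
  exact mul_pos (wt_pos _ hz) (wt_pos _ hw)

lemma locallyIntegrable_density {β γ : ℝ} (hβ : 0 < β) (hγ : 0 < γ) :
    LocallyIntegrable (density β γ) :=
  locallyIntegrable_norm_rpow_mul (by linarith) (by linarith)

lemma vol_eq (β γ : ℝ) :
    vol β γ = volume.withDensity fun p => ENNReal.ofReal (density β γ p) := rfl

lemma vol_absolutelyContinuous (β γ : ℝ) : vol β γ ≪ volume :=
  withDensity_absolutelyContinuous _ _

lemma absolutelyContinuous_vol (β γ : ℝ) : (volume : Measure (ℂ × ℂ)) ≪ vol β γ := by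
  refine withDensity_absolutelyContinuous' (by fun_prop) ?_
  filter_upwards [ae_density_pos β γ] with p hp
  exact (ENNReal.ofReal_pos.2 hp).ne'

lemma integral_vol (β γ : ℝ) (f : ℂ × ℂ → ℝ) :
    ∫ p, f p ∂(vol β γ) = ∫ p, density β γ p * f p := by
  rw [vol_eq, integral_withDensity_eq_integral_toReal_smul (by fun_prop) (by simp)]
  simp [ENNReal.toReal_ofReal, density_nonneg]

lemma integrable_vol_iff {β γ : ℝ} {f : ℂ × ℂ → ℝ} :
    Integrable f (vol β γ) ↔ Integrable (fun p => density β γ p * f p) := by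
  rw [vol_eq, integrable_withDensity_iff_integrable_smul' (by fun_prop) (by simp)]
  simp [ENNReal.toReal_ofReal, density_nonneg]

lemma locallyIntegrable_vol_iff {β γ : ℝ} {f : ℂ × ℂ → ℝ} :
    LocallyIntegrable f (vol β γ) ↔ LocallyIntegrable (fun p => density β γ p * f p) := by
  rw [locallyIntegrable_iff, locallyIntegrable_iff]
  refine forall₂_congr fun K hK => ?_
  rw [IntegrableOn, vol_eq, restrict_withDensity hK.measurableSet,
    integrable_withDensity_iff_integrable_smul' (by fun_prop) (by simp)]
  simp [ENNReal.toReal_ofReal, density_nonneg, IntegrableOn]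

lemma locallyIntegrable_vol_of_continuous {β γ : ℝ} (hβ : 0 < β) (hγ : 0 < γ) {f : ℂ × ℂ → ℝ}
    (hf : Continuous f) : LocallyIntegrable f (vol β γ) := by
  rw [locallyIntegrable_vol_iff, ← locallyIntegrableOn_univ]
  exact ((locallyIntegrableOn_univ.2 (locallyIntegrable_density hβ hγ)).mul_continuousOn
    hf.continuousOn isOpen_univ.isLocallyClosed)

/-! ### The four coordinate directions -/

/-- The directions `∂_x, ∂_y` in `z = x + iy` and then in `w = x + iy`. -/
def coordVec : Fin 4 → ℂ × ℂ := ![(1, 0), (Complex.I, 0), (0, 1), (0, Complex.I)]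

/-- The complex coordinate that is constant along the direction `coordVec i`. -/
def transverse : Fin 4 → (ℂ × ℂ →L[ℝ] ℂ) :=
  ![.snd ℝ ℂ ℂ, .snd ℝ ℂ ℂ, .fst ℝ ℂ ℂ, .fst ℝ ℂ ℂ]

/-- The cone parameter of the coordinate `transverse i`. -/
def transverseExp (β γ : ℝ) : Fin 4 → ℝ := ![γ, γ, β, β]

/-- The weight of the direction `coordVec i` in the Dirichlet form: by conformal invariance of the
energy in dimension two, only the density of the transverse cone remains. -/
def coordWt (β γ : ℝ) (i : Fin 4) (p : ℂ × ℂ) : ℝ := wt (transverseExp β γ i) (transverse i p)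

lemma transverse_coordVec (i : Fin 4) : transverse i (coordVec i) = 0 := by
  fin_cases i <;> simp [transverse, coordVec]

lemma ae_transverse_ne_zero (i : Fin 4) : ∀ᵐ p : ℂ × ℂ, transverse i p ≠ 0 := by
  fin_cases i
  exacts [ae_snd_ne_zero, ae_snd_ne_zero, ae_fst_ne_zero, ae_fst_ne_zero]

lemma transverseExp_le_one {β γ : ℝ} (hβ : β ≤ 1) (hγ : γ ≤ 1) (i : Fin 4) :
    transverseExp β γ i ≤ 1 := by
  fin_cases i <;> simpa [transverseExp]

lemma coordWt_nonneg (β γ : ℝ) (i : Fin 4) (p : ℂ × ℂ) : 0 ≤ coordWt β γ i p := wt_nonneg _ _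

lemma ae_coordWt_pos (β γ : ℝ) (i : Fin 4) : ∀ᵐ p, 0 < coordWt β γ i p := by
  filter_upwards [ae_transverse_ne_zero i] with p hp using wt_pos _ hp

@[fun_prop]
lemma measurable_coordWt (β γ : ℝ) (i : Fin 4) : Measurable (coordWt β γ i) := by
  unfold coordWt; fun_prop

lemma locallyIntegrable_wt_fst {α : ℝ} (hα : 0 < α) :
    LocallyIntegrable fun p : ℂ × ℂ => wt α p.1 := by
  simpa [wt] using locallyIntegrable_norm_rpow_mul (r := 2 * α - 2) (s := 0) (by linarith)
    (by norm_num)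

lemma locallyIntegrable_wt_snd {α : ℝ} (hα : 0 < α) :
    LocallyIntegrable fun p : ℂ × ℂ => wt α p.2 := by
  simpa [wt] using locallyIntegrable_norm_rpow_mul (r := 0) (s := 2 * α - 2) (by norm_num)
    (by linarith)

lemma locallyIntegrable_coordWt {β γ : ℝ} (hβ : 0 < β) (hγ : 0 < γ) (i : Fin 4) :
    LocallyIntegrable (coordWt β γ i) := by
  fin_cases i
  exacts [locallyIntegrable_wt_snd hγ, locallyIntegrable_wt_snd hγ,
    locallyIntegrable_wt_fst hβ, locallyIntegrable_wt_fst hβ]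

lemma sum_coordWt_mul (β γ : ℝ) (p : ℂ × ℂ) (c : Fin 4 → ℝ) :
    ∑ i, coordWt β γ i p * c i = wt γ p.2 * (c 0 + c 1) + wt β p.1 * (c 2 + c 3) := by
  rw [Fin.sum_univ_four]
  change wt γ p.2 * c 0 + wt γ p.2 * c 1 + wt β p.1 * c 2 + wt β p.1 * c 3 = _
  ring

lemma density_mul_coInner {β γ : ℝ} {p : ℂ × ℂ} (hz : p.1 ≠ 0) (hw : p.2 ≠ 0)
    (a b : ℂ × ℂ →L[ℝ] ℝ) :
    density β γ p * coInner β γ p a b =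
      ∑ i, coordWt β γ i p * (a (coordVec i) * b (coordVec i)) := by
  have inv_fst : wt β p.1 * ‖p.1‖ ^ (2 - 2 * β) = 1 := by
    rw [wt, ← Real.rpow_add (norm_pos_iff.2 hz)]; simp
  have inv_snd : wt γ p.2 * ‖p.2‖ ^ (2 - 2 * γ) = 1 := by
    rw [wt, ← Real.rpow_add (norm_pos_iff.2 hw)]; simp
  rw [sum_coordWt_mul, coInner, density]
  simp only [coordVec, Matrix.cons_val]
  linear_combination (wt γ p.2 * (a (1, 0) * b (1, 0) + a (Complex.I, 0) * b (Complex.I, 0))) *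
    inv_fst + (wt β p.1 * (a (0, 1) * b (0, 1) + a (0, Complex.I) * b (0, Complex.I))) * inv_snd

lemma ae_density_mul_coInner (β γ : ℝ) (G : ℂ × ℂ → (ℂ × ℂ →L[ℝ] ℝ))
    (H : ℂ × ℂ → (ℂ × ℂ →L[ℝ] ℝ)) :
    ∀ᵐ p, density β γ p * coInner β γ p (G p) (H p) =
      ∑ i, coordWt β γ i p * (G p (coordVec i) * H p (coordVec i)) := by
  filter_upwards [ae_fst_ne_zero, ae_snd_ne_zero] with p hz hw
  exact density_mul_coInner hz hw _ _

/-! ### Local integrability of weighted Sobolev functions -/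

lemma locallyIntegrable_mul_of_sq {E : Type*} [MeasurableSpace E] [TopologicalSpace E]
    {μ : Measure E} {a b f : E → ℝ} (hb : AEStronglyMeasurable b μ)
    (hf : AEStronglyMeasurable f μ) (ha : ∀ᵐ p ∂μ, 0 < a p)
    (haf : LocallyIntegrable (fun p => a p * f p ^ 2) μ)
    (hba : LocallyIntegrable (fun p => b p ^ 2 / a p) μ) :
    LocallyIntegrable (fun p => b p * f p) μ := by
  refine (haf.add hba).mono (hb.mul hf) ?_
  filter_upwards [ha] with p hp
  have young : |b p * f p| ≤ a p * f p ^ 2 + b p ^ 2 / a p := by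
    rw [← sub_nonneg, ← sq_abs (f p), ← sq_abs (b p), abs_mul]
    have : a p * |f p| ^ 2 + |b p| ^ 2 / a p - |b p| * |f p| =
        (a p * |f p| - |b p| / 2) ^ 2 / a p + 3 / 4 * |b p| ^ 2 / a p := by
      field_simp; ring
    rw [this]; positivity
  exact young.trans (le_abs_self _)

section Sobolev

variable {β γ : ℝ} {u : ℂ × ℂ → ℝ} {G : ℂ × ℂ → (ℂ × ℂ →L[ℝ] ℝ)}

lemma IsLocSobolev.locallyIntegrable (h : IsLocSobolev β γ u G) : LocallyIntegrable u := h.1.1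

lemma IsLocSobolev.aestronglyMeasurable (h : IsLocSobolev β γ u G) : AEStronglyMeasurable u :=
  h.locallyIntegrable.aestronglyMeasurable

lemma IsLocSobolev.aestronglyMeasurable_apply (h : IsLocSobolev β γ u G) (e : ℂ × ℂ) :
    AEStronglyMeasurable fun p => G p e := by
  have := h.1.2.1.aestronglyMeasurable
  fun_prop

lemma IsLocSobolev.locallyIntegrable_vol (hβ : 0 < β) (hγ : 0 < γ) (h : IsLocSobolev β γ u G) :
    LocallyIntegrable u (vol β γ) := by
  rw [locallyIntegrable_vol_iff]
  refine locallyIntegrable_mul_of_sq (a := density β γ)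
    (measurable_density β γ).aestronglyMeasurable h.aestronglyMeasurable
    (ae_density_pos β γ) (locallyIntegrable_vol_iff.1 h.2.1) ?_
  simpa only [sq, mul_self_div_self] using locallyIntegrable_density hβ hγ

lemma wt_sq_div_mul (α α' : ℝ) (z w : ℂ) :
    wt α' w ^ 2 / (wt α z * wt α' w) = ‖z‖ ^ (2 - 2 * α) * wt α' w := by
  have hneg : (2 - 2 * α : ℝ) = -(2 * α - 2) := by ring
  rw [sq, mul_comm (wt α z), mul_div_mul_comm, hneg, Real.rpow_neg (norm_nonneg _), ← wt]
  rcases eq_or_ne (wt α' w) 0 with h0 | h0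
  · simp [h0]
  · field_simp

lemma locallyIntegrable_coordWt_sq_div_density (hβ : 0 < β) (hβ1 : β ≤ 1) (hγ : 0 < γ)
    (hγ1 : γ ≤ 1) (i : Fin 4) :
    LocallyIntegrable fun p => coordWt β γ i p ^ 2 / density β γ p := by
  have horizontal : LocallyIntegrable fun p : ℂ × ℂ => wt γ p.2 ^ 2 / density β γ p := by
    refine (locallyIntegrable_norm_rpow_mul (r := 2 - 2 * β) (s := 2 * γ - 2) (by linarith)
      (by linarith)).congr (ae_of_all _ fun p => ?_)
    exact (wt_sq_div_mul β γ p.1 p.2).symm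
  have vertical : LocallyIntegrable fun p : ℂ × ℂ => wt β p.1 ^ 2 / density β γ p := by
    refine (locallyIntegrable_norm_rpow_mul (r := 2 * β - 2) (s := 2 - 2 * γ) (by linarith)
      (by linarith)).congr (ae_of_all _ fun p => ?_)
    dsimp only
    rw [density, mul_comm (wt β p.1), wt_sq_div_mul γ β, wt, mul_comm]
  fin_cases i
  exacts [horizontal, horizontal, vertical, vertical]

lemma IsLocSobolev.locallyIntegrable_coordWt_mul (hβ : 0 < β) (hβ1 : β ≤ 1) (hγ : 0 < γ)
    (hγ1 : γ ≤ 1) (h : IsLocSobolev β γ u G) (i : Fin 4) :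
    LocallyIntegrable fun p => coordWt β γ i p * u p :=
  locallyIntegrable_mul_of_sq (measurable_coordWt β γ i).aestronglyMeasurable
    h.aestronglyMeasurable (ae_density_pos β γ) (locallyIntegrable_vol_iff.1 h.2.1)
    (locallyIntegrable_coordWt_sq_div_density hβ hβ1 hγ hγ1 i)

lemma IsLocSobolev.locallyIntegrable_coordWt_mul_sq (h : IsLocSobolev β γ u G) (i : Fin 4) :
    LocallyIntegrable fun p => coordWt β γ i p * G p (coordVec i) ^ 2 := by
  refine (locallyIntegrable_vol_iff.1 h.2.2).mono
    ((measurable_coordWt β γ i).aestronglyMeasurable.mul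
      ((h.aestronglyMeasurable_apply _).pow 2)) ?_
  filter_upwards [ae_density_mul_coInner β γ G G] with p hp
  have hsq (j : Fin 4) : 0 ≤ coordWt β γ j p * G p (coordVec j) ^ 2 :=
    mul_nonneg (coordWt_nonneg _ _ _ _) (sq_nonneg _)
  rw [hp, Real.norm_of_nonneg (hsq i)]
  refine le_trans ?_ (le_abs_self _)
  simp only [← sq]
  exact Finset.single_le_sum (f := fun j => coordWt β γ j p * G p (coordVec j) ^ 2)
    (fun j _ => hsq j) (Finset.mem_univ i)

lemma IsLocSobolev.locallyIntegrable_coordWt_mul_apply (hβ : 0 < β) (hγ : 0 < γ)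
    (h : IsLocSobolev β γ u G) (i : Fin 4) :
    LocallyIntegrable fun p => coordWt β γ i p * G p (coordVec i) := by
  refine locallyIntegrable_mul_of_sq (a := coordWt β γ i)
    (measurable_coordWt β γ i).aestronglyMeasurable (h.aestronglyMeasurable_apply _)
    (ae_coordWt_pos β γ i) (h.locallyIntegrable_coordWt_mul_sq i) ?_
  simpa only [sq, mul_self_div_self] using locallyIntegrable_coordWt hβ hγ i

end Sobolev

/-! ### Weighted integration by parts -/

/-- The smooth regularisation `(|z|² + δ)^(α-1)` of the weight `wt α`. -/
def regWt (α δ : ℝ) (z : ℂ) : ℝ := (‖z‖ ^ 2 + δ) ^ (α - 1)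

lemma wt_eq_norm_sq (α : ℝ) (z : ℂ) : wt α z = (‖z‖ ^ 2) ^ (α - 1) := by
  rw [wt, ← Real.rpow_natCast, ← Real.rpow_mul (norm_nonneg z)]
  norm_num
  ring_nf

lemma contDiff_regWt (α : ℝ) {δ : ℝ} (hδ : 0 < δ) : ContDiff ℝ (⊤ : ℕ∞) (regWt α δ) :=
  ((contDiff_norm_sq ℝ).add contDiff_const).rpow_const_of_ne fun z => by positivity

lemma regWt_nonneg (α : ℝ) {δ : ℝ} (hδ : 0 < δ) (z : ℂ) : 0 ≤ regWt α δ z :=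
  Real.rpow_nonneg (by positivity) _

lemma regWt_le {α δ : ℝ} (hα : α ≤ 1) (hδ : 0 < δ) {z : ℂ} (hz : z ≠ 0) :
    regWt α δ z ≤ wt α z := by
  have := norm_pos_iff.2 hz
  rw [wt_eq_norm_sq]
  exact Real.rpow_le_rpow_of_nonpos (by positivity) (by linarith) (by linarith)

lemma tendsto_regWt (α : ℝ) {z : ℂ} (hz : z ≠ 0) {ι : Type*} {l : Filter ι} {δ : ι → ℝ}
    (hδ : Tendsto δ l (𝓝 0)) : Tendsto (fun n => regWt α (δ n) z) l (𝓝 (wt α z)) := by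
  have := norm_pos_iff.2 hz
  rw [wt_eq_norm_sq]
  have h : Tendsto (fun n => ‖z‖ ^ 2 + δ n) l (𝓝 (‖z‖ ^ 2)) := by simpa using hδ.const_add _
  exact h.rpow_const (Or.inl (by positivity))

section DirectionalDerivative

variable {E : Type*} [NormedAddCommGroup E] [NormedSpace ℝ E]

/-- The derivative of `φ` in the direction `e`, as a function. -/
def dirD (e : E) (φ : E → ℝ) : E → ℝ := fun p => fderiv ℝ φ p e

lemma contDiff_dirD {φ : E → ℝ} (h : ContDiff ℝ (⊤ : ℕ∞) φ) (e : E) :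
    ContDiff ℝ (⊤ : ℕ∞) (dirD e φ) :=
  (h.fderiv_right (m := ((⊤ : ℕ∞) : WithTop ℕ∞)) (by simp)).clm_apply contDiff_const

lemma dirD_mul {φ ψ : E → ℝ} (hφ : Differentiable ℝ φ) (hψ : Differentiable ℝ ψ) (e : E) (p : E) :
    dirD e (fun p => φ p * ψ p) p = φ p * dirD e ψ p + dirD e φ p * ψ p := by
  unfold dirD
  rw [fderiv_fun_mul (hφ p) (hψ p)]
  simp [mul_comm]

lemma dirD_comp_clm {F : Type*} [NormedAddCommGroup F] [NormedSpace ℝ F] {f : F → ℝ}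
    (hf : Differentiable ℝ f) (τ : E →L[ℝ] F) (e p : E) :
    dirD e (fun p => f (τ p)) p = dirD (τ e) f (τ p) := by
  have : HasFDerivAt (fun p => f (τ p)) ((fderiv ℝ f (τ p)).comp τ) p :=
    (hf (τ p)).hasFDerivAt.comp p τ.hasFDerivAt
  rw [dirD, this.fderiv, dirD, ContinuousLinearMap.comp_apply]

end DirectionalDerivative

section Test

variable {φ : ℂ × ℂ → ℝ}

lemma IsTest.dirD (h : IsTest φ) (e : ℂ × ℂ) : IsTest (dirD e φ) :=
  ⟨contDiff_dirD h.1 e, h.2.fderiv_apply ℝ e⟩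

lemma IsTest.mul_left {ψ : ℂ × ℂ → ℝ} (h : IsTest φ) (hψ : ContDiff ℝ (⊤ : ℕ∞) ψ) :
    IsTest (fun p => ψ p * φ p) :=
  ⟨hψ.mul h.1, h.2.mul_left⟩

lemma IsTest.integrable_mul {f : ℂ × ℂ → ℝ} (h : IsTest φ) (hf : LocallyIntegrable f) :
    Integrable (fun p => f p * φ p) :=
  hf.integrable_smul_right_of_hasCompactSupport h.1.continuous h.2

instance isAddHaarMeasure_volume_prod : (volume : Measure (ℂ × ℂ)).IsAddHaarMeasure :=
  inferInstanceAs ((volume : Measure ℂ).prod (volume : Measure ℂ)).IsAddHaarMeasure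

lemma integral_mul_dirD {U : ℂ × ℂ → ℝ} (hU : ContDiff ℝ (⊤ : ℕ∞) U) (h : IsTest φ)
    (e : ℂ × ℂ) : ∫ p, U p * dirD e φ p = -∫ p, dirD e U p * φ p :=
  integral_mul_fderiv_eq_neg_fderiv_mul_of_integrable
    (h.integrable_mul (contDiff_dirD hU e).continuous.locallyIntegrable)
    ((h.dirD e).integrable_mul hU.continuous.locallyIntegrable)
    (h.integrable_mul hU.continuous.locallyIntegrable)
    (fun p _ => hU.differentiable (by simp) p) (fun p _ => h.1.differentiable (by simp) p)

lemma tendsto_integral_regWt_mul {α : ℝ} (hα : α ≤ 1) {τ : ℂ × ℂ →L[ℝ] ℂ}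
    (hτ : ∀ᵐ p, τ p ≠ 0) {δ : ℕ → ℝ} (hδ : ∀ n, 0 < δ n) (hδ0 : Tendsto δ atTop (𝓝 0))
    {f : ℂ × ℂ → ℝ} (hf : AEStronglyMeasurable f)
    (hwf : LocallyIntegrable fun p => wt α (τ p) * f p) (hφ : IsTest φ) :
    Tendsto (fun n => ∫ p, f p * (regWt α (δ n) (τ p) * φ p)) atTop
      (𝓝 (∫ p, wt α (τ p) * f p * φ p)) := by
  refine tendsto_integral_filter_of_dominated_convergence (fun p => ‖wt α (τ p) * f p * φ p‖)
    (Eventually.of_forall fun n => ?_) (Eventually.of_forall fun n => ?_)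
    (hφ.integrable_mul hwf).norm ?_
  · exact hf.mul ((((contDiff_regWt α (hδ n)).continuous.comp τ.continuous).mul
      hφ.1.continuous).aestronglyMeasurable)
  · filter_upwards [hτ] with p hp
    rw [mul_left_comm, mul_assoc, norm_mul, norm_mul (wt _ _),
      Real.norm_of_nonneg (regWt_nonneg _ (hδ n) _), Real.norm_of_nonneg (wt_nonneg _ _)]
    exact mul_le_mul_of_nonneg_right (regWt_le hα (hδ n) hp) (norm_nonneg _)
  · filter_upwards [hτ] with p hp
    convert ((tendsto_regWt α hp hδ0).mul_const (φ p)).const_mul (f p) using 2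
    ring

/-- The weight is constant along `e`, so it passes through the derivative; regularising it makes
`regWt · φ` an admissible test function. -/
lemma integral_wt_mul_dirD {α : ℝ} (hα : α ≤ 1) {τ : ℂ × ℂ →L[ℝ] ℂ} (hτ : ∀ᵐ p, τ p ≠ 0)
    {e : ℂ × ℂ} (hτe : τ e = 0) {u g : ℂ × ℂ → ℝ}
    (hug : ∀ ψ, IsTest ψ → ∫ p, u p * dirD e ψ p = -∫ p, g p * ψ p)
    (hu : AEStronglyMeasurable u) (hg : AEStronglyMeasurable g)
    (hwu : LocallyIntegrable fun p => wt α (τ p) * u p)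
    (hwg : LocallyIntegrable fun p => wt α (τ p) * g p) (hφ : IsTest φ) :
    ∫ p, wt α (τ p) * u p * dirD e φ p = -∫ p, wt α (τ p) * g p * φ p := by
  have hδ (n : ℕ) : (0 : ℝ) < 1 / ((n : ℝ) + 1) := Nat.one_div_pos_of_nat
  have hδ0 := tendsto_one_div_add_atTop_nhds_zero_nat (𝕜 := ℝ)
  refine tendsto_nhds_unique (tendsto_integral_regWt_mul hα hτ hδ hδ0 hu hwu (hφ.dirD e)) ?_
  refine (tendsto_integral_regWt_mul hα hτ hδ hδ0 hg hwg hφ).neg.congr fun n => ?_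
  have hreg : ContDiff ℝ (⊤ : ℕ∞) fun p => regWt α (1 / ((n : ℝ) + 1)) (τ p) :=
    (contDiff_regWt α (hδ n)).comp τ.contDiff
  rw [← hug _ (hφ.mul_left hreg)]
  congr 1; ext p
  rw [dirD_mul (hreg.differentiable (by simp)) (hφ.1.differentiable (by simp)),
    dirD_comp_clm ((contDiff_regWt α (hδ n)).differentiable (by simp)), hτe, dirD, dirD, map_zero,
    zero_mul, add_zero]

end Test

/-! ### Very weak solutions -/

/-- The Laplace operator of the cone multiplied by the density of its volume. -/
def coneLap (β γ : ℝ) (φ : ℂ × ℂ → ℝ) (p : ℂ × ℂ) : ℝ :=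
  ∑ i, coordWt β γ i p * dirD (coordVec i) (dirD (coordVec i) φ) p

lemma measurable_coneLap {β γ : ℝ} {φ : ℂ × ℂ → ℝ} (hφ : ContDiff ℝ (⊤ : ℕ∞) φ) :
    Measurable (coneLap β γ φ) :=
  Finset.measurable_fun_sum _ fun i _ =>
    (measurable_coordWt β γ i).mul (contDiff_dirD (contDiff_dirD hφ _) _).continuous.measurable

lemma integral_sum_coordWt_mul {β γ : ℝ} {f : Fin 4 → ℂ × ℂ → ℝ}
    (hf : ∀ i, LocallyIntegrable fun p => coordWt β γ i p * f i p) {ψ : Fin 4 → ℂ × ℂ → ℝ}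
    (hψ : ∀ i, IsTest (ψ i)) :
    ∫ p, ∑ i, coordWt β γ i p * (f i p * ψ i p) =
      ∑ i, ∫ p, coordWt β γ i p * f i p * ψ i p := by
  simp only [← mul_assoc]
  exact integral_finsetSum _ fun i _ => (hψ i).integrable_mul (hf i)

lemma mul_coneLap (β γ : ℝ) (u φ : ℂ × ℂ → ℝ) (p : ℂ × ℂ) :
    u p * coneLap β γ φ p =
      ∑ i, coordWt β γ i p * (u p * dirD (coordVec i) (dirD (coordVec i) φ) p) := by
  rw [coneLap, Finset.mul_sum]
  exact Finset.sum_congr rfl fun i _ => mul_left_comm _ _ _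

lemma integrable_mul_coneLap {β γ : ℝ} {u φ : ℂ × ℂ → ℝ}
    (hu : ∀ i, LocallyIntegrable fun p => coordWt β γ i p * u p) (hφ : IsTest φ) :
    Integrable fun p => u p * coneLap β γ φ p := by
  simp only [mul_coneLap, ← mul_assoc]
  exact integrable_finsetSum _ fun i _ => ((hφ.dirD _).dirD _).integrable_mul (hu i)

section Sobolev

variable {β γ : ℝ} {u U φ : ℂ × ℂ → ℝ} {G : ℂ × ℂ → (ℂ × ℂ →L[ℝ] ℝ)}

lemma IsLocSobolev.integral_coInner_fderiv (hβ : 0 < β) (hβ1 : β ≤ 1) (hγ : 0 < γ)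
    (hγ1 : γ ≤ 1) (h : IsLocSobolev β γ u G) (hφ : IsTest φ) :
    ∫ p, coInner β γ p (G p) (fderiv ℝ φ p) ∂(vol β γ) = -∫ p, u p * coneLap β γ φ p := by
  have ibp (i : Fin 4) :
      ∫ p, coordWt β γ i p * u p * dirD (coordVec i) (dirD (coordVec i) φ) p =
        -∫ p, coordWt β γ i p * G p (coordVec i) * dirD (coordVec i) φ p :=
    integral_wt_mul_dirD (transverseExp_le_one hβ1 hγ1 i) (ae_transverse_ne_zero i)
      (transverse_coordVec i) (fun ψ hψ => h.1.2.2 ψ hψ _) h.aestronglyMeasurable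
      (h.aestronglyMeasurable_apply _) (h.locallyIntegrable_coordWt_mul hβ hβ1 hγ hγ1 i)
      (h.locallyIntegrable_coordWt_mul_apply hβ hγ i) (hφ.dirD _)
  calc ∫ p, coInner β γ p (G p) (fderiv ℝ φ p) ∂(vol β γ)
      = ∫ p, ∑ i, coordWt β γ i p * (G p (coordVec i) * dirD (coordVec i) φ p) := by
        rw [integral_vol]
        exact integral_congr_ae (ae_density_mul_coInner β γ G (fderiv ℝ φ))
    _ = ∑ i, ∫ p, coordWt β γ i p * G p (coordVec i) * dirD (coordVec i) φ p :=
        integral_sum_coordWt_mul (h.locallyIntegrable_coordWt_mul_apply hβ hγ) fun i => hφ.dirD _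
    _ = -∑ i, ∫ p, coordWt β γ i p * u p * dirD (coordVec i) (dirD (coordVec i) φ) p := by
        simp only [ibp, Finset.sum_neg_distrib, neg_neg]
    _ = -∫ p, u p * coneLap β γ φ p := by
        simp only [mul_coneLap]
        rw [integral_sum_coordWt_mul (h.locallyIntegrable_coordWt_mul hβ hβ1 hγ hγ1)
          fun i => (hφ.dirD _).dirD _]

lemma locallyIntegrable_coordWt_mul_of_continuous (hβ : 0 < β) (hγ : 0 < γ) (i : Fin 4)
    (hU : Continuous U) : LocallyIntegrable fun p => coordWt β γ i p * U p := by
  rw [← locallyIntegrableOn_univ]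
  exact (locallyIntegrableOn_univ.2 (locallyIntegrable_coordWt hβ hγ i)).mul_continuousOn
    hU.continuousOn isOpen_univ.isLocallyClosed

lemma integral_mul_coneLap_comm (hβ : 0 < β) (hβ1 : β ≤ 1) (hγ : 0 < γ) (hγ1 : γ ≤ 1)
    (hU : ContDiff ℝ (⊤ : ℕ∞) U) (hφ : IsTest φ) :
    ∫ p, U p * coneLap β γ φ p = ∫ p, coneLap β γ U p * φ p := by
  have ibp {V : ℂ × ℂ → ℝ} (hV : ContDiff ℝ (⊤ : ℕ∞) V) (i : Fin 4) {ψ : ℂ × ℂ → ℝ}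
      (hψ : IsTest ψ) : ∫ p, coordWt β γ i p * V p * dirD (coordVec i) ψ p =
        -∫ p, coordWt β γ i p * dirD (coordVec i) V p * ψ p :=
    integral_wt_mul_dirD (transverseExp_le_one hβ1 hγ1 i) (ae_transverse_ne_zero i)
      (transverse_coordVec i) (fun ψ hψ => integral_mul_dirD hV hψ _)
      hV.continuous.aestronglyMeasurable (contDiff_dirD hV _).continuous.aestronglyMeasurable
      (locallyIntegrable_coordWt_mul_of_continuous hβ hγ i hV.continuous)
      (locallyIntegrable_coordWt_mul_of_continuous hβ hγ i (contDiff_dirD hV _).continuous) hψ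
  have hswap (p : ℂ × ℂ) : coneLap β γ U p * φ p =
      ∑ i, coordWt β γ i p * (dirD (coordVec i) (dirD (coordVec i) U) p * φ p) := by
    simp only [coneLap, Finset.sum_mul, mul_assoc]
  simp only [mul_coneLap, hswap]
  rw [integral_sum_coordWt_mul (f := fun _ => U)
      (fun i => locallyIntegrable_coordWt_mul_of_continuous hβ hγ i hU.continuous)
      (fun i => (hφ.dirD _).dirD _),
    integral_sum_coordWt_mul (ψ := fun _ => φ)
      (fun i => locallyIntegrable_coordWt_mul_of_continuous hβ hγ i
        (contDiff_dirD (contDiff_dirD hU _) _).continuous) (fun _ => hφ)]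
  refine Finset.sum_congr rfl fun i _ => ?_
  rw [ibp hU i (hφ.dirD _), ibp (contDiff_dirD hU _) i hφ, neg_neg]

/-- The functions that solve the Laplace equation after both derivatives have been moved to the
test function, with the integrability needed to make sense of it. In contrast with `IsHarmonic`,
linearity is immediate. -/
def veryWeakSolutions (β γ : ℝ) : Submodule ℝ (ℂ × ℂ → ℝ) where
  carrier := {u | LocallyIntegrable u (vol β γ) ∧
    (∀ i, LocallyIntegrable fun p => coordWt β γ i p * u p) ∧
    ∀ φ, IsTest φ → ∫ p, u p * coneLap β γ φ p = 0}
  zero_mem' := ⟨locallyIntegrable_zero, fun _ => by simpa using locallyIntegrable_zero, by simp⟩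
  add_mem' := by
    rintro u v ⟨hu, hwu, hu0⟩ ⟨hv, hwv, hv0⟩
    refine ⟨hu.add hv, fun i => ?_, fun φ hφ => ?_⟩
    · simp only [Pi.add_apply, mul_add]
      exact (hwu i).add (hwv i)
    · simp only [Pi.add_apply, add_mul]
      rw [integral_add (integrable_mul_coneLap hwu hφ) (integrable_mul_coneLap hwv hφ), hu0 φ hφ,
        hv0 φ hφ, add_zero]
  smul_mem' := by
    rintro c u ⟨hu, hwu, hu0⟩
    refine ⟨hu.smul c, fun i => ?_, fun φ hφ => ?_⟩
    · simp only [Pi.smul_apply, smul_eq_mul, mul_left_comm _ c]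
      exact (hwu i).smul c
    · simp only [Pi.smul_apply, smul_eq_mul, mul_assoc, integral_const_mul, hu0 φ hφ, mul_zero]

lemma IsHarmonic.mem_veryWeakSolutions (hβ : 0 < β) (hβ1 : β ≤ 1) (hγ : 0 < γ) (hγ1 : γ ≤ 1)
    (h : IsHarmonic β γ u) : u ∈ veryWeakSolutions β γ := by
  obtain ⟨G, hG, hH⟩ := h
  refine ⟨hG.locallyIntegrable_vol hβ hγ, hG.locallyIntegrable_coordWt_mul hβ hβ1 hγ hγ1,
    fun φ hφ => ?_⟩
  rw [← neg_eq_zero, ← hG.integral_coInner_fderiv hβ hβ1 hγ hγ1 hφ, hH φ hφ]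

lemma IsLocSobolev.isHarmonic (hβ : 0 < β) (hβ1 : β ≤ 1) (hγ : 0 < γ) (hγ1 : γ ≤ 1)
    (h : IsLocSobolev β γ u G) (hu : ∀ φ, IsTest φ → ∫ p, u p * coneLap β γ φ p = 0) :
    IsHarmonic β γ u :=
  ⟨G, h, fun φ hφ => by rw [h.integral_coInner_fderiv hβ hβ1 hγ hγ1 hφ, hu φ hφ, neg_zero]⟩

lemma isLocSobolev_of_contDiff (hβ : 0 < β) (hγ : 0 < γ) (hU : ContDiff ℝ (⊤ : ℕ∞) U) :
    IsLocSobolev β γ U (fderiv ℝ U) := by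
  have hdU : Continuous (fderiv ℝ U) := hU.continuous_fderiv (by simp)
  refine ⟨⟨hU.continuous.locallyIntegrable, hdU.locallyIntegrable,
    fun φ hφ e => integral_mul_dirD hU hφ e⟩,
    locallyIntegrable_vol_of_continuous hβ hγ (hU.continuous.pow 2), ?_⟩
  rw [locallyIntegrable_vol_iff]
  have hsum : LocallyIntegrable fun p => ∑ i, coordWt β γ i p *
      (fderiv ℝ U p (coordVec i) * fderiv ℝ U p (coordVec i)) :=
    locallyIntegrable_finsetSum _ fun i _ =>
      locallyIntegrable_coordWt_mul_of_continuous hβ hγ i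
        ((hdU.clm_apply continuous_const).mul (hdU.clm_apply continuous_const))
  refine hsum.congr ?_
  filter_upwards [ae_density_mul_coInner β γ (fderiv ℝ U) (fderiv ℝ U)] with p hp using hp.symm

lemma isHarmonic_of_contDiff (hβ : 0 < β) (hβ1 : β ≤ 1) (hγ : 0 < γ) (hγ1 : γ ≤ 1)
    (hU : ContDiff ℝ (⊤ : ℕ∞) U) (h : ∀ p, coneLap β γ U p = 0) : IsHarmonic β γ U :=
  (isLocSobolev_of_contDiff hβ hγ hU).isHarmonic hβ hβ1 hγ hγ1 fun φ hφ => by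
    simp [integral_mul_coneLap_comm hβ hβ1 hγ hγ1 hU hφ, h]

end Sobolev

/-! ### Harmonic polynomials -/

/-- The harmonic polynomial `Re (c z^m)`. -/
def harmPoly (m : ℕ) (c : ℂ) (z : ℂ) : ℝ := (c * z ^ m).re

lemma hasFDerivAt_harmPoly (m : ℕ) (c z : ℂ) :
    HasFDerivAt (harmPoly m c)
      (Complex.reCLM.comp
        ((ContinuousLinearMap.toSpanSingleton ℂ (c * (m * z ^ (m - 1)))).restrictScalars ℝ)) z :=
  Complex.reCLM.hasFDerivAt.comp z
    (((hasDerivAt_pow m z).const_mul c).hasFDerivAt.restrictScalars ℝ)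

lemma dirD_harmPoly (m : ℕ) (c v : ℂ) :
    dirD v (harmPoly m c) = harmPoly (m - 1) (c * m * v) := by
  ext z
  rw [dirD, (hasFDerivAt_harmPoly m c z).fderiv]
  simp only [ContinuousLinearMap.comp_apply, ContinuousLinearMap.coe_restrictScalars',
    ContinuousLinearMap.toSpanSingleton_apply, smul_eq_mul, Complex.reCLM_apply, harmPoly]
  ring_nf

lemma contDiff_harmPoly (m : ℕ) (c : ℂ) : ContDiff ℝ (⊤ : ℕ∞) (harmPoly m c) :=
  Complex.reCLM.contDiff.comp (by fun_prop : ContDiff ℝ (⊤ : ℕ∞) fun z : ℂ => c * z ^ m)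

lemma harmPoly_ofReal_mul (m : ℕ) (c z : ℂ) (r : ℝ) :
    harmPoly m c ((r : ℂ) * z) = r ^ m * harmPoly m c z := by
  rw [harmPoly, harmPoly, mul_pow, ← Complex.ofReal_pow, mul_left_comm, Complex.re_ofReal_mul]

lemma harmPoly_euler (m : ℕ) (c z : ℂ) :
    z.re * dirD 1 (harmPoly m c) z + z.im * dirD Complex.I (harmPoly m c) z =
      m * harmPoly m c z := by
  rw [dirD_harmPoly, dirD_harmPoly]
  rcases m with _ | m
  · simp [harmPoly]
  simp only [harmPoly, Nat.add_sub_cancel, ← Complex.re_ofReal_mul, ← Complex.add_re,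
    Complex.ofReal_natCast]
  congr 1
  linear_combination (c * (m + 1 : ℕ) * z ^ m) * Complex.re_add_im z

lemma laplacian_eq_dirD {f : ℂ → ℝ} (hf : ContDiff ℝ (⊤ : ℕ∞) f) (z : ℂ) :
    Δ f z = dirD 1 (dirD 1 f) z + dirD Complex.I (dirD Complex.I f) z := by
  have hd : DifferentiableAt ℝ (fderiv ℝ f) z :=
    (hf.fderiv_right (m := ((⊤ : ℕ∞) : WithTop ℕ∞)) (by simp)).differentiable (by simp) z
  have second (v : ℂ) : iteratedFDeriv ℝ 2 f z ![v, v] = dirD v (dirD v f) z := by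
    unfold dirD
    rw [iteratedFDeriv_two_apply, fderiv_clm_apply hd (differentiableAt_const v)]
    simp
  simp only [InnerProductSpace.laplacian_eq_iteratedFDeriv_complexPlane, second]

lemma laplacian_harmPoly (m : ℕ) (c z : ℂ) : Δ (harmPoly m c) z = 0 := by
  rw [laplacian_eq_dirD (contDiff_harmPoly m c)]
  simp only [dirD_harmPoly, harmPoly, ← Complex.add_re]
  rw [← Complex.zero_re]
  congr 1
  linear_combination (c * m * ((m - 1 : ℕ) : ℂ) * z ^ (m - 1 - 1)) * Complex.I_mul_I

section Radial

variable {h h1 h2 : ℝ → ℝ}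

lemma hasFDerivAt_comp_norm_sq {y : ℝ} {z : ℂ} (hh : HasDerivAt h y (‖z‖ ^ 2)) :
    HasFDerivAt (fun z : ℂ => h (‖z‖ ^ 2)) (y • (2 • (innerSL ℝ z : ℂ →L[ℝ] ℝ))) z :=
  hh.comp_hasFDerivAt z (hasStrictFDerivAt_norm_sq z).hasFDerivAt

lemma dirD_comp_norm_sq (hh : ∀ x, 0 ≤ x → HasDerivAt h (h1 x) x) (v : ℂ) :
    dirD v (fun z : ℂ => h (‖z‖ ^ 2)) = fun z => 2 * ⟪z, v⟫_ℝ * h1 (‖z‖ ^ 2) := by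
  ext z
  rw [dirD, (hasFDerivAt_comp_norm_sq (hh _ (sq_nonneg _))).fderiv]
  simp only [smul_apply, innerSL_apply_apply, smul_eq_mul, nsmul_eq_mul, Nat.cast_ofNat]
  ring

lemma dirD_dirD_comp_norm_sq (hh : ∀ x, 0 ≤ x → HasDerivAt h (h1 x) x)
    (hh1 : ∀ x, 0 ≤ x → HasDerivAt h1 (h2 x) x) (v z : ℂ) :
    dirD v (dirD v fun z : ℂ => h (‖z‖ ^ 2)) z =
      4 * ⟪z, v⟫_ℝ ^ 2 * h2 (‖z‖ ^ 2) + 2 * ⟪v, v⟫_ℝ * h1 (‖z‖ ^ 2) := by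
  have hlin : HasFDerivAt (fun z : ℂ => 2 * ⟪z, v⟫_ℝ) ((2 : ℝ) • (innerSL ℝ v : ℂ →L[ℝ] ℝ)) z := by
    refine HasFDerivAt.const_mul ?_ 2
    exact (innerSL ℝ v : ℂ →L[ℝ] ℝ).hasFDerivAt.congr_of_eventuallyEq
      (Eventually.of_forall fun x => real_inner_comm _ _)
  rw [dirD_comp_norm_sq hh, dirD,
    (hlin.fun_mul (hasFDerivAt_comp_norm_sq (hh1 _ (sq_nonneg _)))).fderiv]
  simp only [add_apply, smul_apply, innerSL_apply_apply, smul_eq_mul, nsmul_eq_mul, Nat.cast_ofNat]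
  ring

lemma dirD_dirD_mul {E : Type*} [NormedAddCommGroup E] [NormedSpace ℝ E] {f g : E → ℝ}
    (hf : ContDiff ℝ (⊤ : ℕ∞) f) (hg : ContDiff ℝ (⊤ : ℕ∞) g) (v p : E) :
    dirD v (dirD v fun p => f p * g p) p =
      f p * dirD v (dirD v g) p + 2 * (dirD v f p * dirD v g p) + dirD v (dirD v f) p * g p := by
  have hf0 := hf.differentiable (by simp)
  have hg0 := hg.differentiable (by simp)
  have hf1 := (contDiff_dirD hf v).differentiable (by simp)
  have hg1 := (contDiff_dirD hg v).differentiable (by simp)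
  have first : (dirD v fun p => f p * g p) = fun p => f p * dirD v g p + dirD v f p * g p :=
    funext fun p => dirD_mul hf0 hg0 v p
  rw [first, dirD, fderiv_fun_add ((hf0 p).fun_mul (hg1 p)) ((hf1 p).fun_mul (hg0 p)), add_apply]
  change dirD v (fun p => f p * dirD v g p) p + dirD v (fun p => dirD v f p * g p) p = _
  rw [dirD_mul hf0 hg1, dirD_mul hf1 hg0]
  ring

lemma laplacian_harmPoly_mul_radial (m : ℕ) (c : ℂ)
    (hsmooth : ContDiff ℝ (⊤ : ℕ∞) fun z : ℂ => h (‖z‖ ^ 2))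
    (hh : ∀ x, 0 ≤ x → HasDerivAt h (h1 x) x) (hh1 : ∀ x, 0 ≤ x → HasDerivAt h1 (h2 x) x) (z : ℂ) :
    Δ (fun z => harmPoly m c z * h (‖z‖ ^ 2)) z =
      harmPoly m c z * (4 * ‖z‖ ^ 2 * h2 (‖z‖ ^ 2) + 4 * (m + 1) * h1 (‖z‖ ^ 2)) := by
  have hp := contDiff_harmPoly m c
  have euler := harmPoly_euler m c z
  have harmonic := laplacian_harmPoly m c z
  rw [laplacian_eq_dirD hp] at harmonic
  rw [laplacian_eq_dirD (hp.mul hsmooth), dirD_dirD_mul hp hsmooth, dirD_dirD_mul hp hsmooth,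
    dirD_dirD_comp_norm_sq hh hh1, dirD_dirD_comp_norm_sq hh hh1, dirD_comp_norm_sq hh,
    dirD_comp_norm_sq hh]
  have inner_one : ⟪z, (1 : ℂ)⟫_ℝ = z.re := by simp [Complex.inner]
  have inner_I : ⟪z, Complex.I⟫_ℝ = z.im := by simp [Complex.inner]
  have one_one : ⟪(1 : ℂ), (1 : ℂ)⟫_ℝ = 1 := by simp
  have I_I : ⟪Complex.I, Complex.I⟫_ℝ = 1 := by simp
  have norm_sq : ‖z‖ ^ 2 = z.re ^ 2 + z.im ^ 2 := by
    rw [Complex.sq_norm, Complex.normSq_apply]; ring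
  simp only [inner_one, inner_I, one_one, I_I]
  set N := ‖z‖ ^ 2
  linear_combination h N * harmonic + 4 * h1 N * euler - 4 * harmPoly m c z * h2 N * norm_sq

end Radial

lemma dirD_fst_eq {Φ : ℂ × ℂ → ℝ} (h : Differentiable ℝ Φ) (v : ℂ) (p : ℂ × ℂ) :
    dirD (v, 0) Φ p = dirD v (fun z => Φ (z, p.2)) p.1 := by
  have h1 : HasFDerivAt (fun z : ℂ => ((z, p.2) : ℂ × ℂ))
      ((ContinuousLinearMap.id ℝ ℂ).prod 0) p.1 :=
    (hasFDerivAt_id p.1).prodMk (hasFDerivAt_const p.2 p.1)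
  have h2 : HasFDerivAt (fun z => Φ (z, p.2)) _ p.1 := (h p).hasFDerivAt.comp p.1 h1
  rw [dirD, dirD, h2.fderiv]; simp

lemma dirD_snd_eq {Φ : ℂ × ℂ → ℝ} (h : Differentiable ℝ Φ) (v : ℂ) (p : ℂ × ℂ) :
    dirD (0, v) Φ p = dirD v (fun w => Φ (p.1, w)) p.2 := by
  have h1 : HasFDerivAt (fun w : ℂ => ((p.1, w) : ℂ × ℂ))
      ((0 : ℂ →L[ℝ] ℂ).prod (ContinuousLinearMap.id ℝ ℂ)) p.2 :=
    (hasFDerivAt_const p.1 p.2).prodMk (hasFDerivAt_id p.2)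
  have h2 : HasFDerivAt (fun w => Φ (p.1, w)) _ p.2 := (h p).hasFDerivAt.comp p.2 h1
  rw [dirD, dirD, h2.fderiv]; simp

lemma coneLap_eq_laplacian (β γ : ℝ) {Φ : ℂ × ℂ → ℝ} (h : ContDiff ℝ (⊤ : ℕ∞) Φ) (p : ℂ × ℂ) :
    coneLap β γ Φ p = wt γ p.2 * Δ (fun z => Φ (z, p.2)) p.1 +
      wt β p.1 * Δ (fun w => Φ (p.1, w)) p.2 := by
  have hd := h.differentiable (by simp)
  have hd1 (e : ℂ × ℂ) : Differentiable ℝ (dirD e Φ) := (contDiff_dirD h e).differentiable (by simp)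
  have slice_fst (v : ℂ) : (fun z => dirD (v, 0) Φ (z, p.2)) = dirD v fun z => Φ (z, p.2) :=
    funext fun z => dirD_fst_eq hd v (z, p.2)
  have slice_snd (v : ℂ) : (fun w => dirD (0, v) Φ (p.1, w)) = dirD v fun w => Φ (p.1, w) :=
    funext fun w => dirD_snd_eq hd v (p.1, w)
  have smooth_fst : ContDiff ℝ (⊤ : ℕ∞) fun z => Φ (z, p.2) := by fun_prop
  have smooth_snd : ContDiff ℝ (⊤ : ℕ∞) fun w => Φ (p.1, w) := by fun_prop
  rw [coneLap, sum_coordWt_mul, laplacian_eq_dirD smooth_fst, laplacian_eq_dirD smooth_snd]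
  simp only [coordVec, Matrix.cons_val]
  rw [dirD_fst_eq (hd1 _), dirD_fst_eq (hd1 _), dirD_snd_eq (hd1 _), dirD_snd_eq (hd1 _),
    slice_fst, slice_fst, slice_snd, slice_snd]

/-- The smooth functions whose slices are all of the form `Re (a z^m)` in the first variable and
`Re (b w^n)` in the second, such as `Re (c z^m w^n)` and `Re (c z^m \bar w^n)`. -/
structure IsBihomogeneousHarmonic (m n : ℕ) (h : ℂ × ℂ → ℝ) : Prop where
  contDiff : ContDiff ℝ (⊤ : ℕ∞) h
  exists_fst : ∀ w, ∃ a, ∀ z, h (z, w) = harmPoly m a z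
  exists_snd : ∀ z, ∃ b, ∀ w, h (z, w) = harmPoly n b w

namespace IsBihomogeneousHarmonic

variable {β γ : ℝ} {m n : ℕ} {h : ℂ × ℂ → ℝ}

lemma coneLap_eq_zero (hh : IsBihomogeneousHarmonic m n h) (p : ℂ × ℂ) : coneLap β γ h p = 0 := by
  obtain ⟨a, ha⟩ := hh.exists_fst p.2
  obtain ⟨b, hb⟩ := hh.exists_snd p.1
  have hfst : (fun z => h (z, p.2)) = harmPoly m a := funext ha
  have hsnd : (fun w => h (p.1, w)) = harmPoly n b := funext hb
  rw [coneLap_eq_laplacian β γ hh.contDiff, hfst, hsnd, laplacian_harmPoly, laplacian_harmPoly,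
    mul_zero, mul_zero, add_zero]

lemma isHarmonic (hβ : 0 < β) (hβ1 : β ≤ 1) (hγ : 0 < γ) (hγ1 : γ ≤ 1)
    (hh : IsBihomogeneousHarmonic m n h) : IsHarmonic β γ h :=
  isHarmonic_of_contDiff hβ hβ1 hγ hγ1 hh.contDiff fun p => hh.coneLap_eq_zero p

lemma apply_ofReal_mul (hh : IsBihomogeneousHarmonic m n h) (r s : ℝ) (z w : ℂ) :
    h ((r : ℂ) * z, (s : ℂ) * w) = r ^ m * s ^ n * h (z, w) := by
  obtain ⟨a, ha⟩ := hh.exists_fst ((s : ℂ) * w)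
  obtain ⟨b, hb⟩ := hh.exists_snd z
  rw [ha, harmPoly_ofReal_mul, ← ha, hb, harmPoly_ofReal_mul, ← hb, mul_assoc]

lemma apply_dilation (hh : IsBihomogeneousHarmonic m n h) {t : ℝ} (ht : 0 < t) (p : ℂ × ℂ) :
    h (dilation β γ t p) = t ^ (m / β + n / γ) * h p := by
  rw [dilation, hh.apply_ofReal_mul, ← Real.rpow_mul_natCast ht.le, ← Real.rpow_mul_natCast ht.le,
    ← Real.rpow_add ht]
  ring_nf

lemma isHomogeneous (hh : IsBihomogeneousHarmonic m n h) :
    IsHomogeneous β γ (m / β + n / γ) h :=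
  fun _ ht => Eventually.of_forall (hh.apply_dilation ht)

end IsBihomogeneousHarmonic

/-- `ζ` is the monomial `z^m` or `\bar z^m`. -/
def IsPurePower (m : ℕ) (ζ : ℂ → ℂ) : Prop :=
  (∀ z, ζ z = z ^ m) ∨ ∀ z, ζ z = (starRingEnd ℂ) z ^ m

lemma isPurePower_pow (m : ℕ) : IsPurePower m fun z => z ^ m := .inl fun _ => rfl

lemma isPurePower_conj_pow (m : ℕ) : IsPurePower m fun z => (starRingEnd ℂ) z ^ m :=
  .inr fun _ => rfl

lemma IsPurePower.contDiff {m : ℕ} {ζ : ℂ → ℂ} (h : IsPurePower m ζ) :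
    ContDiff ℝ (⊤ : ℕ∞) ζ := by
  rcases h with h | h
  · rw [funext h]; fun_prop
  · rw [funext h]; exact Complex.conjCLE.contDiff.pow m

lemma IsPurePower.exists_re_mul_eq {m : ℕ} {ζ : ℂ → ℂ} (h : IsPurePower m ζ) (c : ℂ) :
    ∃ a, ∀ z, (c * ζ z).re = harmPoly m a z := by
  rcases h with h | h
  · exact ⟨c, fun z => by rw [h, harmPoly]⟩
  · refine ⟨(starRingEnd ℂ) c, fun z => ?_⟩
    rw [h, harmPoly, ← Complex.conj_re, map_mul, map_pow, Complex.conj_conj]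

lemma isBihomogeneousHarmonic_re {m n : ℕ} {ζ η : ℂ → ℂ} (hζ : IsPurePower m ζ)
    (hη : IsPurePower n η) (c : ℂ) :
    IsBihomogeneousHarmonic m n fun p => (c * (ζ p.1 * η p.2)).re where
  contDiff := Complex.reCLM.contDiff.comp
    (contDiff_const.mul ((hζ.contDiff.comp contDiff_fst).mul (hη.contDiff.comp contDiff_snd)))
  exists_fst w := by
    obtain ⟨a, ha⟩ := hζ.exists_re_mul_eq (c * η w)
    exact ⟨a, fun z => by rw [← ha]; ring_nf⟩
  exists_snd z := by
    obtain ⟨b, hb⟩ := hη.exists_re_mul_eq (c * ζ z)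
    exact ⟨b, fun w => by rw [← hb]; ring_nf⟩

/-! ### Regularised squared distances -/

/-- The regularisation `(|z|² + δ)^α / α²` of the squared distance from `z` to the apex of `ℂ_α`,
as a function of `x = |z|²`. -/
def regSq (α δ x : ℝ) : ℝ := (x + δ) ^ α / α ^ 2

/-- The squared distance `|z|^(2α) / α²` from `z` to the apex of the cone `ℂ_α`. -/
def coneSq (α : ℝ) (z : ℂ) : ℝ := ‖z‖ ^ (2 * α) / α ^ 2

/-- The pair of squared distances to the apices of the two factors. -/
def sqDist (β γ : ℝ) (p : ℂ × ℂ) : ℝ × ℝ := (coneSq β p.1, coneSq γ p.2)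

/-- The regularisation of `sqDist`. -/
def regSqDist (β γ δ : ℝ) (p : ℂ × ℂ) : ℝ × ℝ := (regSq β δ (‖p.1‖ ^ 2), regSq γ δ (‖p.2‖ ^ 2))

section OneCone

variable {α δ : ℝ}

lemma coneSq_eq_regSq (α : ℝ) (z : ℂ) : coneSq α z = regSq α 0 (‖z‖ ^ 2) := by
  rw [coneSq, regSq, add_zero, Real.rpow_mul (norm_nonneg z), Real.rpow_two]

lemma coneSq_nonneg (α : ℝ) (z : ℂ) : 0 ≤ coneSq α z :=
  div_nonneg (Real.rpow_nonneg (norm_nonneg _) _) (sq_nonneg _)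

lemma continuous_coneSq (hα : 0 < α) : Continuous (coneSq α) :=
  (continuous_norm.rpow_const fun _ => Or.inr (by positivity)).div_const _

lemma regSq_nonneg {x : ℝ} (h : 0 ≤ x + δ) : 0 ≤ regSq α δ x :=
  div_nonneg (Real.rpow_nonneg h _) (sq_nonneg _)

lemma regSq_mono {δ' x : ℝ} (hα : 0 < α) (h : 0 ≤ x + δ) (h' : δ ≤ δ') :
    regSq α δ x ≤ regSq α δ' x := by
  unfold regSq
  gcongr

lemma coneSq_le_regSq (hα : 0 < α) (hδ : 0 < δ) (z : ℂ) : coneSq α z ≤ regSq α δ (‖z‖ ^ 2) :=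
  (coneSq_eq_regSq α z).trans_le (regSq_mono hα (by positivity) hδ.le)

lemma tendsto_regSq (hα : 0 < α) (z : ℂ) {ι : Type*} {l : Filter ι} {δ : ι → ℝ}
    (hδ : Tendsto δ l (𝓝 0)) :
    Tendsto (fun n => regSq α (δ n) (‖z‖ ^ 2)) l (𝓝 (coneSq α z)) := by
  rw [coneSq_eq_regSq]
  exact ((hδ.const_add _).rpow_const (Or.inr hα.le)).div_const _

lemma hasDerivAt_regSq {x : ℝ} (hα : α ≠ 0) (hx : 0 < x + δ) :
    HasDerivAt (regSq α δ) ((x + δ) ^ (α - 1) / α) x := by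
  have h := (((hasDerivAt_id x).add_const δ).rpow_const (p := α) (Or.inl hx.ne')).div_const (α ^ 2)
  refine h.congr_deriv ?_
  simp only [id_eq]
  field_simp

lemma hasDerivAt_rpow_sub_one_div {x : ℝ} (hx : 0 < x + δ) :
    HasDerivAt (fun x => (x + δ) ^ (α - 1) / α) ((α - 1) * (x + δ) ^ (α - 2) / α) x := by
  have h := (((hasDerivAt_id x).add_const δ).rpow_const (p := α - 1) (Or.inl hx.ne')).div_const α
  refine h.congr_deriv ?_
  rw [id_eq, one_mul, sub_sub, one_add_one_eq_two]

lemma contDiff_regSq_norm (hδ : 0 < δ) :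
    ContDiff ℝ (⊤ : ℕ∞) fun z : ℂ => regSq α δ (‖z‖ ^ 2) :=
  (((contDiff_norm_sq ℝ).add contDiff_const).rpow_const_of_ne fun _ => by positivity).div_const _

lemma dirD_regSq (hα : α ≠ 0) (hδ : 0 < δ) (v z : ℂ) :
    dirD v (fun z : ℂ => regSq α δ (‖z‖ ^ 2)) z = 2 / α * regWt α δ z * ⟪z, v⟫_ℝ := by
  rw [dirD_comp_norm_sq fun x hx => hasDerivAt_regSq hα (by positivity), regWt]
  ring

lemma norm_sq_mul_rpow_le_regWt (hδ : 0 < δ) (z : ℂ) :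
    ‖z‖ ^ 2 * (‖z‖ ^ 2 + δ) ^ (α - 2) ≤ regWt α δ z := by
  have h : 0 < ‖z‖ ^ 2 + δ := by positivity
  rw [regWt, show α - 1 = 1 + (α - 2) by ring, Real.rpow_add h, Real.rpow_one]
  gcongr
  linarith

lemma tendsto_norm_sq_mul_rpow {z : ℂ} (hz : z ≠ 0) {ι : Type*} {l : Filter ι} {δ : ι → ℝ}
    (hδ : Tendsto δ l (𝓝 0)) :
    Tendsto (fun n => ‖z‖ ^ 2 * (‖z‖ ^ 2 + δ n) ^ (α - 2)) l (𝓝 (wt α z)) := by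
  have hpos : 0 < ‖z‖ ^ 2 := by have := norm_pos_iff.2 hz; positivity
  have heq : wt α z = ‖z‖ ^ 2 * (‖z‖ ^ 2 + 0) ^ (α - 2) := by
    rw [wt_eq_norm_sq, add_zero, show α - 1 = 1 + (α - 2) by ring, Real.rpow_add hpos,
      Real.rpow_one]
  rw [heq]
  exact ((hδ.const_add _).rpow_const (Or.inl (by simpa using hpos.ne'))).const_mul _

/-- The factor in `Δ (Re (c z^m) f(S)) = Re (c z^m) * regRadialLap α δ m (f' S) (f'' S) z`, where
`S = regSq α δ |z|²`. -/
def regRadialLap (α δ : ℝ) (m : ℕ) (a b : ℝ) (z : ℂ) : ℝ :=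
  4 * (‖z‖ ^ 2 * (‖z‖ ^ 2 + δ) ^ (α - 2)) * (regSq α δ (‖z‖ ^ 2) * b + (α - 1) / α * a) +
    4 * (m + 1) / α * regWt α δ z * a

lemma laplacian_harmPoly_mul_comp_regSq (hα : α ≠ 0) (hδ : 0 < δ) (m : ℕ) (c : ℂ)
    {f f1 f2 : ℝ → ℝ} (hf : ContDiff ℝ (⊤ : ℕ∞) f) (hf1 : ∀ s, HasDerivAt f (f1 s) s)
    (hf2 : ∀ s, HasDerivAt f1 (f2 s) s) (z : ℂ) :
    Δ (fun z => harmPoly m c z * f (regSq α δ (‖z‖ ^ 2))) z =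
      harmPoly m c z *
        regRadialLap α δ m (f1 (regSq α δ (‖z‖ ^ 2))) (f2 (regSq α δ (‖z‖ ^ 2))) z := by
  have hS {x : ℝ} (hx : 0 ≤ x) : HasDerivAt (regSq α δ) ((x + δ) ^ (α - 1) / α) x :=
    hasDerivAt_regSq hα (by positivity)
  rw [laplacian_harmPoly_mul_radial (h := fun x => f (regSq α δ x))
    (h1 := fun x => f1 (regSq α δ x) * ((x + δ) ^ (α - 1) / α)) m c
    (hf.comp (contDiff_regSq_norm hδ)) (fun x hx => (hf1 _).comp x (hS hx))
    (fun x hx => ((hf2 _).comp x (hS hx)).mul (hasDerivAt_rpow_sub_one_div (by positivity)))]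
  have hpos : 0 < ‖z‖ ^ 2 + δ := by positivity
  have hsq : ((‖z‖ ^ 2 + δ) ^ (α - 1)) ^ 2 = (‖z‖ ^ 2 + δ) ^ (α - 2) * (‖z‖ ^ 2 + δ) ^ α := by
    rw [← Real.rpow_mul_natCast hpos.le, ← Real.rpow_add hpos]
    ring_nf
  simp only [regRadialLap, regWt, Function.comp_apply]
  generalize f1 (regSq α δ (‖z‖ ^ 2)) = a, f2 (regSq α δ (‖z‖ ^ 2)) = b
  rw [regSq]
  linear_combination harmPoly m c z * (4 * ‖z‖ ^ 2 * b / α ^ 2) * hsq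

lemma abs_regRadialLap_le (hα : 0 < α) (hα1 : α ≤ 1) (hδ : 0 < δ) (m : ℕ) {a b C : ℝ} {z : ℂ}
    (hz : z ≠ 0) (ha : |a| ≤ C) (hb : |regSq α δ (‖z‖ ^ 2) * b| ≤ C) :
    |regRadialLap α δ m a b z| ≤ 4 * (m + 2) / α * C * wt α z := by
  have : 0 ≤ C := (abs_nonneg a).trans ha
  have hR : ‖z‖ ^ 2 * (‖z‖ ^ 2 + δ) ^ (α - 2) ≤ wt α z :=
    (norm_sq_mul_rpow_le_regWt hδ z).trans (regWt_le hα1 hδ hz)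
  have hR0 : 0 ≤ ‖z‖ ^ 2 * (‖z‖ ^ 2 + δ) ^ (α - 2) := by positivity
  have hW0 := regWt_nonneg α hδ z
  have hab : |regSq α δ (‖z‖ ^ 2) * b + (α - 1) / α * a| ≤ C + (1 - α) / α * C := by
    refine (abs_add_le _ _).trans (add_le_add hb ?_)
    rw [abs_mul, abs_div, abs_of_pos hα, abs_of_nonpos (by linarith), neg_sub]
    have : 0 ≤ 1 - α := by linarith
    gcongr
  have hwt := wt_nonneg α z
  calc |regRadialLap α δ m a b z|
      ≤ 4 * (‖z‖ ^ 2 * (‖z‖ ^ 2 + δ) ^ (α - 2)) * |regSq α δ (‖z‖ ^ 2) * b + (α - 1) / α * a| +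
        4 * (m + 1) / α * regWt α δ z * |a| := by
        refine (abs_add_le _ _).trans_eq ?_
        rw [abs_mul, abs_mul _ a, abs_of_nonneg (mul_nonneg zero_le_four hR0),
          abs_of_nonneg (mul_nonneg (by positivity) hW0)]
    _ ≤ 4 * wt α z * (C + (1 - α) / α * C) + 4 * (m + 1) / α * wt α z * C := by
        gcongr
        exact regWt_le hα1 hδ hz
    _ = 4 * (m + 2) / α * C * wt α z := by field_simp; ring

lemma tendsto_regRadialLap (hα : 0 < α) (m : ℕ) {z : ℂ} (hz : z ≠ 0) {ι : Type*} {l : Filter ι}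
    {δ a b : ι → ℝ} {a₀ b₀ : ℝ} (hδ : Tendsto δ l (𝓝 0)) (ha : Tendsto a l (𝓝 a₀))
    (hb : Tendsto b l (𝓝 b₀)) :
    Tendsto (fun n => regRadialLap α (δ n) m (a n) (b n) z) l
      (𝓝 (4 * wt α z * (coneSq α z * b₀ + (1 + m / α) * a₀))) := by
  have h := (((tendsto_norm_sq_mul_rpow (α := α) hz hδ).const_mul 4).mul
    (((tendsto_regSq hα z hδ).mul hb).add (ha.const_mul ((α - 1) / α)))).add
    (((tendsto_regWt α hz hδ).const_mul (4 * (m + 1) / α)).mul ha)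
  refine h.trans_eq ?_
  congr 1
  field_simp
  ring

end OneCone

lemma hasDerivAt_slice_fst {F : ℝ × ℝ → ℝ} (hF : Differentiable ℝ F) (s t : ℝ) :
    HasDerivAt (fun s => F (s, t)) (dirD (1, 0) F (s, t)) s :=
  (hF (s, t)).hasFDerivAt.comp_hasDerivAt s ((hasDerivAt_id s).prodMk (hasDerivAt_const s t))

lemma hasDerivAt_slice_snd {F : ℝ × ℝ → ℝ} (hF : Differentiable ℝ F) (s t : ℝ) :
    HasDerivAt (fun t => F (s, t)) (dirD (0, 1) F (s, t)) t :=
  (hF (s, t)).hasFDerivAt.comp_hasDerivAt t ((hasDerivAt_const t s).prodMk (hasDerivAt_id t))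

section TwoCones

variable {β γ δ : ℝ} {m n : ℕ} {h : ℂ × ℂ → ℝ} {F : ℝ × ℝ → ℝ}

lemma continuous_sqDist (hβ : 0 < β) (hγ : 0 < γ) : Continuous (sqDist β γ) :=
  ((continuous_coneSq hβ).comp continuous_fst).prodMk ((continuous_coneSq hγ).comp continuous_snd)

lemma contDiff_regSqDist (hδ : 0 < δ) : ContDiff ℝ (⊤ : ℕ∞) (regSqDist β γ δ) :=
  ((contDiff_regSq_norm hδ).comp contDiff_fst).prodMk ((contDiff_regSq_norm hδ).comp contDiff_snd)

lemma tendsto_regSqDist (hβ : 0 < β) (hγ : 0 < γ) (p : ℂ × ℂ) {ι : Type*} {l : Filter ι}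
    {δ : ι → ℝ} (hδ : Tendsto δ l (𝓝 0)) :
    Tendsto (fun n => regSqDist β γ (δ n) p) l (𝓝 (sqDist β γ p)) :=
  (tendsto_regSq hβ p.1 hδ).prodMk_nhds (tendsto_regSq hγ p.2 hδ)

lemma coneLap_mul_comp_regSqDist (hβ : β ≠ 0) (hγ : γ ≠ 0) (hδ : 0 < δ)
    (hh : IsBihomogeneousHarmonic m n h) (hF : ContDiff ℝ (⊤ : ℕ∞) F) (p : ℂ × ℂ) :
    coneLap β γ (fun p => h p * F (regSqDist β γ δ p)) p =
      h p * (wt γ p.2 * regRadialLap β δ m (dirD (1, 0) F (regSqDist β γ δ p))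
          (dirD (1, 0) (dirD (1, 0) F) (regSqDist β γ δ p)) p.1 +
        wt β p.1 * regRadialLap γ δ n (dirD (0, 1) F (regSqDist β γ δ p))
          (dirD (0, 1) (dirD (0, 1) F) (regSqDist β γ δ p)) p.2) := by
  obtain ⟨a, ha⟩ := hh.exists_fst p.2
  obtain ⟨b, hb⟩ := hh.exists_snd p.1
  have hd := hF.differentiable (by simp)
  have hd1 (e : ℝ × ℝ) : Differentiable ℝ (dirD e F) :=
    (contDiff_dirD hF e).differentiable (by simp)
  set S := regSq β δ (‖p.1‖ ^ 2)
  set T := regSq γ δ (‖p.2‖ ^ 2)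
  have slice_fst : (fun z => h (z, p.2) * F (regSqDist β γ δ (z, p.2))) =
      fun z => harmPoly m a z * F (regSq β δ (‖z‖ ^ 2), T) := funext fun z => by rw [ha]; rfl
  have slice_snd : (fun w => h (p.1, w) * F (regSqDist β γ δ (p.1, w))) =
      fun w => harmPoly n b w * F (S, regSq γ δ (‖w‖ ^ 2)) := funext fun w => by rw [hb]; rfl
  have smooth : ContDiff ℝ (⊤ : ℕ∞) fun p => h p * F (regSqDist β γ δ p) :=
    hh.contDiff.mul (hF.comp (contDiff_regSqDist hδ))
  rw [coneLap_eq_laplacian β γ smooth, slice_fst, slice_snd,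
    laplacian_harmPoly_mul_comp_regSq hβ hδ m a (f := fun s => F (s, T))
      (hF.comp (contDiff_id.prodMk contDiff_const)) (hasDerivAt_slice_fst hd · T)
      (hasDerivAt_slice_fst (hd1 _) · T),
    laplacian_harmPoly_mul_comp_regSq hγ hδ n b (f := fun t => F (S, t))
      (hF.comp (contDiff_const.prodMk contDiff_id)) (hasDerivAt_slice_snd hd S)
      (hasDerivAt_slice_snd (hd1 _) S),
    ← ha, ← hb]
  rw [regSqDist]
  ring

/-- The operator on functions `F(s, t)` of the squared distances which corresponds to a quarter of
the Laplacian of `h * F(s, t)`, for `h` homogeneous harmonic of degree `μ` in the first and `ν` in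
the second factor. -/
def profileOp (μ ν : ℝ) (F : ℝ × ℝ → ℝ) (x : ℝ × ℝ) : ℝ :=
  (x.1 * dirD (1, 0) (dirD (1, 0) F) x + (1 + μ) * dirD (1, 0) F x) +
    (x.2 * dirD (0, 1) (dirD (0, 1) F) x + (1 + ν) * dirD (0, 1) F x)

lemma tendsto_coneLap_mul_comp_regSqDist (hβ : 0 < β) (hγ : 0 < γ)
    (hh : IsBihomogeneousHarmonic m n h) (hF : ContDiff ℝ (⊤ : ℕ∞) F) {p : ℂ × ℂ}
    (hp1 : p.1 ≠ 0) (hp2 : p.2 ≠ 0) {δ : ℕ → ℝ} (hδ : ∀ n, 0 < δ n)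
    (hδ0 : Tendsto δ atTop (𝓝 0)) :
    Tendsto (fun k => coneLap β γ (fun p => h p * F (regSqDist β γ (δ k) p)) p) atTop
      (𝓝 (density β γ p * (4 * (h p * profileOp (m / β) (n / γ) F (sqDist β γ p))))) := by
  simp only [fun k => coneLap_mul_comp_regSqDist hβ.ne' hγ.ne' (hδ k) hh hF p]
  have hS := tendsto_regSqDist hβ hγ p hδ0
  have hlim {f : ℝ × ℝ → ℝ} (hf : ContDiff ℝ (⊤ : ℕ∞) f) (e : ℝ × ℝ) :=
    ((contDiff_dirD hf e).continuous.tendsto (sqDist β γ p)).comp hS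
  have h1 := tendsto_regRadialLap hβ m hp1 hδ0 (hlim hF (1, 0))
    (hlim (contDiff_dirD hF (1, 0)) (1, 0))
  have h2 := tendsto_regRadialLap hγ n hp2 hδ0 (hlim hF (0, 1))
    (hlim (contDiff_dirD hF (0, 1)) (0, 1))
  refine (((h1.const_mul (wt γ p.2)).add (h2.const_mul (wt β p.1))).const_mul (h p)).trans_eq ?_
  congr 1
  simp only [density, profileOp, sqDist]
  ring

/-- `F` has bounded first derivatives, and second derivatives decaying like the inverse of the
corresponding variable, on the quadrant of the possible squared distances. -/
def HasDerivBound (F : ℝ × ℝ → ℝ) (C : ℝ) : Prop :=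
  ∀ x : ℝ × ℝ, 0 ≤ x.1 → 0 ≤ x.2 →
    |dirD (1, 0) F x| ≤ C ∧ |x.1 * dirD (1, 0) (dirD (1, 0) F) x| ≤ C ∧
    |dirD (0, 1) F x| ≤ C ∧ |x.2 * dirD (0, 1) (dirD (0, 1) F) x| ≤ C

lemma abs_coneLap_mul_comp_regSqDist_le (hβ : 0 < β) (hβ1 : β ≤ 1) (hγ : 0 < γ) (hγ1 : γ ≤ 1)
    (hδ : 0 < δ) (hh : IsBihomogeneousHarmonic m n h) (hF : ContDiff ℝ (⊤ : ℕ∞) F) {C : ℝ}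
    (hC : HasDerivBound F C) {p : ℂ × ℂ} (hp1 : p.1 ≠ 0) (hp2 : p.2 ≠ 0) :
    |coneLap β γ (fun p => h p * F (regSqDist β γ δ p)) p| ≤
      |h p| * ((4 * (m + 2) / β + 4 * (n + 2) / γ) * C * density β γ p) := by
  obtain ⟨hC1, hC11, hC2, hC22⟩ := hC (regSqDist β γ δ p) (regSq_nonneg (by positivity))
    (regSq_nonneg (by positivity))
  have h1 := abs_regRadialLap_le hβ hβ1 hδ m hp1 hC1 hC11
  have h2 := abs_regRadialLap_le hγ hγ1 hδ n hp2 hC2 hC22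
  have hw1 := wt_nonneg β p.1
  have hw2 := wt_nonneg γ p.2
  rw [coneLap_mul_comp_regSqDist hβ.ne' hγ.ne' hδ hh hF, abs_mul]
  gcongr
  refine (abs_add_le _ _).trans ?_
  rw [abs_mul, abs_mul, abs_of_nonneg hw1, abs_of_nonneg hw2]
  refine (add_le_add (mul_le_mul_of_nonneg_left h1 hw2)
    (mul_le_mul_of_nonneg_left h2 hw1)).trans_eq ?_
  rw [density]
  ring

end TwoCones

/-! ### The quadratic harmonic function -/

lemma tendsto_integral_mul_of_abs_le {X : Type*} [MeasurableSpace X] {μ : Measure X}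
    {F : ℕ → X → ℝ} {f B g : X → ℝ} (hF : ∀ n, AEStronglyMeasurable (F n) μ)
    (hg : AEStronglyMeasurable g μ) (hB : Integrable (fun p => B p * g p) μ)
    (hle : ∀ n, ∀ᵐ p ∂μ, |F n p| ≤ B p)
    (hlim : ∀ᵐ p ∂μ, Tendsto (fun n => F n p) atTop (𝓝 (f p))) :
    Tendsto (fun n => ∫ p, F n p * g p ∂μ) atTop (𝓝 (∫ p, f p * g p ∂μ)) := by
  refine tendsto_integral_of_dominated_convergence (fun p => ‖B p * g p‖)
    (fun n => (hF n).mul hg) hB.norm (fun n => ?_) ?_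
  · filter_upwards [hle n] with p hp
    rw [norm_mul, norm_mul]
    exact mul_le_mul_of_nonneg_right (hp.trans (le_abs_self _)) (norm_nonneg _)
  · filter_upwards [hlim] with p hp using hp.mul_const _

section OneCone

variable {α : ℝ} {τ : ℂ × ℂ →L[ℝ] ℂ}

/-- The differential of `p ↦ coneSq α (τ p)`. -/
def coneSqGrad (α : ℝ) (τ : ℂ × ℂ →L[ℝ] ℂ) (p : ℂ × ℂ) : ℂ × ℂ →L[ℝ] ℝ :=
  (2 / α * wt α (τ p)) • (innerSL ℝ (τ p) : ℂ →L[ℝ] ℝ).comp τ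

lemma coneSqGrad_apply (α : ℝ) (τ : ℂ × ℂ →L[ℝ] ℂ) (p e : ℂ × ℂ) :
    coneSqGrad α τ p e = 2 / α * wt α (τ p) * ⟪τ p, τ e⟫_ℝ := rfl

lemma measurable_coneSqGrad (α : ℝ) (τ : ℂ × ℂ →L[ℝ] ℂ) : Measurable (coneSqGrad α τ) := by
  have hwt : Measurable fun p => 2 / α * wt α (τ p) := by fun_prop
  have hinner : Continuous fun p => (innerSL ℝ (τ p) : ℂ →L[ℝ] ℝ).comp τ := by fun_prop
  exact hwt.smul hinner.measurable

lemma abs_mul_inner_le (hα : 0 < α) {z : ℂ} (hz : z ≠ 0) {x : ℝ} (hx0 : 0 ≤ x)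
    (hx : x ≤ wt α z) (v : ℂ) :
    |2 / α * x * ⟪z, v⟫_ℝ| ≤ 2 / α * ‖z‖ ^ (2 * α - 1) * ‖v‖ := by
  have hrpow : ‖z‖ ^ (2 * α - 1) = wt α z * ‖z‖ := by
    rw [wt, show 2 * α - 1 = 2 * α - 2 + 1 by ring, Real.rpow_add (norm_pos_iff.2 hz),
      Real.rpow_one]
  rw [hrpow, abs_mul, abs_of_nonneg (by positivity : 0 ≤ 2 / α * x)]
  have hwt := wt_nonneg α z
  calc 2 / α * x * |⟪z, v⟫_ℝ| ≤ 2 / α * wt α z * (‖z‖ * ‖v‖) := by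
        gcongr
        exact abs_real_inner_le_norm z v
    _ = 2 / α * (wt α z * ‖z‖) * ‖v‖ := by ring

lemma locallyIntegrable_coneSqGrad (hα : 0 < α) (hτ : ∀ᵐ p, τ p ≠ 0)
    (hint : LocallyIntegrable fun p => ‖τ p‖ ^ (2 * α - 1)) :
    LocallyIntegrable (coneSqGrad α τ) := by
  refine (hint.smul (2 / α * ‖τ‖)).mono (measurable_coneSqGrad α τ).aestronglyMeasurable ?_
  filter_upwards [hτ] with p hp
  have hbound : 0 ≤ 2 / α * ‖τ‖ * ‖τ p‖ ^ (2 * α - 1) := by positivity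
  refine (ContinuousLinearMap.opNorm_le_bound _ hbound fun e => ?_).trans (le_abs_self _)
  rw [coneSqGrad_apply, Real.norm_eq_abs]
  refine (abs_mul_inner_le hα hp (wt_nonneg _ _) le_rfl _).trans ?_
  calc 2 / α * ‖τ p‖ ^ (2 * α - 1) * ‖τ e‖ ≤ 2 / α * ‖τ p‖ ^ (2 * α - 1) * (‖τ‖ * ‖e‖) := by
        gcongr
        exact τ.le_opNorm e
    _ = 2 / α * ‖τ‖ * ‖τ p‖ ^ (2 * α - 1) * ‖e‖ := by ring

lemma dirD_regSq_comp {δ : ℝ} (hα : α ≠ 0) (hδ : 0 < δ) (τ : ℂ × ℂ →L[ℝ] ℂ) (e p : ℂ × ℂ) :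
    dirD e (fun p => regSq α δ (‖τ p‖ ^ 2)) p = 2 / α * regWt α δ (τ p) * ⟪τ p, τ e⟫_ℝ := by
  rw [dirD_comp_clm ((contDiff_regSq_norm hδ).differentiable (by simp)), dirD_regSq hα hδ]

lemma isWeakDifferential_coneSq (hα : 0 < α) (hα1 : α ≤ 1) (hτ : ∀ᵐ p, τ p ≠ 0)
    (hint : LocallyIntegrable fun p => ‖τ p‖ ^ (2 * α - 1)) :
    IsWeakDifferential (fun p => coneSq α (τ p)) (coneSqGrad α τ) := by
  refine ⟨((continuous_coneSq hα).comp τ.continuous).locallyIntegrable,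
    locallyIntegrable_coneSqGrad hα hτ hint, fun φ hφ e => ?_⟩
  obtain ⟨δ, -, hδ01, hδ⟩ := exists_seq_strictAnti_tendsto' (zero_lt_one' ℝ)
  have smooth {δ : ℝ} (hδ : 0 < δ) : ContDiff ℝ (⊤ : ℕ∞) fun p => regSq α δ (‖τ p‖ ^ 2) :=
    (contDiff_regSq_norm hδ).comp τ.contDiff
  have lim_fun : Tendsto (fun n => ∫ p, regSq α (δ n) (‖τ p‖ ^ 2) * dirD e φ p) atTop
      (𝓝 (∫ p, coneSq α (τ p) * dirD e φ p)) := by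
    refine tendsto_integral_mul_of_abs_le
      (fun n => (smooth (hδ01 n).1).continuous.aestronglyMeasurable)
      (hφ.dirD e).1.continuous.aestronglyMeasurable
      ((hφ.dirD e).integrable_mul (smooth one_pos).continuous.locallyIntegrable)
      (fun n => ae_of_all _ fun p => ?_) (ae_of_all _ fun p => tendsto_regSq hα _ hδ)
    have hpos : 0 ≤ ‖τ p‖ ^ 2 + δ n := add_nonneg (sq_nonneg _) (hδ01 n).1.le
    rw [abs_of_nonneg (regSq_nonneg hpos)]
    exact regSq_mono hα hpos (hδ01 n).2.le
  have lim_grad : Tendsto (fun n => ∫ p, dirD e (fun p => regSq α (δ n) (‖τ p‖ ^ 2)) p * φ p) atTop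
      (𝓝 (∫ p, coneSqGrad α τ p e * φ p)) := by
    refine tendsto_integral_mul_of_abs_le
      (fun n => (contDiff_dirD (smooth (hδ01 n).1) e).continuous.aestronglyMeasurable)
      hφ.1.continuous.aestronglyMeasurable (hφ.integrable_mul (hint.smul (2 / α * ‖τ e‖)))
      (fun n => ?_) ?_
    · filter_upwards [hτ] with p hp
      rw [dirD_regSq_comp hα.ne' (hδ01 n).1]
      refine (abs_mul_inner_le hα hp (regWt_nonneg _ (hδ01 n).1 _)
        (regWt_le hα1 (hδ01 n).1 hp) _).trans_eq ?_
      rw [Pi.smul_apply, smul_eq_mul, mul_right_comm]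
    · filter_upwards [hτ] with p hp
      simp only [fun n => dirD_regSq_comp hα.ne' (hδ01 n).1 τ e p, coneSqGrad_apply]
      exact ((tendsto_regWt α hp hδ).const_mul _).mul_const _
  exact tendsto_nhds_unique lim_fun
    (lim_grad.neg.congr fun n => (integral_mul_dirD (smooth (hδ01 n).1) hφ e).symm)

lemma norm_rpow_mul_sq_eq_coneSq {z : ℂ} (hz : z ≠ 0) :
    ‖z‖ ^ (2 - 2 * α) * ((2 / α * wt α z) ^ 2 * ‖z‖ ^ 2) = 4 * coneSq α z := by
  have hpos := norm_pos_iff.2 hz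
  have hrpow : ‖z‖ ^ (2 * α) = ‖z‖ ^ (2 - 2 * α) * (wt α z ^ 2 * ‖z‖ ^ 2) := by
    rw [wt, ← Real.rpow_mul_natCast hpos.le, ← Real.rpow_two ‖z‖, ← Real.rpow_add hpos,
      ← Real.rpow_add hpos]
    congr 1
    push_cast
    ring
  rw [coneSq, hrpow]
  ring

end OneCone

lemma inner_one_sq_add_inner_I_sq (z : ℂ) :
    ⟪z, (1 : ℂ)⟫_ℝ ^ 2 + ⟪z, Complex.I⟫_ℝ ^ 2 = ‖z‖ ^ 2 := by
  rw [Complex.sq_norm, Complex.normSq_apply]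
  simp [Complex.inner, sq]

lemma IsWeakDifferential.sub {u v : ℂ × ℂ → ℝ} {G H : ℂ × ℂ → (ℂ × ℂ →L[ℝ] ℝ)}
    (hu : IsWeakDifferential u G) (hv : IsWeakDifferential v H) :
    IsWeakDifferential (fun p => u p - v p) (fun p => G p - H p) := by
  refine ⟨hu.1.sub hv.1, hu.2.1.sub hv.2.1, fun φ hφ e => ?_⟩
  have hw {w : ℂ × ℂ → ℝ} (h : LocallyIntegrable w) : Integrable fun p => w p * fderiv ℝ φ p e :=
    (hφ.dirD e).integrable_mul h
  have hG {G : ℂ × ℂ → (ℂ × ℂ →L[ℝ] ℝ)} (h : LocallyIntegrable G) :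
      Integrable fun p => G p e * φ p :=
    hφ.integrable_mul fun p => (ContinuousLinearMap.apply ℝ ℝ e).integrableAtFilter_comp (h p)
  simp only [sub_mul, sub_apply]
  rw [integral_sub (hw hu.1) (hw hv.1), integral_sub (hG hu.2.1) (hG hv.2.1), hu.2.2 φ hφ e,
    hv.2.2 φ hφ e]
  ring

/-- The quadratic harmonic function `β⁻² |z|^(2β) - γ⁻² |w|^(2γ)`. -/
def quadHarm (β γ : ℝ) (p : ℂ × ℂ) : ℝ := coneSq β p.1 - coneSq γ p.2

/-- The differential of `quadHarm`. -/
def quadGrad (β γ : ℝ) (p : ℂ × ℂ) : ℂ × ℂ →L[ℝ] ℝ :=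
  coneSqGrad β (ContinuousLinearMap.fst ℝ ℂ ℂ) p - coneSqGrad γ (ContinuousLinearMap.snd ℝ ℂ ℂ) p

lemma coInner_quadGrad_self (β γ : ℝ) {p : ℂ × ℂ} (hp1 : p.1 ≠ 0) (hp2 : p.2 ≠ 0) :
    coInner β γ p (quadGrad β γ p) (quadGrad β γ p) = 4 * (coneSq β p.1 + coneSq γ p.2) := by
  have h1 := norm_rpow_mul_sq_eq_coneSq (α := β) hp1
  have h2 := norm_rpow_mul_sq_eq_coneSq (α := γ) hp2
  rw [← inner_one_sq_add_inner_I_sq] at h1 h2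
  simp only [coInner, quadGrad, sub_apply, coneSqGrad_apply, ContinuousLinearMap.coe_fst',
    ContinuousLinearMap.coe_snd', inner_zero_right, mul_zero, sub_zero, zero_sub]
  linear_combination h1 + h2

section

variable {β γ : ℝ}

lemma continuous_quadHarm (hβ : 0 < β) (hγ : 0 < γ) : Continuous (quadHarm β γ) :=
  ((continuous_coneSq hβ).comp continuous_fst).sub ((continuous_coneSq hγ).comp continuous_snd)

lemma isLocSobolev_quadHarm (hβ : 0 < β) (hβ1 : β ≤ 1) (hγ : 0 < γ) (hγ1 : γ ≤ 1) :
    IsLocSobolev β γ (quadHarm β γ) (quadGrad β γ) := by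
  have int_fst : LocallyIntegrable fun p : ℂ × ℂ => ‖p.1‖ ^ (2 * β - 1) := by
    simpa using locallyIntegrable_norm_rpow_mul (r := 2 * β - 1) (s := 0) (by linarith) (by simp)
  have int_snd : LocallyIntegrable fun p : ℂ × ℂ => ‖p.2‖ ^ (2 * γ - 1) := by
    simpa using locallyIntegrable_norm_rpow_mul (r := 0) (s := 2 * γ - 1) (by simp) (by linarith)
  refine ⟨(isWeakDifferential_coneSq (τ := ContinuousLinearMap.fst ℝ ℂ ℂ) hβ hβ1 ae_fst_ne_zero
      int_fst).sub (isWeakDifferential_coneSq (τ := ContinuousLinearMap.snd ℝ ℂ ℂ) hγ hγ1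
      ae_snd_ne_zero int_snd),
    locallyIntegrable_vol_of_continuous hβ hγ ((continuous_quadHarm hβ hγ).pow 2), ?_⟩
  have hcont : Continuous fun p : ℂ × ℂ => 4 * (coneSq β p.1 + coneSq γ p.2) :=
    (((continuous_coneSq hβ).comp continuous_fst).add
      ((continuous_coneSq hγ).comp continuous_snd)).const_mul 4
  refine (locallyIntegrable_vol_of_continuous hβ hγ hcont).congr
    ((vol_absolutelyContinuous β γ).ae_le ?_)
  filter_upwards [ae_fst_ne_zero, ae_snd_ne_zero] with p hp1 hp2
  exact (coInner_quadGrad_self β γ hp1 hp2).symm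

lemma isBihomogeneousHarmonic_const (c : ℝ) : IsBihomogeneousHarmonic 0 0 fun _ => c where
  contDiff := contDiff_const
  exists_fst _ := ⟨c, fun _ => by simp [harmPoly]⟩
  exists_snd _ := ⟨c, fun _ => by simp [harmPoly]⟩

lemma dirD_fst_sub_snd (e : ℝ × ℝ) :
    dirD e (fun x : ℝ × ℝ => x.1 - x.2) = fun _ => e.1 - e.2 := by
  ext x
  exact congrArg (fun L : ℝ × ℝ →L[ℝ] ℝ => L e)
    (ContinuousLinearMap.fst ℝ ℝ ℝ - ContinuousLinearMap.snd ℝ ℝ ℝ).fderiv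

lemma dirD_const {E : Type*} [NormedAddCommGroup E] [NormedSpace ℝ E] (e : E) (c : ℝ) :
    dirD e (fun _ => c) = 0 := by
  ext x
  simp [dirD]

lemma tendsto_integral_coneLap_mul (hβ : 0 < β) (hβ1 : β ≤ 1) (hγ : 0 < γ) (hγ1 : γ ≤ 1) {m n : ℕ}
    {h g : ℂ × ℂ → ℝ} (hh : IsBihomogeneousHarmonic m n h) {F : ℝ × ℝ → ℝ}
    (hF : ContDiff ℝ (⊤ : ℕ∞) F) {C : ℝ} (hC : HasDerivBound F C) (hg : AEStronglyMeasurable g)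
    (hint : Integrable fun p => density β γ p * (|h p| * g p)) {δ : ℕ → ℝ} (hδ : ∀ k, 0 < δ k)
    (hδ0 : Tendsto δ atTop (𝓝 0)) :
    Tendsto (fun k => ∫ p, coneLap β γ (fun p => h p * F (regSqDist β γ (δ k) p)) p * g p) atTop (𝓝
      (∫ p, density β γ p * (4 * (h p * profileOp (m / β) (n / γ) F (sqDist β γ p))) * g p)) := by
  have smooth (k : ℕ) : ContDiff ℝ (⊤ : ℕ∞) fun p => h p * F (regSqDist β γ (δ k) p) :=
    hh.contDiff.mul (hF.comp (contDiff_regSqDist (hδ k)))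
  refine tendsto_integral_mul_of_abs_le
    (B := fun p => |h p| * ((4 * (m + 2) / β + 4 * (n + 2) / γ) * C * density β γ p))
    (fun k => (measurable_coneLap (smooth k)).aestronglyMeasurable) hg ?_ (fun k => ?_) ?_
  · refine (hint.const_mul ((4 * (m + 2) / β + 4 * (n + 2) / γ) * C)).congr <|
      ae_of_all _ fun p => ?_
    ring
  · filter_upwards [ae_fst_ne_zero, ae_snd_ne_zero] with p hp1 hp2
    exact abs_coneLap_mul_comp_regSqDist_le hβ hβ1 hγ hγ1 (hδ k) hh hF hC hp1 hp2
  · filter_upwards [ae_fst_ne_zero, ae_snd_ne_zero] with p hp1 hp2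
    exact tendsto_coneLap_mul_comp_regSqDist hβ hγ hh hF hp1 hp2 hδ hδ0

/-- `quadHarm` with each squared distance replaced by its regularisation. -/
def regQuadHarm (β γ δ : ℝ) (p : ℂ × ℂ) : ℝ := (regSqDist β γ δ p).1 - (regSqDist β γ δ p).2

lemma contDiff_regQuadHarm {δ : ℝ} (hδ : 0 < δ) : ContDiff ℝ (⊤ : ℕ∞) (regQuadHarm β γ δ) :=
  (contDiff_regSqDist hδ).fst.sub (contDiff_regSqDist hδ).snd

lemma tendsto_integral_regQuadHarm_mul_coneLap (hβ : 0 < β) (hγ : 0 < γ) {φ : ℂ × ℂ → ℝ}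
    (hφ : IsTest φ) {δ : ℕ → ℝ} (hδ01 : ∀ k, δ k ∈ Ioo (0 : ℝ) 1) (hδ : Tendsto δ atTop (𝓝 0)) :
    Tendsto (fun k => ∫ p, regQuadHarm β γ (δ k) p * coneLap β γ φ p) atTop
      (𝓝 (∫ p, quadHarm β γ p * coneLap β γ φ p)) := by
  have hS : Continuous (regSqDist β γ 1) := (contDiff_regSqDist one_pos).continuous
  refine tendsto_integral_mul_of_abs_le
    (fun k => (contDiff_regQuadHarm (hδ01 k).1).continuous.aestronglyMeasurable)
    (measurable_coneLap hφ.1).aestronglyMeasurable (integrable_mul_coneLap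
      (fun i => locallyIntegrable_coordWt_mul_of_continuous hβ hγ i (hS.fst.add hS.snd)) hφ)
    (fun k => ae_of_all _ fun p => ?_) (ae_of_all _ fun p => ?_)
  · have hle {α : ℝ} (hα : 0 < α) (z : ℂ) :
        |regSq α (δ k) (‖z‖ ^ 2)| ≤ regSq α 1 (‖z‖ ^ 2) := by
      have hpos : 0 ≤ ‖z‖ ^ 2 + δ k := add_nonneg (sq_nonneg _) (hδ01 k).1.le
      rw [abs_of_nonneg (regSq_nonneg hpos)]
      exact regSq_mono hα hpos (hδ01 k).2.le
    exact (abs_sub _ _).trans (add_le_add (hle hβ _) (hle hγ _))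
  · have hS := tendsto_regSqDist hβ hγ p hδ
    exact hS.fst_nhds.sub hS.snd_nhds

lemma integral_quadHarm_mul_coneLap (hβ : 0 < β) (hβ1 : β ≤ 1) (hγ : 0 < γ) (hγ1 : γ ≤ 1)
    {φ : ℂ × ℂ → ℝ} (hφ : IsTest φ) : ∫ p, quadHarm β γ p * coneLap β γ φ p = 0 := by
  obtain ⟨δ, -, hδ01, hδ⟩ := exists_seq_strictAnti_tendsto' (zero_lt_one' ℝ)
  have hF : ContDiff ℝ (⊤ : ℕ∞) fun x : ℝ × ℝ => x.1 - x.2 := contDiff_fst.sub contDiff_snd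
  have hC : HasDerivBound (fun x : ℝ × ℝ => x.1 - x.2) 1 := fun x _ _ => by
    simp [dirD_fst_sub_snd, dirD_const]
  have profile_eq_zero (x : ℝ × ℝ) :
      profileOp ((0 : ℕ) / β) ((0 : ℕ) / γ) (fun x : ℝ × ℝ => x.1 - x.2) x = 0 := by
    simp [profileOp, dirD_fst_sub_snd, dirD_const]
  have lim := tendsto_integral_coneLap_mul hβ hβ1 hγ hγ1 (isBihomogeneousHarmonic_const 1) hF hC
    hφ.1.continuous.aestronglyMeasurable
    (by simpa only [abs_one, one_mul] using hφ.integrable_mul (locallyIntegrable_density hβ hγ))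
    (fun k => (hδ01 k).1) hδ
  simp only [one_mul, profile_eq_zero, mul_zero, zero_mul, integral_zero] at lim
  refine tendsto_nhds_unique (tendsto_integral_regQuadHarm_mul_coneLap hβ hγ hφ hδ01 hδ)
    (lim.congr fun k => ?_)
  exact (integral_mul_coneLap_comm hβ hβ1 hγ hγ1 (contDiff_regQuadHarm (hδ01 k).1) hφ).symm

lemma isHarmonic_quadHarm (hβ : 0 < β) (hβ1 : β ≤ 1) (hγ : 0 < γ) (hγ1 : γ ≤ 1) :
    IsHarmonic β γ (quadHarm β γ) :=
  (isLocSobolev_quadHarm hβ hβ1 hγ hγ1).isHarmonic hβ hβ1 hγ hγ1 fun _ hφ =>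
    integral_quadHarm_mul_coneLap hβ hβ1 hγ hγ1 hφ

lemma coneSq_ofReal_mul {α t : ℝ} (hα : α ≠ 0) (ht : 0 < t) (z : ℂ) :
    coneSq α (((t ^ (1 / α) : ℝ) : ℂ) * z) = t ^ 2 * coneSq α z := by
  have hrpow : (t ^ (1 / α)) ^ (2 * α) = t ^ 2 := by
    rw [← Real.rpow_mul ht.le, ← Real.rpow_natCast]
    congr 1
    push_cast
    field_simp
  rw [coneSq, coneSq, norm_mul, Complex.norm_of_nonneg (by positivity),
    Real.mul_rpow (by positivity) (norm_nonneg z), hrpow, mul_div_assoc]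

lemma isHomogeneous_quadHarm (hβ : β ≠ 0) (hγ : γ ≠ 0) : IsHomogeneous β γ 2 (quadHarm β γ) := by
  refine fun t ht => ae_of_all _ fun p => ?_
  simp only [quadHarm, dilation, coneSq_ofReal_mul hβ ht, coneSq_ofReal_mul hγ ht, Real.rpow_two]
  ring

end

/-! ### Testing a very weak solution with profiles -/

lemma dirD_eq_zero_of_eventuallyEq {E : Type*} [NormedAddCommGroup E] [NormedSpace ℝ E] {f : E → ℝ}
    {x : E} (h : f =ᶠ[𝓝 x] 0) (e : E) : dirD e f x = 0 := by
  rw [dirD, h.fderiv_eq, fderiv_zero]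
  rfl

/-- Smooth functions of the two squared distances with support in `x.1 + x.2 ≤ 2`. -/
def IsProfile (F : ℝ × ℝ → ℝ) : Prop :=
  ContDiff ℝ (⊤ : ℕ∞) F ∧ ∀ x : ℝ × ℝ, 2 < x.1 + x.2 → F x = 0

section Profile

variable {F : ℝ × ℝ → ℝ}

lemma IsProfile.dirD (hF : IsProfile F) (e : ℝ × ℝ) : IsProfile (dirD e F) := by
  refine ⟨contDiff_dirD hF.1 e, fun x hx => dirD_eq_zero_of_eventuallyEq ?_ e⟩
  filter_upwards [(continuous_fst.add continuous_snd).continuousAt.eventually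
    (lt_mem_nhds hx)] with y hy using hF.2 y hy

lemma IsProfile.exists_abs_le (hF : IsProfile F) :
    ∃ C, ∀ x : ℝ × ℝ, 0 ≤ x.1 → 0 ≤ x.2 → |F x| ≤ C := by
  obtain ⟨C, hC⟩ := (isCompact_Icc (a := ((0, 0) : ℝ × ℝ)) (b := (2, 2)))
    |>.exists_bound_of_continuousOn hF.1.continuous.continuousOn
  have hC0 : 0 ≤ C := (norm_nonneg _).trans (hC (0, 0) (by simp [Prod.le_def]))
  refine ⟨C, fun x hx1 hx2 => ?_⟩
  rcases lt_or_ge 2 (x.1 + x.2) with hx | hx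
  · rwa [hF.2 x hx, abs_zero]
  · exact hC x ⟨⟨hx1, hx2⟩, by dsimp only; linarith, by dsimp only; linarith⟩

lemma IsProfile.mul_left (hF : IsProfile F) {f : ℝ × ℝ → ℝ} (hf : ContDiff ℝ (⊤ : ℕ∞) f) :
    IsProfile fun x => f x * F x :=
  ⟨hf.mul hF.1, fun x hx => mul_eq_zero_of_right _ (hF.2 x hx)⟩

lemma IsProfile.add {G : ℝ × ℝ → ℝ} (hF : IsProfile F) (hG : IsProfile G) :
    IsProfile fun x => F x + G x :=
  ⟨hF.1.add hG.1, fun x hx => by simp only [hF.2 x hx, hG.2 x hx, add_zero]⟩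

lemma IsProfile.exists_hasDerivBound (hF : IsProfile F) : ∃ C, HasDerivBound F C := by
  obtain ⟨C₁, h₁⟩ := (hF.dirD (1, 0)).exists_abs_le
  obtain ⟨C₁₁, h₁₁⟩ := (((hF.dirD (1, 0)).dirD (1, 0)).mul_left contDiff_fst).exists_abs_le
  obtain ⟨C₂, h₂⟩ := (hF.dirD (0, 1)).exists_abs_le
  obtain ⟨C₂₂, h₂₂⟩ := (((hF.dirD (0, 1)).dirD (0, 1)).mul_left contDiff_snd).exists_abs_le
  refine ⟨max (max C₁ C₁₁) (max C₂ C₂₂), fun x hx1 hx2 => ⟨?_, ?_, ?_, ?_⟩⟩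
  · exact (h₁ x hx1 hx2).trans (by simp)
  · exact (h₁₁ x hx1 hx2).trans (by simp)
  · exact (h₂ x hx1 hx2).trans (by simp)
  · exact (h₂₂ x hx1 hx2).trans (by simp)

lemma IsProfile.profileOp (hF : IsProfile F) (μ ν : ℝ) : IsProfile (profileOp μ ν F) := by
  have h₁ := hF.dirD (1, 0)
  have h₂ := hF.dirD (0, 1)
  exact (((h₁.dirD _).mul_left contDiff_fst).add (h₁.mul_left contDiff_const)).add
    (((h₂.dirD _).mul_left contDiff_snd).add (h₂.mul_left contDiff_const))

end Profile

/-- The squared distance to the apex. -/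
def rad (β γ : ℝ) (p : ℂ × ℂ) : ℝ := (sqDist β γ p).1 + (sqDist β γ p).2

section TwoCones

variable {β γ : ℝ} {m n : ℕ} {u h : ℂ × ℂ → ℝ} {F : ℝ × ℝ → ℝ}

lemma continuous_rad (hβ : 0 < β) (hγ : 0 < γ) : Continuous (rad β γ) :=
  (continuous_sqDist hβ hγ).fst.add (continuous_sqDist hβ hγ).snd

lemma norm_le_of_coneSq_le {α r : ℝ} (hα : 0 < α) {z : ℂ} (h : coneSq α z ≤ r) :
    ‖z‖ ≤ (r * α ^ 2) ^ (2 * α)⁻¹ := by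
  have hr : 0 ≤ r := (coneSq_nonneg α z).trans h
  rw [Real.le_rpow_inv_iff_of_pos (norm_nonneg z) (by positivity) (by positivity)]
  exact (div_le_iff₀ (by positivity)).1 h

lemma isCompact_rad_le (hβ : 0 < β) (hγ : 0 < γ) (r : ℝ) : IsCompact {p | rad β γ p ≤ r} := by
  refine ((isCompact_closedBall (0 : ℂ) ((r * β ^ 2) ^ (2 * β)⁻¹)).prod
    (isCompact_closedBall (0 : ℂ) ((r * γ ^ 2) ^ (2 * γ)⁻¹))).of_isClosed_subset
    (isClosed_le (continuous_rad hβ hγ) continuous_const) fun p hp => ?_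
  have h1 := coneSq_nonneg β p.1
  have h2 := coneSq_nonneg γ p.2
  have hp' : coneSq β p.1 + coneSq γ p.2 ≤ r := hp
  exact ⟨mem_closedBall_zero_iff.2 (norm_le_of_coneSq_le hβ (by linarith)),
    mem_closedBall_zero_iff.2 (norm_le_of_coneSq_le hγ (by linarith))⟩

lemma integrable_mul_of_rad (hβ : 0 < β) (hγ : 0 < γ) (hu : LocallyIntegrable u (vol β γ))
    {g : ℂ × ℂ → ℝ} (hg : Continuous g) {r : ℝ} (hg0 : ∀ p, r < rad β γ p → g p = 0) :
    Integrable (fun p => u p * g p) (vol β γ) :=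
  hu.integrable_smul_right_of_hasCompactSupport hg <|
    HasCompactSupport.intro (isCompact_rad_le hβ hγ r) fun p hp => hg0 p (not_le.1 hp)

lemma apply_regSqDist_eq_zero (hβ : 0 < β) (hγ : 0 < γ) (hF : IsProfile F) {δ : ℝ} (hδ : 0 < δ)
    {p : ℂ × ℂ} (hp : 2 < rad β γ p) : F (regSqDist β γ δ p) = 0 :=
  hF.2 _ (hp.trans_le (add_le_add (coneSq_le_regSq hβ hδ _) (coneSq_le_regSq hγ hδ _)))

lemma isTest_mul_comp_regSqDist (hβ : 0 < β) (hγ : 0 < γ) (hh : ContDiff ℝ (⊤ : ℕ∞) h)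
    (hF : IsProfile F) {δ : ℝ} (hδ : 0 < δ) : IsTest fun p => h p * F (regSqDist β γ δ p) :=
  ⟨hh.mul (hF.1.comp (contDiff_regSqDist hδ)),
    HasCompactSupport.intro (isCompact_rad_le hβ hγ 2) fun p hp => by
      rw [apply_regSqDist_eq_zero hβ hγ hF hδ (not_le.1 hp), mul_zero]⟩

lemma coneLap_eq_zero_of_eventuallyEq {φ : ℂ × ℂ → ℝ} {p : ℂ × ℂ} (h : φ =ᶠ[𝓝 p] 0) :
    coneLap β γ φ p = 0 := by
  refine Finset.sum_eq_zero fun i _ => ?_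
  rw [dirD_eq_zero_of_eventuallyEq, mul_zero]
  filter_upwards [h.eventuallyEq_nhds] with q hq using dirD_eq_zero_of_eventuallyEq hq _

theorem integral_mul_profileOp (hβ : 0 < β) (hβ1 : β ≤ 1) (hγ : 0 < γ) (hγ1 : γ ≤ 1)
    (hu : u ∈ veryWeakSolutions β γ) (hh : IsBihomogeneousHarmonic m n h) (hF : IsProfile F) :
    ∫ p, u p * (h p * profileOp (m / β) (n / γ) F (sqDist β γ p)) ∂vol β γ = 0 := by
  obtain ⟨C, hC⟩ := hF.exists_hasDerivBound
  obtain ⟨δ, -, hδ01, hδ⟩ := exists_seq_strictAnti_tendsto' (zero_lt_one' ℝ)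
  let K : Set (ℂ × ℂ) := {p | rad β γ p ≤ 2}
  have hK : IsCompact K := isCompact_rad_le hβ hγ 2
  let g : ℂ × ℂ → ℝ := K.indicator u
  have hg : AEStronglyMeasurable g :=
    (hu.1.aestronglyMeasurable.mono_ac (absolutelyContinuous_vol β γ)).indicator hK.measurableSet
  have hint : Integrable fun p => density β γ p * (|h p| * g p) := by
    rw [← integrable_vol_iff]
    refine (((hu.1.integrableOn_isCompact hK).continuousOn_mul
      hh.contDiff.continuous.abs.continuousOn hK).integrable_indicator hK.measurableSet).congr
      (ae_of_all _ fun p => ?_)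
    exact indicator_mul_right _ _ _
  have lim := tendsto_integral_coneLap_mul hβ hβ1 hγ hγ1 hh hF.1 hC hg hint
    (fun k => (hδ01 k).1) hδ
  have test_eq_zero (k : ℕ) :
      ∫ p, coneLap β γ (fun p => h p * F (regSqDist β γ (δ k) p)) p * g p = 0 := by
    rw [← hu.2.2 _ (isTest_mul_comp_regSqDist hβ hγ hh.contDiff hF (hδ01 k).1)]
    refine integral_congr_ae (ae_of_all _ fun p => ?_)
    dsimp only
    by_cases hp : p ∈ K
    · rw [show g p = u p from indicator_of_mem hp u, mul_comm]
    · rw [coneLap_eq_zero_of_eventuallyEq, zero_mul, mul_zero]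
      filter_upwards [(continuous_rad hβ hγ).continuousAt.eventually (lt_mem_nhds (not_le.1 hp))]
        with q hq
      rw [apply_regSqDist_eq_zero hβ hγ hF (hδ01 k).1 hq, mul_zero, Pi.zero_apply]
  simp only [test_eq_zero] at lim
  rw [integral_vol, ← mul_zero (1 / 4 : ℝ), ← tendsto_nhds_unique lim tendsto_const_nhds,
    ← integral_const_mul]
  refine integral_congr_ae (ae_of_all _ fun p => ?_)
  dsimp only
  by_cases hp : p ∈ K
  · rw [show g p = u p from indicator_of_mem hp u]
    ring
  · rw [(hF.profileOp _ _).2 _ (not_le.1 hp)]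
    ring

end TwoCones

/-! ### Dilations -/

section Dilation

variable {β γ : ℝ}

/-- `dilation β γ t` as a linear map. -/
def dilationLinearMap (β γ t : ℝ) : ℂ × ℂ →ₗ[ℝ] ℂ × ℂ :=
  LinearMap.prodMap ((t ^ (1 / β)) • LinearMap.id) ((t ^ (1 / γ)) • LinearMap.id)

lemma coe_dilationLinearMap (β γ t : ℝ) : ⇑(dilationLinearMap β γ t) = dilation β γ t := by
  ext p <;> simp [dilationLinearMap, dilation]

lemma det_dilationLinearMap {t : ℝ} (ht : 0 < t) :
    LinearMap.det (dilationLinearMap β γ t) = t ^ (2 / β + 2 / γ) := by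
  have hsq (a : ℝ) : (t ^ (1 / a)) ^ 2 = t ^ (2 / a) := by
    rw [← Real.rpow_mul_natCast ht.le]
    ring_nf
  rw [dilationLinearMap, LinearMap.det_prodMap, LinearMap.det_smul, LinearMap.det_smul,
    Complex.finrank_real_complex, LinearMap.det_id, mul_one, mul_one, hsq, hsq, Real.rpow_add ht]

lemma measurableEmbedding_dilation {t : ℝ} (ht : 0 < t) :
    MeasurableEmbedding (dilation β γ t) := by
  have h1 : ((t ^ (1 / β) : ℝ) : ℂ) ≠ 0 := by exact_mod_cast (Real.rpow_pos_of_pos ht _).ne'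
  have h2 : ((t ^ (1 / γ) : ℝ) : ℂ) ≠ 0 := by exact_mod_cast (Real.rpow_pos_of_pos ht _).ne'
  refine Continuous.measurableEmbedding (by unfold dilation; fun_prop) fun p q h => ?_
  obtain ⟨hfst, hsnd⟩ := Prod.mk.inj h
  exact Prod.ext (mul_left_cancel₀ h1 hfst) (mul_left_cancel₀ h2 hsnd)

lemma integral_comp_dilation {t : ℝ} (ht : 0 < t) (f : ℂ × ℂ → ℝ) :
    ∫ p, f (dilation β γ t p) = t ^ (-(2 / β + 2 / γ)) * ∫ p, f p := by
  have hpos := Real.rpow_pos_of_pos ht (2 / β + 2 / γ)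
  have hmap := Measure.map_linearMap_addHaar_eq_smul_addHaar (volume : Measure (ℂ × ℂ))
    (f := dilationLinearMap β γ t) (by rw [det_dilationLinearMap ht]; exact hpos.ne')
  rw [coe_dilationLinearMap, det_dilationLinearMap ht, abs_of_pos (inv_pos.2 hpos),
    ← Real.rpow_neg ht.le] at hmap
  rw [← (measurableEmbedding_dilation ht).integral_map, hmap, integral_smul_measure,
    ENNReal.toReal_ofReal (Real.rpow_nonneg ht.le _), smul_eq_mul]

lemma wt_ofReal_mul {α t : ℝ} (hα : α ≠ 0) (ht : 0 < t) (z : ℂ) :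
    wt α (((t ^ (1 / α) : ℝ) : ℂ) * z) = t ^ (2 - 2 / α) * wt α z := by
  have h := Real.rpow_pos_of_pos ht (1 / α)
  rw [wt, wt, norm_mul, Complex.norm_of_nonneg h.le, Real.mul_rpow h.le (norm_nonneg _),
    ← Real.rpow_mul ht.le]
  congr 2
  field_simp

lemma density_dilation (hβ : β ≠ 0) (hγ : γ ≠ 0) {t : ℝ} (ht : 0 < t) (p : ℂ × ℂ) :
    density β γ (dilation β γ t p) = t ^ (4 - (2 / β + 2 / γ)) * density β γ p := by
  rw [show 4 - (2 / β + 2 / γ) = 2 - 2 / β + (2 - 2 / γ) by ring, Real.rpow_add ht, density,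
    dilation, wt_ofReal_mul hβ ht, wt_ofReal_mul hγ ht, density]
  ring

lemma integral_vol_comp_dilation (hβ : β ≠ 0) (hγ : γ ≠ 0) {t : ℝ} (ht : 0 < t)
    (f : ℂ × ℂ → ℝ) :
    ∫ p, f (dilation β γ t p) ∂vol β γ = t ^ (-4 : ℝ) * ∫ p, f p ∂vol β γ := by
  have hpos := Real.rpow_pos_of_pos ht (4 - (2 / β + 2 / γ))
  have hdil (p : ℂ × ℂ) : density β γ p * f (dilation β γ t p) =
      (t ^ (4 - (2 / β + 2 / γ)))⁻¹ *
        (density β γ (dilation β γ t p) * f (dilation β γ t p)) := by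
    rw [density_dilation hβ hγ ht, mul_assoc, inv_mul_cancel_left₀ hpos.ne']
  rw [integral_vol, integral_vol]
  simp only [hdil]
  rw [integral_const_mul, integral_comp_dilation ht fun p => density β γ p * f p, ← mul_assoc,
    ← Real.rpow_neg ht.le, ← Real.rpow_add ht]
  ring_nf

lemma sqDist_dilation (hβ : β ≠ 0) (hγ : γ ≠ 0) {t : ℝ} (ht : 0 < t) (p : ℂ × ℂ) :
    sqDist β γ (dilation β γ t p) = t ^ 2 • sqDist β γ p :=
  Prod.ext (coneSq_ofReal_mul hβ ht _) (coneSq_ofReal_mul hγ ht _)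

lemma rad_dilation (hβ : β ≠ 0) (hγ : γ ≠ 0) {t : ℝ} (ht : 0 < t) (p : ℂ × ℂ) :
    rad β γ (dilation β γ t p) = t ^ 2 * rad β γ p := by
  rw [rad, sqDist_dilation hβ hγ ht, rad, mul_add]
  rfl

lemma rad_nonneg (β γ : ℝ) (p : ℂ × ℂ) : 0 ≤ rad β γ p :=
  add_nonneg (coneSq_nonneg β p.1) (coneSq_nonneg γ p.2)

lemma IsHomogeneous.mul {d e : ℝ} {f g : ℂ × ℂ → ℝ} (hf : IsHomogeneous β γ d f)
    (hg : IsHomogeneous β γ e g) : IsHomogeneous β γ (d + e) fun p => f p * g p := by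
  intro t ht
  filter_upwards [hf t ht, hg t ht] with p hfp hgp
  rw [hfp, hgp, Real.rpow_add ht]
  ring

lemma IsHomogeneous.integral_mul_comp_rad (hβ : β ≠ 0) (hγ : γ ≠ 0) {D : ℝ} {f : ℂ × ℂ → ℝ}
    (hf : IsHomogeneous β γ D f) {x : ℝ} (hx : 0 < x) (Y : ℝ → ℝ) :
    ∫ p, f p * Y (x * rad β γ p) ∂vol β γ =
      x ^ (-(D / 2 + 2)) * ∫ p, f p * Y (rad β γ p) ∂vol β γ := by
  have ht : 0 < √x := Real.sqrt_pos.2 hx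
  have hcomp : ∫ p, f (dilation β γ √x p) * Y (rad β γ (dilation β γ √x p)) ∂vol β γ =
      √x ^ D * ∫ p, f p * Y (x * rad β γ p) ∂vol β γ := by
    rw [← integral_const_mul]
    refine integral_congr_ae ((vol_absolutelyContinuous β γ).ae_le ?_)
    filter_upwards [hf _ ht] with p hp
    rw [hp, rad_dilation hβ hγ ht, Real.sq_sqrt hx.le, mul_assoc]
  rw [integral_vol_comp_dilation hβ hγ ht fun p => f p * Y (rad β γ p)] at hcomp
  rw [← mul_right_inj' (Real.rpow_pos_of_pos ht D).ne', ← hcomp, ← mul_assoc]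
  congr 1
  rw [Real.sqrt_eq_rpow, ← Real.rpow_mul hx.le, ← Real.rpow_mul hx.le, ← Real.rpow_add hx]
  ring_nf

end Dilation

/-! ### Cutoffs and the Euler identity -/

/-- Smooth functions on the line with support in `(-∞, 2]`. -/
def IsCutoff (X : ℝ → ℝ) : Prop :=
  ContDiff ℝ (⊤ : ℕ∞) X ∧ ∀ x, 2 < x → X x = 0

section Cutoff

variable {X Y : ℝ → ℝ}

lemma IsCutoff.deriv (hX : IsCutoff X) : IsCutoff (deriv X) := by
  refine ⟨(contDiff_infty_iff_deriv.1 hX.1).2, fun x hx => ?_⟩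
  have hzero : X =ᶠ[𝓝 x] fun _ => 0 := by
    filter_upwards [lt_mem_nhds hx] with y hy using hX.2 y hy
  rw [hzero.deriv_eq, deriv_const]

lemma IsCutoff.id_mul (hX : IsCutoff X) : IsCutoff fun x => x * X x :=
  ⟨contDiff_id.mul hX.1, fun x hx => mul_eq_zero_of_right _ (hX.2 x hx)⟩

lemma IsCutoff.exists_abs_le (hX : IsCutoff X) : ∃ C, ∀ x, 0 ≤ x → |X x| ≤ C := by
  obtain ⟨C, hC⟩ := (isCompact_Icc (a := (0 : ℝ)) (b := 2)).exists_bound_of_continuousOn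
    hX.1.continuous.continuousOn
  have hC0 : 0 ≤ C := (norm_nonneg _).trans (hC 0 (by simp))
  refine ⟨C, fun x hx0 => ?_⟩
  rcases lt_or_ge 2 x with hx | hx
  · rwa [hX.2 x hx, abs_zero]
  · exact hC x ⟨hx0, hx⟩

lemma IsCutoff.exists_deriv_eq (hY : IsCutoff Y) : ∃ X, IsCutoff X ∧ _root_.deriv X = Y := by
  have hderiv (x : ℝ) : HasDerivAt (fun x => ∫ s in (3 : ℝ)..x, Y s) (Y x) x :=
    hY.1.continuous.integral_hasStrictDerivAt 3 x |>.hasDerivAt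
  have hderiv_eq := funext fun x => (hderiv x).deriv
  refine ⟨_, ⟨contDiff_infty_iff_deriv.2 ⟨fun x => (hderiv x).differentiableAt, ?_⟩,
    fun x hx => ?_⟩, hderiv_eq⟩
  · rw [hderiv_eq]
    exact hY.1
  · refine (intervalIntegral.integral_congr fun s hs => hY.2 s ?_).trans
      intervalIntegral.integral_zero
    exact (lt_min (by norm_num) hx).trans_le hs.1

variable {β γ : ℝ} {f : ℂ × ℂ → ℝ}

lemma norm_mul_comp_mul_le {C : ℝ} (hX : IsCutoff X) (hC : ∀ x, 0 ≤ x → |x * X x| ≤ C) {x r : ℝ}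
    (hx : 1 / 2 < x) (hr : 0 ≤ r) :
    ‖r * X (x * r)‖ ≤ (Iic 4).indicator (fun _ => 2 * C) r := by
  by_cases hr4 : r ≤ 4
  · rw [indicator_of_mem (show r ∈ Iic 4 from hr4)]
    have : 0 < x := by linarith
    calc ‖r * X (x * r)‖ = |r| * |X (x * r)| := abs_mul _ _
      _ ≤ (2 * (x * r)) * |X (x * r)| := by
        rw [abs_of_nonneg hr]
        gcongr
        nlinarith
      _ = 2 * |x * r * X (x * r)| := by
        rw [abs_mul (x * r), abs_of_nonneg (show 0 ≤ x * r by positivity), mul_assoc]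
      _ ≤ 2 * C := by gcongr; exact hC _ (by positivity)
  · rw [indicator_of_notMem (show r ∉ Iic 4 from hr4), hX.2 _ (by nlinarith), mul_zero, norm_zero]

lemma hasDerivAt_integral_mul_comp_rad (hβ : 0 < β) (hγ : 0 < γ)
    (hf : LocallyIntegrable f (vol β γ)) (hX : IsCutoff X) :
    HasDerivAt (fun x => ∫ p, f p * X (x * rad β γ p) ∂vol β γ)
      (∫ p, f p * (rad β γ p * deriv X (rad β γ p)) ∂vol β γ) 1 := by
  obtain ⟨C, hC⟩ := hX.deriv.id_mul.exists_abs_le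
  have hrad := continuous_rad hβ hγ
  have hK := isCompact_rad_le hβ hγ 4
  have hX_cont := hX.1.continuous
  have hX'_cont := hX.deriv.1.continuous
  have hcomp (x : ℝ) : Continuous fun p => X (x * rad β γ p) := by fun_prop
  have hcomp' (x : ℝ) : Continuous fun p => rad β γ p * deriv X (x * rad β γ p) := by fun_prop
  have hbound : Integrable
      (fun p => ‖f p‖ * (Iic 4).indicator (fun _ => 2 * C) (rad β γ p)) (vol β γ) := by
    have hnorm := (hf.integrableOn_isCompact hK).norm.mul_const (2 * C)
    refine (IntegrableOn.integrable_indicator hnorm hK.measurableSet).congr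
      (ae_of_all _ fun p => ?_)
    exact indicator_mul_right _ _ _
  have hderiv (p : ℂ × ℂ) (x : ℝ) : HasDerivAt (fun x => f p * X (x * rad β γ p))
      (f p * (rad β γ p * deriv X (x * rad β γ p))) x := by
    have hX_deriv := (hX.1.differentiable (by simp) (x * rad β γ p)).hasDerivAt.comp x
      (hasDerivAt_mul_const (rad β γ p))
    rw [mul_comm (rad β γ p)]
    exact hX_deriv.const_mul _
  have hmain := (hasDerivAt_integral_of_dominated_loc_of_deriv_le (x₀ := 1)
    (F := fun x p => f p * X (x * rad β γ p))
    (F' := fun x p => f p * (rad β γ p * deriv X (x * rad β γ p)))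
    (Ioi_mem_nhds (show (1 / 2 : ℝ) < 1 by norm_num))
    (Eventually.of_forall fun x => hf.aestronglyMeasurable.mul (hcomp x).aestronglyMeasurable)
    (integrable_mul_of_rad hβ hγ hf (hcomp 1) fun p hp => hX.2 _ (by rwa [one_mul]))
    (hf.aestronglyMeasurable.mul (hcomp' 1).aestronglyMeasurable)
    (ae_of_all _ fun p x hx => (norm_mul _ _).trans_le (mul_le_mul_of_nonneg_left
      (norm_mul_comp_mul_le hX.deriv hC hx (rad_nonneg β γ p)) (norm_nonneg _)))
    hbound (ae_of_all _ fun p x _ => hderiv p x)).2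
  simpa only [one_mul] using hmain

lemma IsHomogeneous.integral_mul_rad_mul_deriv (hβ : 0 < β) (hγ : 0 < γ) {D : ℝ}
    (hfD : IsHomogeneous β γ D f) (hf : LocallyIntegrable f (vol β γ)) (hX : IsCutoff X) :
    ∫ p, f p * (rad β γ p * deriv X (rad β γ p)) ∂vol β γ =
      -(D / 2 + 2) * ∫ p, f p * X (rad β γ p) ∂vol β γ := by
  refine (hasDerivAt_integral_mul_comp_rad hβ hγ hf hX).unique ?_
  have hpow := (Real.hasDerivAt_rpow_const (x := 1) (p := -(D / 2 + 2)) (.inl one_ne_zero))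
    |>.mul_const (∫ p, f p * X (rad β γ p) ∂vol β γ)
  rw [Real.one_rpow, mul_one] at hpow
  refine hpow.congr_of_eventuallyEq ?_
  filter_upwards [lt_mem_nhds one_pos] with x hx
  exact hfD.integral_mul_comp_rad hβ.ne' hγ.ne' hx X

end Cutoff

/-! ### Moments of the solution against radial cutoffs -/

/-- The function `x ↦ x.1^k x.2^l Y(x.1 + x.2)` of the two squared distances. -/
def monomialProfile (k l : ℕ) (Y : ℝ → ℝ) (x : ℝ × ℝ) : ℝ := x.1 ^ k * x.2 ^ l * Y (x.1 + x.2)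

section MonomialProfile

variable {Y : ℝ → ℝ}

lemma IsCutoff.isProfile (hY : IsCutoff Y) (k l : ℕ) : IsProfile (monomialProfile k l Y) :=
  ⟨((contDiff_fst.pow k).mul (contDiff_snd.pow l)).mul (hY.1.comp (contDiff_fst.add contDiff_snd)),
    fun _ hx => mul_eq_zero_of_right _ (hY.2 _ hx)⟩

lemma dirD_monomialProfile (k l : ℕ) (hY : Differentiable ℝ Y) (e : ℝ × ℝ) :
    dirD e (monomialProfile k l Y) = fun x =>
      e.1 * (k * monomialProfile (k - 1) l Y x) + e.2 * (l * monomialProfile k (l - 1) Y x) +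
        (e.1 + e.2) * monomialProfile k l (deriv Y) x := by
  ext x
  have hfst : HasFDerivAt (fun x : ℝ × ℝ => x.1) (ContinuousLinearMap.fst ℝ ℝ ℝ) x :=
    hasFDerivAt_fst
  have hsnd : HasFDerivAt (fun x : ℝ × ℝ => x.2) (ContinuousLinearMap.snd ℝ ℝ ℝ) x :=
    hasFDerivAt_snd
  have hderiv := ((hfst.pow k).mul (hsnd.pow l)).mul
    ((hY (x.1 + x.2)).hasDerivAt.comp_hasFDerivAt x (hfst.add hsnd))
  refine (congrArg (fun L : ℝ × ℝ →L[ℝ] ℝ => L e) hderiv.fderiv).trans ?_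
  simp [monomialProfile]
  ring

lemma dirD_const_mul_add {f g : ℝ × ℝ → ℝ} (hf : Differentiable ℝ f) (hg : Differentiable ℝ g)
    (c : ℝ) (e x : ℝ × ℝ) :
    dirD e (fun x => c * f x + g x) x = c * dirD e f x + dirD e g x := by
  rw [dirD, fderiv_fun_add ((hf x).const_mul c) (hg x), fderiv_const_mul (hf x)]
  rfl

lemma profileOp_monomialProfile (k l : ℕ) (hY : IsCutoff Y) (μ ν : ℝ) (x : ℝ × ℝ) :
    profileOp μ ν (monomialProfile k l Y) x =
      k * (k + μ) * monomialProfile (k - 1) l Y x + l * (l + ν) * monomialProfile k (l - 1) Y x +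
        (2 * (k + l + 1) + μ + ν) * monomialProfile k l (deriv Y) x +
        (x.1 + x.2) * monomialProfile k l (deriv (deriv Y)) x := by
  have hdiff {Y : ℝ → ℝ} (hY : IsCutoff Y) (k l : ℕ) : Differentiable ℝ (monomialProfile k l Y) :=
    (hY.isProfile k l).1.differentiable (by simp)
  have hY_diff : Differentiable ℝ Y := hY.1.differentiable (by simp)
  have hY'_diff : Differentiable ℝ (deriv Y) := hY.deriv.1.differentiable (by simp)
  have hfst : dirD (1, 0) (monomialProfile k l Y) =
      fun x => k * monomialProfile (k - 1) l Y x + monomialProfile k l (deriv Y) x := by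
    rw [dirD_monomialProfile k l hY_diff]
    ext x
    ring
  have hsnd : dirD (0, 1) (monomialProfile k l Y) =
      fun x => l * monomialProfile k (l - 1) Y x + monomialProfile k l (deriv Y) x := by
    rw [dirD_monomialProfile k l hY_diff]
    ext x
    ring
  rw [profileOp, hfst, hsnd, dirD_const_mul_add (hdiff hY _ _) (hdiff hY.deriv _ _),
    dirD_const_mul_add (hdiff hY _ _) (hdiff hY.deriv _ _)]
  simp only [dirD_monomialProfile _ _ hY_diff, dirD_monomialProfile _ _ hY'_diff, monomialProfile]
  rcases k with - | - | k <;> rcases l with - | - | l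
  all_goals
    push_cast
    ring

end MonomialProfile

/-- The integral of `u` against `h` times a function of the two squared distances. -/
def moment (β γ : ℝ) (u h : ℂ × ℂ → ℝ) (F : ℝ × ℝ → ℝ) : ℝ :=
  ∫ p, u p * (h p * F (sqDist β γ p)) ∂vol β γ

section Moment

variable {β γ d : ℝ} {m n k l : ℕ} {u h : ℂ × ℂ → ℝ} {F G : ℝ × ℝ → ℝ} {X Y : ℝ → ℝ}

lemma integrable_mul_comp_sqDist (hβ : 0 < β) (hγ : 0 < γ) (hu : LocallyIntegrable u (vol β γ))
    (hh : Continuous h) (hF : IsProfile F) :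
    Integrable (fun p => u p * (h p * F (sqDist β γ p))) (vol β γ) :=
  integrable_mul_of_rad hβ hγ hu (hh.mul (hF.1.continuous.comp (continuous_sqDist hβ hγ)))
    fun _ hp => mul_eq_zero_of_right _ (hF.2 _ hp)

lemma moment_const_mul (c : ℝ) : moment β γ u h (fun x => c * F x) = c * moment β γ u h F := by
  rw [moment, moment, ← integral_const_mul]
  simp only [mul_left_comm]

lemma moment_add (hβ : 0 < β) (hγ : 0 < γ) (hu : LocallyIntegrable u (vol β γ))
    (hh : Continuous h) (hF : IsProfile F) (hG : IsProfile G) :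
    moment β γ u h (fun x => F x + G x) = moment β γ u h F + moment β γ u h G := by
  rw [moment, moment, moment, ← integral_add (integrable_mul_comp_sqDist hβ hγ hu hh hF)
    (integrable_mul_comp_sqDist hβ hγ hu hh hG)]
  simp only [mul_add]

lemma isHomogeneous_sqDist_pow (hβ : β ≠ 0) (hγ : γ ≠ 0) (k l : ℕ) :
    IsHomogeneous β γ (2 * (k + l)) fun p => (sqDist β γ p).1 ^ k * (sqDist β γ p).2 ^ l := by
  refine fun t ht => ae_of_all _ fun p => ?_
  dsimp only
  rw [sqDist_dilation hβ hγ ht, Real.rpow_mul ht.le, Real.rpow_add (Real.rpow_pos_of_pos ht 2)]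
  simp only [Prod.smul_fst, Prod.smul_snd, smul_eq_mul, mul_pow, Real.rpow_natCast,
    Real.rpow_ofNat]
  ring

lemma moment_add_mul_monomialProfile_deriv (hβ : 0 < β) (hγ : 0 < γ)
    (hu : LocallyIntegrable u (vol β γ)) (hud : IsHomogeneous β γ d u)
    (hh : IsBihomogeneousHarmonic m n h) (k l : ℕ) (hX : IsCutoff X) :
    moment β γ u h (fun x => (x.1 + x.2) * monomialProfile k l (deriv X) x) =
      -((d + (m / β + n / γ)) / 2 + k + l + 2) * moment β γ u h (monomialProfile k l X) := by
  have hpoly : Continuous fun p => h p * ((sqDist β γ p).1 ^ k * (sqDist β γ p).2 ^ l) :=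
    hh.contDiff.continuous.mul (((continuous_sqDist hβ hγ).fst.pow k).mul
      ((continuous_sqDist hβ hγ).snd.pow l))
  have euler := IsHomogeneous.integral_mul_rad_mul_deriv hβ hγ
    (hud.mul (hh.isHomogeneous.mul (isHomogeneous_sqDist_pow hβ.ne' hγ.ne' k l)))
    (hu.mul_continuous hpoly) hX
  rw [show (d + (m / β + n / γ)) / 2 + k + l + 2 =
    (d + (m / β + n / γ + 2 * (k + l))) / 2 + 2 by ring]
  convert euler using 1
  · refine integral_congr_ae (ae_of_all _ fun p => ?_)
    simp only [monomialProfile, rad]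
    ring
  · congr 1
    refine integral_congr_ae (ae_of_all _ fun p => ?_)
    simp only [monomialProfile, rad]
    ring

lemma moment_recursion (hβ : 0 < β) (hβ1 : β ≤ 1) (hγ : 0 < γ) (hγ1 : γ ≤ 1)
    (hu : u ∈ veryWeakSolutions β γ) (hud : IsHomogeneous β γ d u)
    (hh : IsBihomogeneousHarmonic m n h) (k l : ℕ) (hX : IsCutoff X) :
    k * (k + m / β) * moment β γ u h (monomialProfile (k - 1) l X) +
      l * (l + n / γ) * moment β γ u h (monomialProfile k (l - 1) X) +
      (k + l + (m / β + n / γ - d) / 2) * moment β γ u h (monomialProfile k l (deriv X)) = 0 := by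
  have hzero : moment β γ u h (profileOp (m / β) (n / γ) (monomialProfile k l X)) = 0 :=
    integral_mul_profileOp hβ hβ1 hγ hγ1 hu hh (hX.isProfile k l)
  have hcont := hh.contDiff.continuous
  have h₁ := (hX.isProfile (k - 1) l).mul_left (contDiff_const (c := (k : ℝ) * (k + m / β)))
  have h₂ := (hX.isProfile k (l - 1)).mul_left (contDiff_const (c := (l : ℝ) * (l + n / γ)))
  have h₃ := (hX.deriv.isProfile k l).mul_left
    (contDiff_const (c := 2 * ((k : ℝ) + l + 1) + m / β + n / γ))
  have h₄ := (hX.deriv.deriv.isProfile k l).mul_left (contDiff_fst.add contDiff_snd)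
  rw [funext (profileOp_monomialProfile k l hX _ _),
    moment_add hβ hγ hu.1 hcont ((h₁.add h₂).add h₃) h₄, moment_add hβ hγ hu.1 hcont (h₁.add h₂) h₃,
    moment_add hβ hγ hu.1 hcont h₁ h₂, moment_const_mul, moment_const_mul, moment_const_mul,
    moment_add_mul_monomialProfile_deriv hβ hγ hu.1 hud hh k l hX.deriv] at hzero
  linear_combination hzero

/-- Every cutoff is the derivative of a cutoff, so the recursion yields the top moment. -/
lemma moment_eq_zero_of_coeff_ne_zero (hβ : 0 < β) (hβ1 : β ≤ 1) (hγ : 0 < γ) (hγ1 : γ ≤ 1)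
    (hu : u ∈ veryWeakSolutions β γ) (hud : IsHomogeneous β γ d u)
    (hh : IsBihomogeneousHarmonic m n h) (hne : (k + l + (m / β + n / γ - d) / 2 : ℝ) ≠ 0)
    (hk : k ≠ 0 → ∀ X, IsCutoff X → moment β γ u h (monomialProfile (k - 1) l X) = 0)
    (hl : l ≠ 0 → ∀ X, IsCutoff X → moment β γ u h (monomialProfile k (l - 1) X) = 0)
    (hY : IsCutoff Y) : moment β γ u h (monomialProfile k l Y) = 0 := by
  obtain ⟨X, hX, rfl⟩ := hY.exists_deriv_eq
  have hrec := moment_recursion hβ hβ1 hγ hγ1 hu hud hh k l hX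
  have hfst : (k : ℝ) * (k + m / β) * moment β γ u h (monomialProfile (k - 1) l X) = 0 := by
    rcases eq_or_ne k 0 with rfl | hk0
    · simp
    · rw [hk hk0 X hX, mul_zero]
  have hsnd : (l : ℝ) * (l + n / γ) * moment β γ u h (monomialProfile k (l - 1) X) = 0 := by
    rcases eq_or_ne l 0 with rfl | hl0
    · simp
    · rw [hl hl0 X hX, mul_zero]
  rw [hfst, hsnd, zero_add, zero_add] at hrec
  exact (mul_eq_zero.1 hrec).resolve_left hne

lemma IsBihomogeneousHarmonic.exists_eq_const (hh : IsBihomogeneousHarmonic 0 0 h) :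
    ∃ c, h = fun _ => c := by
  refine ⟨h (0, 0), funext fun ⟨z, w⟩ => ?_⟩
  obtain ⟨a, ha⟩ := hh.exists_fst w
  obtain ⟨b, hb⟩ := hh.exists_snd 0
  rw [ha, hb, show harmPoly 0 a z = harmPoly 0 a 0 by simp [harmPoly], ← ha, hb]
  simp [harmPoly]

lemma moment_linear_eq_zero (hβ : 0 < β) (hβ1 : β ≤ 1) (hγ : 0 < γ) (hγ1 : γ ≤ 1)
    (hu : u ∈ veryWeakSolutions β γ) (hud : IsHomogeneous β γ 2 u)
    (hh : IsBihomogeneousHarmonic 0 0 h)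
    (hquad : ∀ X, IsCutoff X → ∫ p, u p * (quadHarm β γ p * X (rad β γ p)) ∂vol β γ = 0)
    (hY : IsCutoff Y) :
    moment β γ u h (monomialProfile 1 0 Y) = 0 ∧ moment β γ u h (monomialProfile 0 1 Y) = 0 := by
  obtain ⟨c, rfl⟩ := hh.exists_eq_const
  have hadd : moment β γ u (fun _ => c) (monomialProfile 1 0 Y) +
      moment β γ u (fun _ => c) (monomialProfile 0 1 Y) = 0 := by
    rw [← moment_add hβ hγ hu.1 hh.contDiff.continuous (hY.isProfile 1 0) (hY.isProfile 0 1),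
      ← moment_eq_zero_of_coeff_ne_zero hβ hβ1 hγ hγ1 hu hud hh (k := 0) (l := 0) (by norm_num)
        (absurd rfl) (absurd rfl) hY.id_mul]
    congr 1
    ext x
    simp only [monomialProfile]
    ring
  have hsub : moment β γ u (fun _ => c) (monomialProfile 1 0 Y) +
      -1 * moment β γ u (fun _ => c) (monomialProfile 0 1 Y) = 0 := by
    rw [← moment_const_mul, ← moment_add hβ hγ hu.1 hh.contDiff.continuous (hY.isProfile 1 0)
      ((hY.isProfile 0 1).mul_left contDiff_const), ← mul_zero c, ← hquad Y hY,
      ← integral_const_mul]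
    refine integral_congr_ae (ae_of_all _ fun p => ?_)
    simp only [monomialProfile, quadHarm, sqDist, rad]
    ring
  constructor <;> linarith

lemma eq_or_eq_of_coeff_eq_zero (hβ : 0 < β) (hγ : 0 < γ) (hd : d ≤ 2)
    (h : (k + l + (m / β + n / γ - d) / 2 : ℝ) = 0) :
    (k = 0 ∧ l = 0 ∧ m / β + n / γ = d) ∨ (k + l = 1 ∧ d = 2 ∧ m = 0 ∧ n = 0) := by
  have hm : 0 ≤ m / β := by positivity
  have hn : 0 ≤ n / γ := by positivity
  have hkl : k + l ≤ 1 := by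
    have : (k + l : ℝ) ≤ 1 := by linarith
    exact_mod_cast this
  obtain ⟨rfl, rfl⟩ | hkl1 : k = 0 ∧ l = 0 ∨ k + l = 1 := by omega
  · push_cast at h
    exact .inl ⟨rfl, rfl, by linarith⟩
  · have hkl' : (k + l : ℝ) = 1 := by exact_mod_cast hkl1
    have hm0 : m / β = 0 := by linarith
    have hn0 : n / γ = 0 := by linarith
    exact .inr ⟨hkl1, by linarith, by exact_mod_cast (div_eq_zero_iff.1 hm0).resolve_right hβ.ne',
      by exact_mod_cast (div_eq_zero_iff.1 hn0).resolve_right hγ.ne'⟩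

theorem moment_monomialProfile_eq_zero (hβ : 0 < β) (hβ1 : β ≤ 1) (hγ : 0 < γ) (hγ1 : γ ≤ 1)
    (hd : d ≤ 2) (hu : u ∈ veryWeakSolutions β γ) (hud : IsHomogeneous β γ d u)
    (hh : IsBihomogeneousHarmonic m n h)
    (hres : m / β + n / γ = d → ∀ X, IsCutoff X →
      ∫ p, u p * (h p * X (rad β γ p)) ∂vol β γ = 0)
    (hquad : d = 2 → ∀ X, IsCutoff X →
      ∫ p, u p * (quadHarm β γ p * X (rad β γ p)) ∂vol β γ = 0) (k l : ℕ) (hY : IsCutoff Y) :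
    moment β γ u h (monomialProfile k l Y) = 0 := by
  induction hN : k + l using Nat.strong_induction_on generalizing k l Y with
  | _ N ih =>
  by_cases hne : (k + l + (m / β + n / γ - d) / 2 : ℝ) = 0
  · obtain ⟨rfl, rfl, hd_eq⟩ | ⟨hkl, rfl, rfl, rfl⟩ := eq_or_eq_of_coeff_eq_zero hβ hγ hd hne
    · simpa only [moment, monomialProfile, rad, pow_zero, one_mul] using hres hd_eq Y hY
    · have hlinear := moment_linear_eq_zero hβ hβ1 hγ hγ1 hu hud hh (hquad rfl) hY
      obtain ⟨rfl, rfl⟩ | ⟨rfl, rfl⟩ : k = 1 ∧ l = 0 ∨ k = 0 ∧ l = 1 := by omega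
      exacts [hlinear.1, hlinear.2]
  · exact moment_eq_zero_of_coeff_ne_zero hβ hβ1 hγ hγ1 hu hud hh hne
      (fun hk _ hX => ih _ (by omega) _ _ hX rfl) (fun hl _ hX => ih _ (by omega) _ _ hX rfl) hY

end Moment

/-! ### Density arguments -/

section Density

variable {𝕜 E Ω : Type*} [RCLike 𝕜] [TopologicalSpace E] [MeasurableSpace Ω] {μ : Measure Ω}

lemma exists_mem_starSubalgebra_near (A : StarSubalgebra 𝕜 C(E, 𝕜)) (hA : A.SeparatesPoints)
    {K : Set E} (hK : IsCompact K) (g : C(E, 𝕜)) {ε : ℝ} (hε : 0 < ε) :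
    ∃ a ∈ A, ∀ x ∈ K, ‖g x - a x‖ < ε := by
  have : CompactSpace K := isCompact_iff_compactSpace.1 hK
  let restrict : C(E, 𝕜) →⋆ₐ[𝕜] C(K, 𝕜) :=
    ContinuousMap.compStarAlgHom' 𝕜 𝕜 ⟨Subtype.val, continuous_subtype_val⟩
  have hsep : (A.map restrict).SeparatesPoints := fun x y hxy => by
    obtain ⟨_, ⟨a, ha, rfl⟩, hne⟩ := hA (Subtype.coe_injective.ne hxy)
    exact ⟨_, ⟨restrict a, ⟨a, ha, rfl⟩, rfl⟩, hne⟩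
  have hclosure : restrict g ∈ (A.map restrict).topologicalClosure := by
    rw [ContinuousMap.starSubalgebra_topologicalClosure_eq_top_of_separatesPoints _ hsep]
    trivial
  obtain ⟨_, ⟨a, ha, rfl⟩, hdist⟩ := Metric.mem_closure_iff.1 hclosure ε hε
  refine ⟨a, ha, fun x hx => ?_⟩
  rw [dist_eq_norm] at hdist
  exact ((restrict g - restrict a).norm_coe_le_norm ⟨x, hx⟩).trans_lt hdist

lemma integrable_mul_comp_of_isCompact [MeasurableSpace E] [BorelSpace E] {f : Ω → 𝕜} {s : Ω → E}
    {K : Set E} (hf : Integrable f μ) (hs : Measurable s) (hK : IsCompact K)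
    (hsK : ∀ x, s x ∉ K → f x = 0) (g : C(E, 𝕜)) : Integrable (fun x => f x * g (s x)) μ := by
  obtain ⟨C, hC⟩ := hK.exists_bound_of_continuousOn g.continuous.continuousOn
  refine (hf.norm.mul_const C).mono'
    (hf.aestronglyMeasurable.mul (g.measurable.comp hs).aestronglyMeasurable)
    (ae_of_all _ fun x => ?_)
  rw [norm_mul]
  by_cases hx : s x ∈ K
  · gcongr
    exact hC _ hx
  · rw [hsK x hx, norm_zero, zero_mul, zero_mul]

lemma integral_mul_comp_eq_zero_of_near [MeasurableSpace E] [BorelSpace E] {f : Ω → 𝕜} {s : Ω → E}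
    {K : Set E} (hf : Integrable f μ) (hs : Measurable s) (hK : IsCompact K)
    (hsK : ∀ x, s x ∉ K → f x = 0) (g : C(E, 𝕜))
    (hg : ∀ ε > 0, ∃ a : C(E, 𝕜), (∀ x ∈ K, ‖g x - a x‖ < ε) ∧ ∫ x, f x * a (s x) ∂μ = 0) :
    ∫ x, f x * g (s x) ∂μ = 0 := by
  have hint := integrable_mul_comp_of_isCompact hf hs hK hsK
  have hle (ε : ℝ) (hε : 0 < ε) : ‖∫ x, f x * g (s x) ∂μ‖ ≤ (∫ x, ‖f x‖ ∂μ) * ε := by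
    obtain ⟨a, hnear, ha⟩ := hg ε hε
    rw [← sub_zero (∫ x, f x * g (s x) ∂μ), ← ha, ← integral_sub (hint g) (hint a),
      ← integral_mul_const]
    refine norm_integral_le_of_norm_le (hf.norm.mul_const ε) (ae_of_all _ fun x => ?_)
    rw [← mul_sub, norm_mul]
    by_cases hx : s x ∈ K
    · gcongr
      exact (hnear _ hx).le
    · rw [hsK x hx, norm_zero, zero_mul, zero_mul]
  have hlim : Tendsto (fun ε : ℝ => (∫ x, ‖f x‖ ∂μ) * ε) (𝓝[>] 0) (𝓝 0) := by
    refine ((continuous_const_mul (∫ x, ‖f x‖ ∂μ)).tendsto' 0 0 (mul_zero _)).mono_left ?_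
    exact nhdsWithin_le_nhds
  exact norm_le_zero_iff.1 (ge_of_tendsto hlim (eventually_mem_nhdsWithin.mono hle))

theorem integral_mul_comp_eq_zero_of_submonoid [MeasurableSpace E] [BorelSpace E] {f : Ω → 𝕜}
    {s : Ω → E} {K : Set E} (hf : Integrable f μ) (hs : Measurable s) (hK : IsCompact K)
    (hsK : ∀ x, s x ∉ K → f x = 0) (M : Submonoid C(E, 𝕜)) (hstar : ∀ a ∈ M, star a ∈ M)
    (hsep : ∀ x y, (∀ a ∈ M, a x = a y) → x = y) (h0 : ∀ a ∈ M, ∫ x, f x * a (s x) ∂μ = 0)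
    (g : C(E, 𝕜)) : ∫ x, f x * g (s x) ∂μ = 0 := by
  let A : StarSubalgebra 𝕜 C(E, 𝕜) := StarAlgebra.adjoin 𝕜 M
  have hA : A.SeparatesPoints := fun x y hxy => by
    by_contra! heq
    exact hxy (hsep x y fun a ha => heq a ⟨a, StarAlgebra.subset_adjoin 𝕜 _ ha, rfl⟩)
  have hspan : ∀ a ∈ A, a ∈ Submodule.span 𝕜 (M : Set C(E, 𝕜)) := fun a ha => by
    have hM : (M : Set C(E, 𝕜)) ∪ star M = M :=
      union_eq_left.2 fun b hb => star_star b ▸ hstar _ hb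
    rwa [← StarSubalgebra.mem_toSubalgebra, ← Subalgebra.mem_toSubmodule,
      StarAlgebra.adjoin_eq_span, hM, Submonoid.closure_eq] at ha
  have hint := integrable_mul_comp_of_isCompact hf hs hK hsK
  refine integral_mul_comp_eq_zero_of_near hf hs hK hsK g fun ε hε => ?_
  obtain ⟨a, ha, hnear⟩ := exists_mem_starSubalgebra_near A hA hK g hε
  refine ⟨a, hnear, ?_⟩
  replace ha := hspan a ha
  clear hnear
  induction ha using Submodule.span_induction with
  | mem a ha => exact h0 a ha
  | zero => simp
  | add a b _ _ ha hb =>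
    simp only [ContinuousMap.add_apply, mul_add]
    rw [integral_add (hint a) (hint b), ha, hb, add_zero]
  | smul c a _ ha =>
    simp only [ContinuousMap.smul_apply, smul_eq_mul, mul_left_comm _ c]
    rw [integral_const_mul, ha, mul_zero]

lemma integral_eq_integral_map_withDensity_sub {f r : Ω → ℝ} (hf : Integrable f μ)
    (hr : Measurable r) {Y : ℝ → ℝ} (hY : Measurable Y)
    (hfY : Integrable (fun x => f x * Y (r x)) μ) :
    ∫ x, f x * Y (r x) ∂μ =
      ∫ y, Y y ∂(μ.withDensity fun x => ENNReal.ofReal (f x)).map r -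
        ∫ y, Y y ∂(μ.withDensity fun x => ENNReal.ofReal (-f x)).map r := by
  have hmap {g : Ω → ℝ} (hg : AEMeasurable g μ) :
      ∫ y, Y y ∂(μ.withDensity fun x => ENNReal.ofReal (g x)).map r =
        ∫ x, max (g x) 0 * Y (r x) ∂μ := by
    rw [integral_map hr.aemeasurable hY.aestronglyMeasurable,
      integral_withDensity_eq_integral_toReal_smul₀ hg.ennreal_ofReal (by simp)]
    simp only [ENNReal.toReal_ofReal', smul_eq_mul]
  have hint {g : Ω → ℝ} (hg : AEMeasurable g μ) (hgf : ∀ x, |g x| = |f x|) :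
      Integrable (fun x => max (g x) 0 * Y (r x)) μ := by
    refine hfY.mono ((hg.max aemeasurable_const).mul (hY.comp hr).aemeasurable).aestronglyMeasurable
      (ae_of_all _ fun x => ?_)
    rw [norm_mul, norm_mul, Real.norm_eq_abs (f x), ← hgf, Real.norm_eq_abs]
    refine mul_le_mul_of_nonneg_right ?_ (norm_nonneg _)
    rw [abs_of_nonneg (le_max_right _ _)]
    exact max_le (le_abs_self _) (abs_nonneg _)
  have hfm : AEMeasurable f μ := hf.aestronglyMeasurable.aemeasurable
  have hfm' : AEMeasurable (fun x => -f x) μ := hfm.neg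
  rw [hmap hfm, hmap hfm', ← integral_sub (hint hfm fun _ => rfl) (hint hfm' fun _ => abs_neg _)]
  refine integral_congr_ae (ae_of_all _ fun x => ?_)
  dsimp only
  rw [← sub_mul, max_zero_sub_max_neg_zero_eq_self]

theorem integral_mul_comp_eq_zero_of_setIntegral_le {f r : Ω → ℝ} (hf : Integrable f μ)
    (hr : Measurable r) (h : ∀ x, ∫ p in {p | r p ≤ x}, f p ∂μ = 0) {Y : ℝ → ℝ}
    (hY : Measurable Y) : ∫ p, f p * Y (r p) ∂μ = 0 := by
  have heq : (μ.withDensity fun x => ENNReal.ofReal (f x)).map r =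
      (μ.withDensity fun x => ENNReal.ofReal (-f x)).map r := by
    have : IsFiniteMeasure (μ.withDensity fun x => ENNReal.ofReal (f x)) :=
      isFiniteMeasure_withDensity_ofReal hf.2
    refine Measure.ext_of_Iic _ _ fun x => ?_
    have hmeas := hr (measurableSet_Iic (a := x))
    have hx := h x
    rw [integral_eq_lintegral_pos_part_sub_lintegral_neg_part hf.integrableOn, sub_eq_zero,
      ENNReal.toReal_eq_toReal_iff' hf.integrableOn.lintegral_lt_top.ne
        (Integrable.lintegral_lt_top (f := fun p => -f p) hf.integrableOn.neg).ne] at hx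
    rw [Measure.map_apply hr measurableSet_Iic, Measure.map_apply hr measurableSet_Iic,
      withDensity_apply _ hmeas, withDensity_apply _ hmeas]
    exact hx
  by_cases hfY : Integrable (fun x => f x * Y (r x)) μ
  · rw [integral_eq_integral_map_withDensity_sub hf hr hY hfY, heq, sub_self]
  · exact integral_undef hfY

end Density

/-! ### Vanishing of functions without moments -/

section Radial

variable {β γ D : ℝ} {f : ℂ × ℂ → ℝ} {X : ℝ → ℝ}

lemma IsHomogeneous.setIntegral_rad_le_eq_zero (hβ : 0 < β) (hγ : 0 < γ)
    (hf : IsHomogeneous β γ D f) (h1 : ∫ p in {p | rad β γ p ≤ 1}, f p ∂vol β γ = 0) (x : ℝ) :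
    ∫ p in {p | rad β γ p ≤ x}, f p ∂vol β γ = 0 := by
  have hind (x y : ℝ) (hx : 0 < x) : ∫ p in {p | rad β γ p ≤ y}, f p ∂vol β γ =
      ∫ p, f p * (Iic (x * y)).indicator 1 (x * rad β γ p) ∂vol β γ := by
    rw [← integral_indicator (isCompact_rad_le hβ hγ y).measurableSet]
    refine integral_congr_ae (ae_of_all _ fun p => ?_)
    simp only [indicator_apply, mem_ofPred_eq, mem_Iic, mul_le_mul_iff_right₀ hx, Pi.one_apply,
      mul_ite, mul_one, mul_zero]
  rcases le_or_gt x 0 with hx | hx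
  · refine setIntegral_measure_zero _ (vol_absolutelyContinuous β γ ?_)
    refine measure_mono_null (fun p (hp : rad β γ p ≤ x) => ?_) (ae_iff.1 ae_fst_ne_zero)
    have hle : coneSq β p.1 ≤ 0 :=
      (le_add_of_nonneg_right (coneSq_nonneg γ p.2)).trans (hp.trans hx)
    have hnorm := norm_le_of_coneSq_le hβ hle
    rw [zero_mul, Real.zero_rpow (by positivity)] at hnorm
    exact not_not.2 (norm_le_zero_iff.1 hnorm)
  · have h := hind x⁻¹ x (inv_pos.2 hx)
    rw [inv_mul_cancel₀ hx.ne'] at h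
    rw [h, hf.integral_mul_comp_rad hβ.ne' hγ.ne' (inv_pos.2 hx)]
    refine mul_eq_zero_of_right _ ?_
    simpa only [one_mul, h1] using (hind 1 1 one_pos).symm

lemma IsHomogeneous.integral_mul_comp_rad_eq_zero (hβ : 0 < β) (hγ : 0 < γ)
    (hf : IsHomogeneous β γ D f) (hfint : LocallyIntegrable f (vol β γ))
    (h1 : ∫ p in {p | rad β γ p ≤ 1}, f p ∂vol β γ = 0) (hX : IsCutoff X) :
    ∫ p, f p * X (rad β γ p) ∂vol β γ = 0 := by
  have hK := isCompact_rad_le hβ hγ 2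
  rw [← setIntegral_eq_integral_of_forall_compl_eq_zero (s := {p | rad β γ p ≤ 2}) fun p hp => by
    rw [hX.2 _ (not_le.1 hp), mul_zero]]
  refine integral_mul_comp_eq_zero_of_setIntegral_le (hfint.integrableOn_isCompact hK)
    (continuous_rad hβ hγ).measurable (fun x => ?_) hX.1.continuous.measurable
  rw [Measure.restrict_restrict (isCompact_rad_le hβ hγ x).measurableSet, ← ofPred_and]
  simp only [← le_min_iff]
  exact hf.setIntegral_rad_le_eq_zero hβ hγ h1 _

end Radial

section Vanishing

variable {β γ d : ℝ} {u h : ℂ × ℂ → ℝ} {X : ℝ → ℝ}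

lemma integrable_mul_comp_rad (hβ : 0 < β) (hγ : 0 < γ) (hu : LocallyIntegrable u (vol β γ))
    (hX : IsCutoff X) : Integrable (fun p => u p * X (rad β γ p)) (vol β γ) :=
  integrable_mul_of_rad hβ hγ hu (hX.1.continuous.comp (continuous_rad hβ hγ)) fun _ => hX.2 _

lemma integral_mul_comp_sqDist_eq_zero (hβ : 0 < β) (hγ : 0 < γ)
    (hu : LocallyIntegrable u (vol β γ)) (hh : Continuous h) (hX : IsCutoff X)
    (h0 : ∀ k l, moment β γ u h (monomialProfile k l X) = 0) {G : ℝ × ℝ → ℝ} (hG : Continuous G) :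
    ∫ p, u p * X (rad β γ p) * h p * G (sqDist β γ p) ∂vol β γ = 0 := by
  have hsqDist := continuous_sqDist hβ hγ
  let fst : C(ℝ × ℝ, ℝ) := ⟨Prod.fst, continuous_fst⟩
  let snd : C(ℝ × ℝ, ℝ) := ⟨Prod.snd, continuous_snd⟩
  have hM {a : C(ℝ × ℝ, ℝ)} : a ∈ Submonoid.closure {fst, snd} ↔ ∃ k l : ℕ, fst ^ k * snd ^ l = a :=
    Submonoid.mem_closure_pair _ _ _
  refine integral_mul_comp_eq_zero_of_submonoid
    (integrable_mul_comp_of_isCompact (integrable_mul_comp_rad hβ hγ hu hX) measurable_id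
      (isCompact_rad_le hβ hγ 2) (fun p hp => ?_) ⟨h, hh⟩)
    hsqDist.measurable ((isCompact_rad_le hβ hγ 2).image hsqDist) (fun p hp => ?_)
    (Submonoid.closure {fst, snd}) (fun a ha => ?_) (fun x y hxy => ?_) (fun a ha => ?_) ⟨G, hG⟩
  · rw [hX.2 (rad β γ p) (not_le.1 hp), mul_zero]
  · have hp2 : 2 < rad β γ p := not_le.1 fun hle => hp (mem_image_of_mem _ hle)
    rw [hX.2 _ hp2, mul_zero, zero_mul]
  · rwa [star_trivial]
  · exact Prod.ext (hxy fst (Submonoid.subset_closure (.inl rfl)))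
      (hxy snd (Submonoid.subset_closure (.inr rfl)))
  · obtain ⟨k, l, rfl⟩ := hM.1 ha
    rw [← h0 k l]
    refine integral_congr_ae (ae_of_all _ fun p => ?_)
    change u p * X (rad β γ p) * h p * ((sqDist β γ p).1 ^ k * (sqDist β γ p).2 ^ l) =
      u p * (h p * ((sqDist β γ p).1 ^ k * (sqDist β γ p).2 ^ l * X (rad β γ p)))
    ring

lemma coneSq_mul_sq_rpow {α : ℝ} (hα : α ≠ 0) (i : ℕ) (z : ℂ) :
    (coneSq α z * α ^ 2) ^ (i / α) = (‖z‖ ^ 2) ^ i := by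
  rw [coneSq, div_mul_cancel₀ _ (pow_ne_zero 2 hα), ← Real.rpow_mul (norm_nonneg _), ← pow_mul,
    ← Real.rpow_natCast]
  congr 1
  push_cast
  field_simp

lemma integral_mul_norm_sq_pow_eq_zero (hβ : 0 < β) (hγ : 0 < γ)
    (hu : LocallyIntegrable u (vol β γ)) (hh : Continuous h) (hX : IsCutoff X)
    (h0 : ∀ k l, moment β γ u h (monomialProfile k l X) = 0) (i j : ℕ) :
    ∫ p, u p * X (rad β γ p) * h p * ((‖p.1‖ ^ 2) ^ i * (‖p.2‖ ^ 2) ^ j) ∂vol β γ = 0 := by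
  have hpow {α : ℝ} (hα : 0 < α) (i : ℕ) : Continuous fun x : ℝ => (x * α ^ 2) ^ (i / α) :=
    (continuous_mul_const (α ^ 2)).rpow_const fun _ => .inr (by positivity)
  have hzero := integral_mul_comp_sqDist_eq_zero hβ hγ hu hh hX h0
    (((hpow hβ i).comp continuous_fst).mul ((hpow hγ j).comp continuous_snd))
  simpa only [Pi.mul_apply, Function.comp_apply, sqDist, coneSq_mul_sq_rpow hβ.ne',
    coneSq_mul_sq_rpow hγ.ne'] using hzero

lemma exists_pow_mul_conj_pow_eq (a b : ℕ) : ∃ (i m : ℕ) (ζ : ℂ → ℂ), IsPurePower m ζ ∧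
    ∀ z, z ^ a * (starRingEnd ℂ) z ^ b = (((‖z‖ ^ 2) ^ i : ℝ) : ℂ) * ζ z := by
  have hnorm (z : ℂ) (n : ℕ) : (((‖z‖ ^ 2) ^ n : ℝ) : ℂ) = z ^ n * (starRingEnd ℂ) z ^ n := by
    rw [← mul_pow, Complex.mul_conj']
    push_cast
    rfl
  rcases le_total b a with hle | hle
  · obtain ⟨m, rfl⟩ := Nat.exists_eq_add_of_le hle
    exact ⟨b, m, _, isPurePower_pow m, fun z => by rw [hnorm]; ring⟩
  · obtain ⟨m, rfl⟩ := Nat.exists_eq_add_of_le hle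
    exact ⟨a, m, _, isPurePower_conj_pow m, fun z => by rw [hnorm]; ring⟩

lemma integral_eq_zero_of_forall_integral_re {Ω : Type*} [MeasurableSpace Ω] {μ : Measure Ω}
    {f : Ω → ℂ} (hf : Integrable f μ) (h : ∀ c : ℂ, ∫ x, (c * f x).re ∂μ = 0) :
    ∫ x, f x ∂μ = 0 := by
  have hre (c : ℂ) : (c * ∫ x, f x ∂μ).re = 0 := by
    rw [← h c, ← integral_const_mul]
    exact (Complex.reCLM.integral_comp_comm (hf.const_mul c)).symm
  have hsq := hre ((starRingEnd ℂ) (∫ x, f x ∂μ))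
  rwa [mul_comm, Complex.mul_conj, Complex.ofReal_re, Complex.normSq_eq_zero] at hsq

lemma integrable_ofReal_mul_comp_rad_mul (hβ : 0 < β) (hγ : 0 < γ)
    (hu : LocallyIntegrable u (vol β γ)) (hX : IsCutoff X) (g : C(ℂ × ℂ, ℂ)) :
    Integrable (fun p => ((u p * X (rad β γ p) : ℝ) : ℂ) * g p) (vol β γ) := by
  refine integrable_mul_comp_of_isCompact (integrable_mul_comp_rad hβ hγ hu hX).ofReal
    measurable_id (isCompact_rad_le hβ hγ 2) (fun p hp => ?_) g
  rw [hX.2 (rad β γ p) (not_le.1 hp), mul_zero, RCLike.ofReal_zero]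

lemma integral_mul_monomial_eq_zero (hβ : 0 < β) (hγ : 0 < γ) (hu : LocallyIntegrable u (vol β γ))
    (hX : IsCutoff X) (h0 : ∀ m n h, IsBihomogeneousHarmonic m n h →
      ∀ k l, moment β γ u h (monomialProfile k l X) = 0) (a b e f : ℕ) :
    ∫ p, ((u p * X (rad β γ p) : ℝ) : ℂ) * ((p.1 ^ a * (starRingEnd ℂ) p.1 ^ b) *
      (p.2 ^ e * (starRingEnd ℂ) p.2 ^ f)) ∂vol β γ = 0 := by
  have := Complex.continuous_conj
  refine integral_eq_zero_of_forall_integral_re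
    (integrable_ofReal_mul_comp_rad_mul hβ hγ hu hX
      ⟨fun p => p.1 ^ a * (starRingEnd ℂ) p.1 ^ b * (p.2 ^ e * (starRingEnd ℂ) p.2 ^ f),
        by fun_prop⟩) fun c => ?_
  obtain ⟨i, m, ζ, hζ, hfst⟩ := exists_pow_mul_conj_pow_eq a b
  obtain ⟨j, n, η, hη, hsnd⟩ := exists_pow_mul_conj_pow_eq e f
  have hh := isBihomogeneousHarmonic_re hζ hη c
  rw [← integral_mul_norm_sq_pow_eq_zero hβ hγ hu hh.contDiff.continuous hX (h0 m n _ hh) i j]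
  refine integral_congr_ae (ae_of_all _ fun p => ?_)
  dsimp only [ContinuousMap.coe_mk]
  rw [← Complex.re_ofReal_mul, ← Complex.re_mul_ofReal, hfst, hsnd]
  push_cast
  ring_nf

lemma integral_mul_comp_rad_mul_eq_zero (hβ : 0 < β) (hγ : 0 < γ)
    (hu : LocallyIntegrable u (vol β γ)) (hX : IsCutoff X)
    (h0 : ∀ m n h, IsBihomogeneousHarmonic m n h →
      ∀ k l, moment β γ u h (monomialProfile k l X) = 0) (g : C(ℂ × ℂ, ℂ)) :
    ∫ p, ((u p * X (rad β γ p) : ℝ) : ℂ) * g p ∂vol β γ = 0 := by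
  let z : C(ℂ × ℂ, ℂ) := ⟨Prod.fst, continuous_fst⟩
  let w : C(ℂ × ℂ, ℂ) := ⟨Prod.snd, continuous_snd⟩
  let M := Submonoid.closure {z, star z} ⊔ Submonoid.closure {w, star w}
  have hM (a : C(ℂ × ℂ, ℂ)) :
      a ∈ M ↔ ∃ i j k l : ℕ, z ^ i * star z ^ j * (w ^ k * star w ^ l) = a := by
    simp only [M, Submonoid.mem_sup, Submonoid.mem_closure_pair]
    exact ⟨fun ⟨_, ⟨i, j, hb⟩, _, ⟨k, l, hc⟩, ha⟩ => ⟨i, j, k, l, by rw [hb, hc, ha]⟩,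
      fun ⟨i, j, k, l, ha⟩ => ⟨_, ⟨i, j, rfl⟩, _, ⟨k, l, rfl⟩, ha⟩⟩
  refine integral_mul_comp_eq_zero_of_submonoid (integrable_mul_comp_rad hβ hγ hu hX).ofReal
    measurable_id (isCompact_rad_le hβ hγ 2) (fun p hp => ?_) M (fun a ha => ?_)
    (fun x y hxy => ?_) (fun a ha => ?_) g
  · rw [hX.2 (rad β γ p) (not_le.1 hp), mul_zero, RCLike.ofReal_zero]
  · obtain ⟨i, j, k, l, rfl⟩ := (hM a).1 ha
    refine (hM _).2 ⟨j, i, l, k, ?_⟩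
    simp only [star_mul', star_pow, star_star]
    ring
  · exact Prod.ext (hxy z ((hM z).2 ⟨1, 0, 0, 0, by simp⟩)) (hxy w ((hM w).2 ⟨0, 0, 1, 0, by simp⟩))
  · obtain ⟨i, j, k, l, rfl⟩ := (hM a).1 ha
    exact integral_mul_monomial_eq_zero hβ hγ hu hX h0 i j k l

theorem ae_eq_zero_of_rad_lt (hβ : 0 < β) (hγ : 0 < γ) (hu : LocallyIntegrable u (vol β γ))
    (h0 : ∀ m n h, IsBihomogeneousHarmonic m n h →
      ∀ k l X, IsCutoff X → moment β γ u h (monomialProfile k l X) = 0) :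
    ∀ᵐ p : ℂ × ℂ, rad β γ p < 2 → u p = 0 := by
  let X (x : ℝ) : ℝ := Real.smoothTransition (2 - x)
  have hX : IsCutoff X := ⟨Real.smoothTransition.contDiff.comp (contDiff_const.sub contDiff_id),
    fun x hx => Real.smoothTransition.zero_of_nonpos (by linarith)⟩
  have hint := integrable_mul_comp_rad hβ hγ hu hX
  have hzero := ae_eq_zero_of_integral_contDiff_smul_eq_zero
    (integrable_vol_iff.1 hint).locallyIntegrable fun g hg _ => ?_
  · filter_upwards [hzero, ae_density_pos β γ] with p hp hpos hrad
    have hXpos : 0 < X (rad β γ p) := Real.smoothTransition.pos_of_pos (by linarith)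
    exact ((mul_eq_zero.1 ((mul_eq_zero.1 hp).resolve_left hpos.ne')).resolve_right hXpos.ne')
  · have hcomplex := integral_mul_comp_rad_mul_eq_zero hβ hγ hu hX
      (fun m n h hh k l => h0 m n h hh k l X hX) ⟨_, Complex.continuous_ofReal.comp hg.continuous⟩
    have hreal : ∫ p, u p * X (rad β γ p) * g p ∂vol β γ = 0 := by
      rw [← Complex.ofReal_eq_zero, ← integral_complex_ofReal, ← hcomplex]
      push_cast
      rfl
    rw [← hreal, integral_vol]
    refine integral_congr_ae (ae_of_all _ fun p => ?_)
    simp only [smul_eq_mul]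
    ring

lemma quasiMeasurePreserving_dilation {t : ℝ} (ht : 0 < t) :
    Measure.QuasiMeasurePreserving (dilation β γ t) := by
  have hdet : LinearMap.det (dilationLinearMap β γ t) ≠ 0 := by
    rw [det_dilationLinearMap ht]
    exact (Real.rpow_pos_of_pos ht _).ne'
  rw [← coe_dilationLinearMap]
  exact ⟨(LinearMap.continuous_of_finiteDimensional _).measurable,
    (Measure.map_linearMap_addHaar_eq_smul_addHaar volume hdet).absolutelyContinuous.trans
      Measure.smul_absolutelyContinuous⟩

lemma IsHomogeneous.ae_eq_zero (hβ : β ≠ 0) (hγ : γ ≠ 0) (hu : IsHomogeneous β γ d u) {r : ℝ}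
    (hr : 0 < r) (h : ∀ᵐ p : ℂ × ℂ, rad β γ p < r → u p = 0) : u =ᵐ[volume] 0 := by
  obtain ⟨δ, -, hδ, hlim⟩ := exists_seq_strictAnti_tendsto (0 : ℝ)
  have hnear (n : ℕ) := (quasiMeasurePreserving_dilation (β := β) (γ := γ) (hδ n)).ae h
  filter_upwards [ae_all_iff.2 hnear, ae_all_iff.2 fun n => hu _ (hδ n)] with p hnear hhom
  have hsmall : Tendsto (fun n => δ n ^ 2 * rad β γ p) atTop (𝓝 0) := by
    simpa using (hlim.pow 2).mul_const (rad β γ p)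
  obtain ⟨n, hn⟩ := (hsmall.eventually (gt_mem_nhds hr)).exists
  have hzero := hnear n (by rwa [rad_dilation hβ hγ (hδ n)])
  rw [hhom n] at hzero
  exact (mul_eq_zero.1 hzero).resolve_left (Real.rpow_pos_of_pos (hδ n) d).ne'

end Vanishing

/-! ### The explicit functions -/

section ExplicitList

variable {β γ d : ℝ} {m n : ℕ} {h v : ℂ × ℂ → ℝ}

lemma isBihomogeneousHarmonic_of_mem_reIm {ζ η : ℂ → ℂ} {f : ℂ × ℂ → ℂ} (hζ : IsPurePower m ζ)
    (hη : IsPurePower n η) (hf : ∀ p, f p = ζ p.1 * η p.2) (hv : v ∈ reIm f) :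
    IsBihomogeneousHarmonic m n v := by
  obtain rfl | rfl := hv
  · simpa only [hf, one_mul] using isBihomogeneousHarmonic_re hζ hη 1
  · have him (c : ℂ) : c.im = (-Complex.I * c).re := by simp
    simpa only [hf, him] using isBihomogeneousHarmonic_re hζ hη (-Complex.I)

lemma isBihomogeneousHarmonic_or_eq_quadHarm (hv : v ∈ explicitList β γ) :
    (∃ m n : ℕ, m / β + n / γ ≤ 2 ∧ IsBihomogeneousHarmonic m n v) ∨ v = quadHarm β γ := by
  have half {α : ℝ} (h : 1 / 2 ≤ α) : 1 / α ≤ 2 := by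
    simpa using one_div_le_one_div_of_le one_half_pos h
  have pow := isPurePower_pow
  have conj := isPurePower_conj_pow
  rcases hv with rfl | ⟨hβ, h⟩ | ⟨rfl, h⟩ | ⟨hγ, h⟩ | ⟨rfl, h⟩ | ⟨rfl, rfl, h⟩ | ⟨rfl, rfl, h⟩ | rfl
  · exact .inl ⟨0, 0, by simp, isBihomogeneousHarmonic_const 1⟩
  · exact .inl ⟨1, 0, by simpa using half hβ,
      isBihomogeneousHarmonic_of_mem_reIm (pow 1) (pow 0) (fun p => by simp) h⟩
  · exact .inl ⟨2, 0, by simp,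
      isBihomogeneousHarmonic_of_mem_reIm (pow 2) (pow 0) (fun p => by simp) h⟩
  · exact .inl ⟨0, 1, by simpa using half hγ,
      isBihomogeneousHarmonic_of_mem_reIm (pow 0) (pow 1) (fun p => by simp) h⟩
  · exact .inl ⟨0, 2, by simp,
      isBihomogeneousHarmonic_of_mem_reIm (pow 0) (pow 2) (fun p => by simp) h⟩
  · exact .inl ⟨1, 1, by norm_num,
      isBihomogeneousHarmonic_of_mem_reIm (pow 1) (pow 1) (fun p => by simp) h⟩
  · exact .inl ⟨1, 1, by norm_num,
      isBihomogeneousHarmonic_of_mem_reIm (pow 1) (conj 1) (fun p => by simp) h⟩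
  · exact .inr rfl

lemma isSubquadraticHarmonic_of_mem_explicitList (hβ : 0 < β) (hβ1 : β ≤ 1) (hγ : 0 < γ)
    (hγ1 : γ ≤ 1) (hv : v ∈ explicitList β γ) : IsSubquadraticHarmonic β γ v := by
  obtain ⟨m, n, hmn, hv⟩ | rfl := isBihomogeneousHarmonic_or_eq_quadHarm hv
  · exact ⟨hv.isHarmonic hβ hβ1 hγ hγ1, _, by positivity, hmn, hv.isHomogeneous⟩
  · exact ⟨isHarmonic_quadHarm hβ hβ1 hγ hγ1, 2, zero_le_two, le_rfl,
      isHomogeneous_quadHarm hβ.ne' hγ.ne'⟩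

lemma finite_explicitList (β γ : ℝ) : (explicitList β γ).Finite := by
  have hreIm (f : ℂ × ℂ → ℂ) : (reIm f).Finite := toFinite {_, _}
  refine ((((((((finite_singleton fun _ => 1).union (hreIm fun p => p.1)).union
    (hreIm fun p => p.1 ^ 2)).union (hreIm fun p => p.2)).union (hreIm fun p => p.2 ^ 2)).union
    (hreIm fun p => p.1 * p.2)).union (hreIm fun p => p.1 * (starRingEnd ℂ) p.2)).union
    (finite_singleton (quadHarm β γ))).subset fun v hv => ?_
  simp only [explicitList, mem_ofPred_eq] at hv
  simp only [mem_union, mem_singleton_iff]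
  tauto

lemma exists_re_mul_harmPoly (m : ℕ) : ∃ ξ : ℂ, ∀ a z,
    harmPoly m a z = harmPoly m a 1 * (z ^ m).re + harmPoly m a ξ * (z ^ m).im := by
  rcases eq_or_ne m 0 with rfl | hm
  · exact ⟨0, fun a z => by simp [harmPoly]⟩
  · obtain ⟨ξ, hξ⟩ := IsAlgClosed.exists_pow_nat_eq Complex.I (Nat.pos_of_ne_zero hm)
    refine ⟨ξ, fun a z => ?_⟩
    simp only [harmPoly, hξ, one_pow, mul_one, Complex.mul_re, Complex.I_re, Complex.I_im]
    ring

lemma IsBihomogeneousHarmonic.mem_span_reIm (hh : IsBihomogeneousHarmonic m n h) :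
    h ∈ Submodule.span ℝ (reIm (fun p => p.1 ^ m * p.2 ^ n) ∪
      reIm fun p => p.1 ^ m * (starRingEnd ℂ) p.2 ^ n) := by
  obtain ⟨ξ, hξ⟩ := exists_re_mul_harmPoly m
  obtain ⟨b, hb⟩ := hh.exists_snd 1
  obtain ⟨c, hc⟩ := hh.exists_snd ξ
  have heq : h = ((b.re + c.im) / 2) • (fun p => (p.1 ^ m * p.2 ^ n).re) +
      ((c.re - b.im) / 2) • (fun p => (p.1 ^ m * p.2 ^ n).im) +
      (((b.re - c.im) / 2) • (fun p => (p.1 ^ m * (starRingEnd ℂ) p.2 ^ n).re) +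
      ((b.im + c.re) / 2) • (fun p => (p.1 ^ m * (starRingEnd ℂ) p.2 ^ n).im)) := by
    ext ⟨z, w⟩
    obtain ⟨a, ha⟩ := hh.exists_fst w
    rw [ha, hξ, ← ha, ← ha, hb, hc]
    simp only [harmPoly, ← map_pow, Complex.mul_re, Complex.mul_im, Complex.conj_re,
      Complex.conj_im, Pi.add_apply, Pi.smul_apply, smul_eq_mul]
    ring
  have mem {v} (hv : v ∈ reIm (fun p => p.1 ^ m * p.2 ^ n) ∪
    reIm fun p => p.1 ^ m * (starRingEnd ℂ) p.2 ^ n) (c : ℝ) :=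
    Submodule.smul_mem _ c (Submodule.subset_span (R := ℝ) hv)
  rw [heq]
  exact add_mem (add_mem (mem (.inl (.inl rfl)) _) (mem (.inl (.inr rfl)) _))
    (add_mem (mem (.inr (.inl rfl)) _) (mem (.inr (.inr rfl)) _))

lemma reIm_conj_subset_span (f : ℂ × ℂ → ℂ) :
    reIm (fun p => (starRingEnd ℂ) (f p)) ⊆ Submodule.span ℝ (reIm f) := by
  rintro _ (rfl | rfl)
  · simp only [Complex.conj_re]
    exact Submodule.subset_span (.inl rfl)
  · simp only [Complex.conj_im]
    exact neg_mem (Submodule.subset_span (.inr rfl))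

lemma exponents_of_degree_le_two (hβ : 0 < β) (hβ1 : β ≤ 1) (hγ : 0 < γ) (hγ1 : γ ≤ 1)
    (hmn : m / β + n / γ ≤ 2) :
    m = 0 ∧ n = 0 ∨ (m = 1 ∧ n = 0 ∧ 1 / 2 ≤ β) ∨ (m = 2 ∧ n = 0 ∧ β = 1) ∨
      (m = 0 ∧ n = 1 ∧ 1 / 2 ≤ γ) ∨ (m = 0 ∧ n = 2 ∧ γ = 1) ∨ (m = 1 ∧ n = 1 ∧ β = 1 ∧ γ = 1) := by
  have hm : (m : ℝ) ≤ m / β := le_div_self m.cast_nonneg hβ hβ1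
  have hn : (n : ℝ) ≤ n / γ := le_div_self n.cast_nonneg hγ hγ1
  have hle : m + n ≤ 2 := by
    rify
    linarith
  have half_le {α : ℝ} (hα : 0 < α) (h : 1 / α ≤ 2) : 1 / 2 ≤ α := (one_div_le hα two_pos).1 h
  have eq_one {α k : ℝ} (hα : 0 < α) (hα1 : α ≤ 1) (hk : 0 < k) (h : k / α ≤ k) : α = 1 :=
    le_antisymm hα1 ((le_mul_iff_one_le_right hk).1 ((div_le_iff₀ hα).1 h))
  obtain ⟨rfl, rfl⟩ | ⟨rfl, rfl⟩ | ⟨rfl, rfl⟩ | ⟨rfl, rfl⟩ | ⟨rfl, rfl⟩ | ⟨rfl, rfl⟩ :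
      m = 0 ∧ n = 0 ∨ m = 1 ∧ n = 0 ∨ m = 2 ∧ n = 0 ∨ m = 0 ∧ n = 1 ∨ m = 0 ∧ n = 2 ∨
        m = 1 ∧ n = 1 := by
    omega
  all_goals norm_num at hmn hm hn ⊢
  · exact half_le hβ (by simpa using hmn)
  · exact eq_one hβ hβ1 two_pos hmn
  · exact half_le hγ (by simpa using hmn)
  · exact eq_one hγ hγ1 two_pos hmn
  · exact ⟨eq_one hβ hβ1 one_pos (by rw [one_div]; linarith),
      eq_one hγ hγ1 one_pos (by rw [one_div]; linarith)⟩

/-- The span of those explicit functions that are homogeneous of degree `d`. -/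
def explicitSpan (β γ d : ℝ) : Submodule ℝ (ℂ × ℂ → ℝ) :=
  Submodule.span ℝ {v ∈ explicitList β γ | IsHomogeneous β γ d v}

lemma const_mem_explicitSpan (β γ c : ℝ) : (fun _ => c) ∈ explicitSpan β γ 0 := by
  have hone : (fun _ => 1) ∈ explicitSpan β γ 0 := Submodule.subset_span
    ⟨.inl rfl, by simpa using (isBihomogeneousHarmonic_const 1).isHomogeneous (β := β) (γ := γ)⟩
  simpa only [Pi.smul_def, smul_eq_mul, mul_one] using Submodule.smul_mem _ c hone

lemma reIm_subset_explicitSpan {ζ η : ℂ → ℂ} (hζ : IsPurePower m ζ) (hη : IsPurePower n η)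
    (hsub : reIm (fun p => ζ p.1 * η p.2) ⊆ explicitList β γ) :
    reIm (fun p => ζ p.1 * η p.2) ⊆ explicitSpan β γ (m / β + n / γ) := fun _ hv =>
  Submodule.subset_span
    ⟨hsub hv, (isBihomogeneousHarmonic_of_mem_reIm hζ hη (fun _ => rfl) hv).isHomogeneous⟩

lemma IsBihomogeneousHarmonic.mem_explicitSpan_of_reIm_subset (hh : IsBihomogeneousHarmonic m n h)
    (hpow : reIm (fun p => p.1 ^ m * p.2 ^ n) ⊆ explicitList β γ)
    (hconj : m ≠ 0 → reIm (fun p => p.1 ^ m * (starRingEnd ℂ) p.2 ^ n) ⊆ explicitList β γ) :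
    h ∈ explicitSpan β γ (m / β + n / γ) := by
  have hpow' := reIm_subset_explicitSpan (isPurePower_pow m) (isPurePower_pow n) hpow
  refine Submodule.span_le.2 (union_subset hpow' ?_) hh.mem_span_reIm
  rcases eq_or_ne m 0 with rfl | hm
  · refine Subset.trans ?_ (Submodule.span_le.2 hpow')
    simpa only [pow_zero, one_mul, map_pow] using
      reIm_conj_subset_span fun p : ℂ × ℂ => p.2 ^ n
  · exact reIm_subset_explicitSpan (isPurePower_pow m) (isPurePower_conj_pow n) (hconj hm)

lemma IsBihomogeneousHarmonic.mem_explicitSpan (hβ : 0 < β) (hβ1 : β ≤ 1) (hγ : 0 < γ)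
    (hγ1 : γ ≤ 1) (hh : IsBihomogeneousHarmonic m n h) (hmn : m / β + n / γ ≤ 2) :
    h ∈ explicitSpan β γ (m / β + n / γ) := by
  rcases exponents_of_degree_le_two hβ hβ1 hγ hγ1 hmn with ⟨rfl, rfl⟩ | ⟨rfl, rfl, hβ2⟩ |
    ⟨rfl, rfl, rfl⟩ | ⟨rfl, rfl, hγ2⟩ | ⟨rfl, rfl, rfl⟩ | ⟨rfl, rfl, rfl, rfl⟩
  · obtain ⟨c, rfl⟩ := hh.exists_eq_const
    simpa using const_mem_explicitSpan β γ c
  all_goals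
    refine hh.mem_explicitSpan_of_reIm_subset (fun v hv => ?_) fun hm v hv => ?_
    all_goals
      simp only [pow_zero, pow_one, mul_one, one_mul] at hv
      simp_all [explicitList]

end ExplicitList

/-! ### Projection onto the explicit functions -/

lemma exists_mem_span_orthogonal_sub {Ω : Type*} [MeasurableSpace Ω] {μ : Measure Ω}
    {S : Set (Ω → ℝ)} (hfin : S.Finite) (hS : ∀ v ∈ S, MemLp v 2 μ) {u : Ω → ℝ}
    (hu : MemLp u 2 μ) :
    ∃ w ∈ Submodule.span ℝ S, ∀ v ∈ Submodule.span ℝ S, ∫ x, (u x - w x) * v x ∂μ = 0 := by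
  have hV (v : Submodule.span ℝ S) : MemLp v.1 2 μ := by
    refine Submodule.span_induction (p := fun v _ => MemLp v 2 μ) hS MemLp.zero
      (fun _ _ _ _ hv hw => hv.add hw) (fun c _ _ hv => hv.const_smul c) v.2
  have : FiniteDimensional ℝ (Submodule.span ℝ S) := .span_of_finite ℝ hfin
  let T : Submodule.span ℝ S →ₗ[ℝ] Lp ℝ 2 μ :=
    { toFun := fun v => (hV v).toLp
      map_add' := fun _ _ => rfl
      map_smul' := fun _ _ => rfl }
  obtain ⟨w, hw⟩ := (LinearMap.range T).starProjection_apply_mem hu.toLp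
  refine ⟨w, w.2, fun v hv => ?_⟩
  have horth := Submodule.inner_left_of_mem_orthogonal (LinearMap.mem_range_self T ⟨v, hv⟩)
    ((LinearMap.range T).sub_starProjection_mem_orthogonal hu.toLp)
  rw [← hw, real_inner_comm, L2.inner_def] at horth
  rw [← horth]
  refine integral_congr_ae ?_
  filter_upwards [hu.coeFn_toLp, (hV w).coeFn_toLp, (hV ⟨v, hv⟩).coeFn_toLp,
    Lp.coeFn_sub hu.toLp (T w)] with x hux hwx hvx hsub
  have hTw : T w x = w.1 x := hwx
  have hTv : T ⟨v, hv⟩ x = v x := hvx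
  simp only [hTv, hsub, Pi.sub_apply, hux, hTw, RCLike.inner_apply, conj_trivial]

section Projection

variable {β γ d : ℝ} {u v : ℂ × ℂ → ℝ}

/-- The functions that are homogeneous of degree `d`. -/
def homogeneousFunctions (β γ d : ℝ) : Submodule ℝ (ℂ × ℂ → ℝ) where
  carrier := {u | IsHomogeneous β γ d u}
  zero_mem' := fun _ _ => ae_of_all _ fun _ => (mul_zero _).symm
  add_mem' := fun hu hv t ht => by
    filter_upwards [hu t ht, hv t ht] with p hup hvp
    rw [Pi.add_apply, Pi.add_apply, hup, hvp, mul_add]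
  smul_mem' := fun c u hu t ht => by
    filter_upwards [hu t ht] with p hup
    rw [Pi.smul_apply, Pi.smul_apply, hup, smul_eq_mul, smul_eq_mul, mul_left_comm]

lemma explicitSpan_le_homogeneousFunctions : explicitSpan β γ d ≤ homogeneousFunctions β γ d :=
  Submodule.span_le.2 fun _ hv => hv.2

lemma explicitSpan_le_veryWeakSolutions (hβ : 0 < β) (hβ1 : β ≤ 1) (hγ : 0 < γ) (hγ1 : γ ≤ 1) :
    explicitSpan β γ d ≤ veryWeakSolutions β γ :=
  Submodule.span_le.2 fun _ hv =>
    (isSubquadraticHarmonic_of_mem_explicitList hβ hβ1 hγ hγ1 hv.1).1.mem_veryWeakSolutions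
      hβ hβ1 hγ hγ1

lemma quadHarm_mem_explicitSpan (hβ : β ≠ 0) (hγ : γ ≠ 0) : quadHarm β γ ∈ explicitSpan β γ 2 :=
  Submodule.subset_span ⟨by simp only [explicitList]; tauto, isHomogeneous_quadHarm hβ hγ⟩

lemma IsHarmonic.memLp_two (hu : IsHarmonic β γ u) {K : Set (ℂ × ℂ)} (hK : IsCompact K) :
    MemLp u 2 ((vol β γ).restrict K) := by
  obtain ⟨G, hG, -⟩ := hu
  exact (memLp_two_iff_integrable_sq (hG.1.1.aestronglyMeasurable.mono_ac
    (Measure.restrict_le_self.absolutelyContinuous.trans (vol_absolutelyContinuous β γ)))).2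
    (hG.2.1.integrableOn_isCompact hK)

theorem ae_eq_zero_of_orthogonal_explicitSpan (hβ : 0 < β) (hβ1 : β ≤ 1) (hγ : 0 < γ) (hγ1 : γ ≤ 1)
    (hd : d ≤ 2) (hu : u ∈ veryWeakSolutions β γ) (hud : IsHomogeneous β γ d u)
    (horth : ∀ v ∈ explicitSpan β γ d, ∫ p in {p | rad β γ p ≤ 1}, u p * v p ∂vol β γ = 0) :
    u =ᵐ[volume] 0 := by
  have hzero (v) (hv : v ∈ explicitSpan β γ d) (hcont : Continuous v) (X) (hX : IsCutoff X) :
      ∫ p, u p * (v p * X (rad β γ p)) ∂vol β γ = 0 := by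
    simp only [← mul_assoc]
    exact (hud.mul (explicitSpan_le_homogeneousFunctions hv)).integral_mul_comp_rad_eq_zero hβ hγ
      (hu.1.mul_continuous hcont) (horth v hv) hX
  refine hud.ae_eq_zero hβ.ne' hγ.ne' two_pos (ae_eq_zero_of_rad_lt hβ hγ hu.1 ?_)
  intro m n h hh k l X hX
  refine moment_monomialProfile_eq_zero hβ hβ1 hγ hγ1 hd hu hud hh ?_ ?_ k l hX
  · rintro rfl
    exact hzero h (hh.mem_explicitSpan hβ hβ1 hγ hγ1 hd) hh.contDiff.continuous
  · rintro rfl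
    exact hzero _ (quadHarm_mem_explicitSpan hβ.ne' hγ.ne') (continuous_quadHarm hβ hγ)

theorem exists_mem_explicitSpan_ae_eq (hβ : 0 < β) (hβ1 : β ≤ 1) (hγ : 0 < γ) (hγ1 : γ ≤ 1)
    (hd : d ≤ 2) (hu : IsHarmonic β γ u) (hud : IsHomogeneous β γ d u) :
    ∃ w ∈ explicitSpan β γ d, u =ᵐ[volume] w := by
  have hball := isCompact_rad_le hβ hγ 1
  obtain ⟨w, hw, horth⟩ := exists_mem_span_orthogonal_sub
    ((finite_explicitList β γ).subset (sep_subset _ (IsHomogeneous β γ d)))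
    (fun v hv => (isSubquadraticHarmonic_of_mem_explicitList hβ hβ1 hγ hγ1 hv.1).1.memLp_two hball)
    (hu.memLp_two hball)
  have hsol : u - w ∈ veryWeakSolutions β γ := sub_mem (hu.mem_veryWeakSolutions hβ hβ1 hγ hγ1)
    (explicitSpan_le_veryWeakSolutions hβ hβ1 hγ hγ1 hw)
  have hhom : u - w ∈ homogeneousFunctions β γ d :=
    sub_mem hud (explicitSpan_le_homogeneousFunctions hw)
  refine ⟨w, hw, ?_⟩
  filter_upwards [ae_eq_zero_of_orthogonal_explicitSpan hβ hβ1 hγ hγ1 hd hsol hhom horth] with p hp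
  exact sub_eq_zero.1 hp

end Projection

/-! ### The span in `L²` -/

section SpanL2

variable {β γ R : ℝ} {u : ℂ × ℂ → ℝ}

lemma rho_eq_sqrt_rad (β γ : ℝ) (p : ℂ × ℂ) : rho β γ p = √(rad β γ p) := by
  have hsq (α : ℝ) (z : ℂ) : (‖z‖ ^ α / α) ^ 2 = coneSq α z := by
    rw [coneSq, div_pow, ← Real.rpow_mul_natCast (norm_nonneg z), mul_comm 2 α, Nat.cast_ofNat]
  rw [rho, hsq, hsq, rad, sqDist]

lemma IsHarmonic.memLp_two_ballVol (hβ : 0 < β) (hγ : 0 < γ) (hu : IsHarmonic β γ u) (R : ℝ) :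
    MemLp u 2 (ballVol β γ R) := by
  refine (hu.memLp_two (isCompact_rad_le hβ hγ (R ^ 2))).mono_measure
    (Measure.restrict_mono (fun p (hp : rho β γ p < R) => ?_) le_rfl)
  rw [rho_eq_sqrt_rad] at hp
  exact (Real.sqrt_le_left ((Real.sqrt_nonneg _).trans hp.le)).1 hp.le

lemma ballVol_absolutelyContinuous (β γ R : ℝ) : ballVol β γ R ≪ volume :=
  Measure.restrict_le_self.absolutelyContinuous.trans (vol_absolutelyContinuous β γ)

lemma mem_spanL2_of_ae_eq {S : Set (ℂ × ℂ → ℝ)} (hS : ∀ v ∈ S, MemLp v 2 (ballVol β γ R))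
    {w : ℂ × ℂ → ℝ} (hw : w ∈ Submodule.span ℝ S) {f : Lp ℝ 2 (ballVol β γ R)}
    (hf : f =ᵐ[ballVol β γ R] w) : f ∈ spanL2 β γ R S := by
  obtain ⟨g, hg, hgw⟩ : ∃ g ∈ spanL2 β γ R S, g =ᵐ[ballVol β γ R] w := by
    clear hf
    induction hw using Submodule.span_induction with
    | mem v hv =>
      have hclass := (hS v hv).coeFn_toLp
      exact ⟨(hS v hv).toLp, Submodule.subset_span ⟨v, hv, hclass⟩, hclass⟩
    | zero => exact ⟨0, zero_mem _, Lp.coeFn_zero _ _ _⟩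
    | add v w _ _ hv hw =>
      obtain ⟨f, hf, hfv⟩ := hv
      obtain ⟨g, hg, hgw⟩ := hw
      exact ⟨f + g, add_mem hf hg, (Lp.coeFn_add f g).trans (hfv.add hgw)⟩
    | smul c v _ hv =>
      obtain ⟨f, hf, hfv⟩ := hv
      exact ⟨c • f, Submodule.smul_mem _ c hf, (Lp.coeFn_smul c f).trans (hfv.const_smul c)⟩
  rwa [Lp.ext (hf.trans hgw.symm)]

end SpanL2

end ConeProduct

end

theorem mainTheorem9 (β γ : ℝ) (hβ : 0 < β) (hβ1 : β ≤ 1) (hγ : 0 < γ) (hγ1 : γ ≤ 1) :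
    (∀ v ∈ ConeProduct.explicitList β γ, ConeProduct.IsSubquadraticHarmonic β γ v) ∧
    ∀ R : ℝ, 0 < R →
      ConeProduct.subquadraticHarmonics β γ R =
        ConeProduct.spanL2 β γ R (ConeProduct.explicitList β γ) := by
  have hlist : ∀ v ∈ ConeProduct.explicitList β γ, ConeProduct.IsSubquadraticHarmonic β γ v :=
    fun v => ConeProduct.isSubquadraticHarmonic_of_mem_explicitList hβ hβ1 hγ hγ1
  refine ⟨hlist, fun R _ => le_antisymm (Submodule.span_le.2 ?_) (Submodule.span_mono ?_)⟩
  · rintro f ⟨u, ⟨hu, d, -, hd, hud⟩, hfu⟩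
    obtain ⟨w, hw, huw⟩ := ConeProduct.exists_mem_explicitSpan_ae_eq hβ hβ1 hγ hγ1 hd hu hud
    exact ConeProduct.mem_spanL2_of_ae_eq
      (fun v hv => (hlist v hv).1.memLp_two_ballVol hβ hγ R)
      (Submodule.span_mono (fun _ hv => hv.1) hw)
      (hfu.trans ((ConeProduct.ballVol_absolutelyContinuous β γ R).ae_eq huw))
  · rintro f ⟨v, hv, hfv⟩
    exact ⟨v, hlist v hv, hfv⟩
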